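/- Write $\Delta=\partial_x^2+\partial_y^2+\partial_z^2$ and $\Delta^{(2)}=\partial_x^2\partial_y^2+\partial_y^2\partial_z^2+\partial_x^2\partial_z^2$ on $\mathbb R^3$, and set $$D_1=\tfrac{25}{6}\Big[\partial_t^2-\tfrac13\Delta\partial_t+\tfrac{5}{54}\Delta^{(2)}\Big],\qquad D_2=\tfrac{125}{18}\Big[\partial_t^3-\tfrac13\Delta\partial_t^2+\tfrac{25}{216}\Delta^{(2)}\partial_t-\tfrac{25}{432}\partial_x^2\partial_y^2\partial_z^2\Big],$$ $$D_3=\tfrac{625}{108}\Big[\partial_t^4-\tfrac{5}{18}\Delta\partial_t^3+\tfrac{5}{72}\Delta^{(2)}\partial_t^2\Big],\qquad D_4=\tfrac{3125}{1296}\Big[\partial_t^5-\tfrac16\Delta\partial_t^4\Big],\qquad D_5=\tfrac{3125}{7776}\,\partial_t^6,$$ and $D_j=0$ for $j\ge 6$. For $\varepsilon>0$ consider the equation $$\Big\{\partial_t-\tfrac{5}{18}\Delta+\varepsilon^2D_1+\varepsilon^4D_2+\varepsilon^6D_3+\varepsilon^8D_4+\varepsilon^{10}D_5\Big\}f=0,\qquad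 t>0. \tag{8}$$ (This is $\tfrac{3125}{7776}\varepsilon^{10}\det(L_6)f=0$, where $L_6$ has diagonal entries $\partial_t\pm\varepsilon^{-1}\partial_{x_i}+\varepsilon^{-2}$, $i=1,2,3$, and all off-diagonal entries $-\varepsilon^{-2}/5$.) Call a function on $\mathbb R^3$ admissible if it is smooth and bounded together with each of its derivatives. Call a function of $(t,x,y,z)$, $t\ge0$, admissible if it is continuous for $t\ge 0$, smooth for $t>0$, and each of its derivatives is bounded on every strip $0<t\le T$. Let $\varepsilon_0>0$, let $\varphi_0,\varphi_1,\dots$ and $g^\varepsilon$ ($0<\varepsilon<\varepsilon_0$) be admissible functions on $\mathbb R^3$, and suppose that $g^\varepsilon\sim\varphi_0+\varepsilon^2\varphi_1+\varepsilon^4\varphi_2+\cdots$ as $\varepsilon\to0^+$, uniformly on $\mathbb R^3$ together with all derivatives; that is, each derivative of $g^\varepsilon-\sum_{k=0}^{N}\varepsilon^{2k}\varphi_k$ is $O(\varepsilon^{2N+2})$ uniformly on $\mathbb R^3$, for every $N\ge 0$. A regular solution of (8) with initial data $g^\varepsilon$ is a family $(f^\varepsilon)_{0<\varepsilon<\varepsilon_0}$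 of admissible functions such that $f^\varepsilon$ satisfies (8) for $t>0$, $f^\varepsilon(0,\cdot)=g^\varepsilon$, and each derivative (in $t,x,y,z$) of $f^\varepsilon$ stays bounded on each strip $0<t\le T$, uniformly as $\varepsilon\to0^+$. Then: 1. There is a sequence of admissible functions $u_0,u_1,\dots$, unique for $t\ge0$, with $u_k(0,\cdot)=\varphi_k$ and, for $t>0$, $$\partial_tu_0=\tfrac{5}{18}\Delta u_0,\qquad \partial_tu_k=\tfrac{5}{18}\Delta u_k-\sum_{j=0}^{k-1}D_{k-j}u_j\quad(k\ge1).$$ 2. A regular solution of (8) with initial data $g^\varepsilon$ exists. 3. Every regular solution $f^\varepsilon$ of (8) with initial data $g^\varepsilon$ has the asymptotic expansion $f^\varepsilon\sim u_0+\varepsilon^2u_1+\varepsilon^4u_2+\cdots$ as $\varepsilon\to0^+$ (for every $N\ge0$ and $T>0$, each derivative of $f^\varepsilon-\sum_{k=0}^N\varepsilon^{2k}u_k$ is $O(\varepsilon^{2N+2})$ uniformly for $0<t\le T$ and $(x,y,z)\in\mathbb R^3$); and conversely, the coefficients of any such expansion of $f^\varepsilon$ with admissible coefficients are a solution of the system in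 1. -/

import Mathlib

open Set Filter Topology
open scoped ContDiff

noncomputable section

namespace RandomMotion

/-- Three-dimensional Euclidean space. -/
abbrev Space : Type := EuclideanSpace ℝ (Fin 3)

/-- The partial derivative in the `i`-th coordinate direction of a function on space. -/
def pd (i : Fin 3) (φ : Space → ℝ) : Space → ℝ :=
  fun x => lineDeriv ℝ φ x (EuclideanSpace.single i 1)

/-- The spatial derivative of multi-order `α`. -/
def pdMulti (α : Fin 3 → ℕ) (φ : Space → ℝ) : Space → ℝ :=
  (pd 0)^[α 0] ((pd 1)^[α 1] ((pd 2)^[α 2] φ))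

/-- `∂/∂t` for functions of time and space. -/
def dt (u : ℝ → Space → ℝ) : ℝ → Space → ℝ :=
  fun t x => deriv (fun s => u s x) t

/-- `∂/∂xᵢ` for functions of time and space. -/
def dx (i : Fin 3) (u : ℝ → Space → ℝ) : ℝ → Space → ℝ :=
  fun t => pd i (u t)

/-- The mixed derivative of order `m` in time and multi-order `α` in space. -/
def mixedDeriv (m : ℕ) (α : Fin 3 → ℕ) (u : ℝ → Space → ℝ) : ℝ → Space → ℝ :=
  dt^[m] (fun t => pdMulti α (u t))

/-- `Δ = ∂²/∂x² + ∂²/∂y² + ∂²/∂z²`. -/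
def lap (u : ℝ → Space → ℝ) : ℝ → Space → ℝ :=
  dx 0 (dx 0 u) + dx 1 (dx 1 u) + dx 2 (dx 2 u)

/-- `Δ⁽²⁾ = ∂⁴/∂x²∂y² + ∂⁴/∂y²∂z² + ∂⁴/∂x²∂z²`. -/
def lap2 (u : ℝ → Space → ℝ) : ℝ → Space → ℝ :=
  dx 0 (dx 0 (dx 1 (dx 1 u))) + dx 1 (dx 1 (dx 2 (dx 2 u))) + dx 0 (dx 0 (dx 2 (dx 2 u)))

/-- `∂⁶/∂x²∂y²∂z²`. -/
def lap3 (u : ℝ → Space → ℝ) : ℝ → Space → ℝ :=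
  dx 0 (dx 0 (dx 1 (dx 1 (dx 2 (dx 2 u)))))

/-- The coefficient operators of `ε², ε⁴, ε⁶, ε⁸, ε¹⁰` in the regularized equation
(there are no further ones). -/
def corr : ℕ → (ℝ → Space → ℝ) → ℝ → Space → ℝ
  | 1, u => (25 / 6 : ℝ) • (dt^[2] u - (1 / 3 : ℝ) • lap (dt u) + (5 / 54 : ℝ) • lap2 u)
  | 2, u => (125 / 18 : ℝ) • (dt^[3] u - (1 / 3 : ℝ) • lap (dt^[2] u)
      + (25 / 216 : ℝ) • lap2 (dt u) - (25 / 432 : ℝ) • lap3 u)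
  | 3, u => (625 / 108 : ℝ) • (dt^[4] u - (5 / 18 : ℝ) • lap (dt^[3] u)
      + (5 / 72 : ℝ) • lap2 (dt^[2] u))
  | 4, u => (3125 / 1296 : ℝ) • (dt^[5] u - (1 / 6 : ℝ) • lap (dt^[4] u))
  | 5, u => (3125 / 7776 : ℝ) • dt^[6] u
  | _, _ => 0

/-- The operator of the regularized equation: it is `(3125 / 7776) ε¹⁰ det L₆`, where `L₆` is the
operator matrix with diagonal entries `∂/∂t ± ε⁻¹ ∂/∂xᵢ + ε⁻²` (`i = 1, 2, 3`, both signs) and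
off-diagonal entries `-ε⁻² / 5`. -/
def regOp (ε : ℝ) (u : ℝ → Space → ℝ) : ℝ → Space → ℝ :=
  dt u - (5 / 18 : ℝ) • lap u + ∑ j ∈ Finset.Icc 1 5, ε ^ (2 * j) • corr j u

/-- Smooth functions on space, bounded together with each of their derivatives. -/
def SmoothBddData (φ : Space → ℝ) : Prop :=
  ContDiff ℝ ∞ φ ∧ ∀ α : Fin 3 → ℕ, ∃ C : ℝ, ∀ x, |pdMulti α φ x| ≤ C

/-- Functions that are continuous for `t ≥ 0` and smooth for `t > 0`, each derivative being bounded
on every strip `0 < t ≤ T`. Values at `t < 0` play no role. -/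
structure SmoothBdd (u : ℝ → Space → ℝ) : Prop where
  continuousOn : ContinuousOn (fun p : ℝ × Space => u p.1 p.2) (Ici 0 ×ˢ univ)
  contDiffOn : ContDiffOn ℝ ∞ (fun p : ℝ × Space => u p.1 p.2) (Ioi 0 ×ˢ univ)
  bounded : ∀ (T : ℝ) (m : ℕ) (α : Fin 3 → ℕ), ∃ C : ℝ,
    ∀ t ∈ Ioc 0 T, ∀ x, |mixedDeriv m α u t x| ≤ C

/-- `w ε = O(ε ^ p)` as `ε → 0+`, with all derivatives, uniformly on every strip `0 < t ≤ T`. -/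
def UniformBigO (w : ℝ → ℝ → Space → ℝ) (p : ℕ) : Prop :=
  ∀ (T : ℝ) (m : ℕ) (α : Fin 3 → ℕ), ∃ C : ℝ, ∀ᶠ ε in 𝓝[>] (0 : ℝ),
    ∀ t ∈ Ioc 0 T, ∀ x, |mixedDeriv m α (w ε) t x| ≤ C * ε ^ p

/-- `g ε ∼ φ₀ + ε² φ₁ + ε⁴ φ₂ + …` as `ε → 0+`, uniformly on space with all derivatives. -/
def HasDataExpansion (g : ℝ → Space → ℝ) (φ : ℕ → Space → ℝ) : Prop :=
  ∀ (N : ℕ) (α : Fin 3 → ℕ), ∃ C : ℝ, ∀ᶠ ε in 𝓝[>] (0 : ℝ), ∀ x,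
    |pdMulti α (g ε - ∑ k ∈ Finset.range (N + 1), ε ^ (2 * k) • φ k) x| ≤ C * ε ^ (2 * (N + 1))

/-- `f ε ∼ u₀ + ε² u₁ + ε⁴ u₂ + …` as `ε → 0+`, with all derivatives, uniformly on strips. -/
structure HasExpansion (f : ℝ → ℝ → Space → ℝ) (u : ℕ → ℝ → Space → ℝ) : Prop where
  coeff : ∀ k, SmoothBdd (u k)
  remainder : ∀ N : ℕ, UniformBigO
    (fun ε => f ε - ∑ k ∈ Finset.range (N + 1), ε ^ (2 * k) • u k) (2 * (N + 1))

/-- `f ε`, `0 < ε < ε₀`, is a regular family of solutions of the regularized equation with initial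
values `g ε`: each derivative stays bounded as `ε → 0+` (there is no initial layer). -/
structure IsRegularSolution (ε₀ : ℝ) (g : ℝ → Space → ℝ) (f : ℝ → ℝ → Space → ℝ) : Prop where
  smooth : ∀ ε ∈ Ioo 0 ε₀, SmoothBdd (f ε)
  equation : ∀ ε ∈ Ioo 0 ε₀, ∀ t > 0, ∀ x, regOp ε (f ε) t x = 0
  initial : ∀ ε ∈ Ioo 0 ε₀, ∀ x, f ε 0 x = g ε x
  regular : UniformBigO f 0

/-- The recursive system for the coefficients of the expansion, with initial values `φ k`. -/
structure SolvesHierarchy (φ : ℕ → Space → ℝ) (u : ℕ → ℝ → Space → ℝ) : Prop where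
  smooth : ∀ k, SmoothBdd (u k)
  initial : ∀ k x, u k 0 x = φ k x
  leading : ∀ t > 0, ∀ x, dt (u 0) t x = 5 / 18 * lap (u 0) t x
  higher : ∀ k ≥ 1, ∀ t > 0, ∀ x, dt (u k) t x =
    5 / 18 * lap (u k) t x - ∑ j ∈ Finset.range k, corr (k - j) (u j) t x

end RandomMotion

end

/-! The equation is a singular perturbation of the heat equation: it is of order six in `t`, but
only one initial value is prescribed. Uniform boundedness of all derivatives replaces the five
missing conditions. Let `d` be the difference of two regular solutions. Its initial value is zero,
and the heat operator maps it to minus the sum of the terms `ε ^ (2 * j) D_j d`. If `d` is `O(ε ^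
p)` with all derivatives, this source is `O(ε ^ (p + 2))`, and the maximum principle gives the same
order for `d` and its space derivatives; the heat operator then gives the time derivatives. By
iteration `d` is small of every order (`bigO_of_regSymb_smul_eq_zero`). Hence all regular solutions
share the expansion of any single one, and coefficients of an expansion are unique
(`HasBEvoExpansion.unique`).

It remains to construct one regular solution with the right expansion (`exists_regular_solution`).
The heat flow turns the heat operator into `∂/∂t`, so the hierarchy is solved by integration in time
(`hier`). A Borel sum of its solutions (`exists_bigO_sub_sum`), with its initial value corrected,
satisfies the equation up to a source `R` that is small of every order. This source is removed by
`exists_regSymb_smul_eq`. Put `b = ε⁻² / 5` and let `L_j = ∂/∂t + c_j ∂ + 6b` be the six transport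
operators. Up to a constant multiple of `ε ^ 10`, the operator is `∏ L_j - b ∑_j ∏_{k ≠ j} L_k`
(`regSymb_eq`), so a multiple of `∏ L_j⁻¹ S` solves the equation as soon as `S = R + b ∑ L_j⁻¹ S`.
The loss rate `6b` balances the six gains `b`, and therefore `S` grows only linearly: `|S| ≤ sup |R|
(1 + 6bt)` (`exists_renewal`). All losses are powers of `ε⁻¹`, which a source small of every order
absorbs.

Admissible functions on `t > 0` form a module `BEvo` over the polynomials in the derivatives, so
that differential operators are multiplications by symbols. Initial values are encoded by `trace`,
which exists because time derivatives are bounded. -/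

noncomputable section

namespace RandomMotion

/-! ### Smooth functions on the half-space as a module over differential operators. -/

/-- The open half-space `t > 0`. -/
abbrev posHalf : Set (ℝ × Space) := Ioi 0 ×ˢ univ

lemma isOpen_posHalf : IsOpen posHalf := isOpen_Ioi.prod isOpen_univ

lemma mem_posHalf {t : ℝ} {x : Space} : (t, x) ∈ posHalf ↔ 0 < t := by simp

/-- Smooth functions on the half-space `t > 0`, extended by zero. -/
def smoothFunctions : Submodule ℝ (ℝ → Space → ℝ) where
  carrier := {u | (∀ t ≤ 0, ∀ x, u t x = 0) ∧
    ContDiffOn ℝ ∞ (fun p : ℝ × Space => u p.1 p.2) posHalf}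
  add_mem' := fun {u v} hu hv => ⟨fun t ht x => by simp [hu.1 t ht x, hv.1 t ht x], hu.2.add hv.2⟩
  zero_mem' := ⟨fun _ _ _ => rfl, contDiffOn_const⟩
  smul_mem' := fun c u hu => ⟨fun t ht x => by simp [hu.1 t ht x],
    ContDiffOn.smul (f := fun _ => c) contDiffOn_const hu.2⟩

/-- The space of smooth functions on the half-space `t > 0`, extended by zero. -/
def Evo : Type := smoothFunctions

instance : AddCommGroup Evo := inferInstanceAs (AddCommGroup smoothFunctions)
instance : Module ℝ Evo := inferInstanceAs (Module ℝ smoothFunctions)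
instance : CoeFun Evo (fun _ => ℝ → Space → ℝ) := ⟨fun u => u.1⟩

lemma mem_smoothFunctions {u : ℝ → Space → ℝ} : u ∈ smoothFunctions ↔ (∀ t ≤ 0, ∀ x, u t x = 0) ∧
    ContDiffOn ℝ ∞ (fun p : ℝ × Space => u p.1 p.2) posHalf := Iff.rfl

namespace Evo

lemma zero_of_nonpos (u : Evo) {t : ℝ} (ht : t ≤ 0) (x : Space) : u t x = 0 :=
  (mem_smoothFunctions.1 u.2).1 t ht x

lemma contDiffOn (u : Evo) : ContDiffOn ℝ ∞ (fun p : ℝ × Space => u p.1 p.2) posHalf :=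
  (mem_smoothFunctions.1 u.2).2

lemma ext {u v : Evo} (h : ∀ t > 0, ∀ x, u t x = v t x) : u = v := by
  apply Subtype.ext
  funext t x
  rcases lt_or_ge 0 t with ht | ht
  · exact h t ht x
  · exact (u.zero_of_nonpos ht x).trans (v.zero_of_nonpos ht x).symm

lemma contDiffAt (u : Evo) {t : ℝ} (ht : 0 < t) (x : Space) :
    ContDiffAt ℝ ∞ (fun p : ℝ × Space => u p.1 p.2) (t, x) :=
  u.contDiffOn.contDiffAt (isOpen_posHalf.mem_nhds (mem_posHalf.2 ht))

@[simp] lemma add_apply (u v : Evo) (t : ℝ) (x : Space) : (u + v) t x = u t x + v t x := rfl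
@[simp] lemma zero_apply (t : ℝ) (x : Space) : (0 : Evo) t x = 0 := rfl
@[simp] lemma smul_apply (c : ℝ) (u : Evo) (t : ℝ) (x : Space) : (c • u) t x = c * u t x := rfl

/-- Evaluation at a point, as a linear map. -/
def evalAt (t : ℝ) (x : Space) : Evo →ₗ[ℝ] ℝ where
  toFun u := u t x
  map_add' _ _ := rfl
  map_smul' _ _ := rfl

lemma sum_apply {ι : Type*} (s : Finset ι) (u : ι → Evo) (t : ℝ) (x : Space) :
    (∑ i ∈ s, u i) t x = ∑ i ∈ s, u i t x :=
  map_sum (evalAt t x) u s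

/-- The function that agrees with `u` for `t > 0` and vanishes for `t ≤ 0`. -/
def mk' (u : ℝ → Space → ℝ) (hu : ContDiffOn ℝ ∞ (fun p : ℝ × Space => u p.1 p.2) posHalf) : Evo :=
  ⟨fun t x => if 0 < t then u t x else 0, mem_smoothFunctions.2 ⟨fun _ ht _ => if_neg ht.not_gt,
    hu.congr fun _ hp => if_pos (mem_posHalf.1 hp)⟩⟩

lemma mk'_apply {u : ℝ → Space → ℝ} (hu) {t : ℝ} (ht : 0 < t) (x : Space) :
    mk' u hu t x = u t x := if_pos ht

/-- The derivative in the direction `v`. -/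
def dirDeriv (v : ℝ × Space) : Evo →ₗ[ℝ] Evo where
  toFun u := mk' (fun t x => fderiv ℝ (fun p : ℝ × Space => u p.1 p.2) (t, x) v)
    ((u.contDiffOn.fderiv_of_isOpen isOpen_posHalf (m := ∞) (by simp)).clm_apply contDiffOn_const)
  map_add' u w := ext fun t ht x => by
    simp only [mk'_apply _ ht, add_apply]
    rw [fderiv_fun_add ((u.contDiffAt ht x).differentiableAt (by simp))
      ((w.contDiffAt ht x).differentiableAt (by simp))]
    rfl
  map_smul' c u := ext fun t ht x => by
    simp only [mk'_apply _ ht, smul_apply, RingHom.id_apply]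
    rw [fderiv_const_mul ((u.contDiffAt ht x).differentiableAt (by simp))]
    rfl

lemma dirDeriv_apply (v : ℝ × Space) (u : Evo) {t : ℝ} (ht : 0 < t) (x : Space) :
    dirDeriv v u t x = fderiv ℝ (fun p : ℝ × Space => u p.1 p.2) (t, x) v :=
  mk'_apply (u := fun t x => fderiv ℝ (fun p : ℝ × Space => u p.1 p.2) (t, x) v)
    ((u.contDiffOn.fderiv_of_isOpen isOpen_posHalf (m := ∞) (by simp)).clm_apply contDiffOn_const)
    ht x

/-- Symmetry of second derivatives. It is what allows commutative polynomial rings to act. -/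
lemma dirDeriv_comm (v w : ℝ × Space) : dirDeriv v * dirDeriv w = dirDeriv w * dirDeriv v := by
  have key : ∀ (v w : ℝ × Space) (u : Evo) (t : ℝ), 0 < t → ∀ x, dirDeriv v (dirDeriv w u) t x =
      fderiv ℝ (fderiv ℝ (fun p : ℝ × Space => u p.1 p.2)) (t, x) v w := by
    intro v w u t ht x
    rw [dirDeriv_apply _ _ ht]
    have h1 : (fun p : ℝ × Space => dirDeriv w u p.1 p.2) =ᶠ[𝓝 (t, x)]
        fun p => fderiv ℝ (fun p : ℝ × Space => u p.1 p.2) p w := by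
      filter_upwards [isOpen_posHalf.mem_nhds (mem_posHalf.2 ht)] with p hp
      exact dirDeriv_apply _ _ (mem_posHalf.1 hp) _
    rw [h1.fderiv_eq, fderiv_clm_apply _ (by fun_prop)]
    · simp
    · exact ((u.contDiffAt ht x).fderiv_right (m := 1)
        (WithTop.coe_le_coe.2 le_top)).differentiableAt (by simp)
  ext1 u
  refine ext fun t ht x => ?_
  rw [Module.End.mul_apply, Module.End.mul_apply, key v w u t ht, key w v u t ht]
  exact ((u.contDiffAt ht x).isSymmSndFDerivAt (by
    simp [minSmoothness_of_isRCLikeNormedField]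
    exact WithTop.coe_le_coe.2 le_top)) v w

end Evo

/-- Polynomials in the space derivatives. -/
abbrev SpacePoly : Type := MvPolynomial (Fin 3) ℝ

/-- Polynomials in the time derivative (the variable) and the space derivatives. -/
abbrev Symb : Type := Polynomial SpacePoly

namespace Evo

/-- The unit vector of the `i`-th space direction in space-time. -/
def spaceDir (i : Fin 3) : ℝ × Space := (0, EuclideanSpace.single i 1)

/-- The space derivatives. -/
def spaceDerivs : Set (Module.End ℝ Evo) := range fun i => dirDeriv (spaceDir i)

/-- The action of polynomials in the space derivatives. -/
def spaceAction : SpacePoly →ₐ[ℝ] Module.End ℝ Evo :=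
  -- Evaluation of polynomials needs a commutative target, which `Module.End` is not; it takes place
  -- in the subalgebra generated by the commuting space derivatives.
  haveI : IsMulCommutative (Algebra.adjoin ℝ spaceDerivs) :=
    Algebra.isMulCommutative_adjoin ℝ (by
      rintro _ ⟨i, rfl⟩ _ ⟨j, rfl⟩
      exact dirDeriv_comm _ _)
  letI : CommRing (Algebra.adjoin ℝ spaceDerivs) :=
    { (Algebra.adjoin ℝ spaceDerivs).toRing with mul_comm := mul_comm' }
  (Algebra.adjoin ℝ spaceDerivs).val.comp
    (MvPolynomial.aeval fun i => ⟨dirDeriv (spaceDir i), Algebra.subset_adjoin ⟨i, rfl⟩⟩)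

lemma spaceAction_X (i : Fin 3) : spaceAction (MvPolynomial.X i) = dirDeriv (spaceDir i) := by
  simp [spaceAction]

instance : Module SpacePoly Evo := Module.compHom Evo spaceAction.toRingHom

lemma spacePoly_smul_def (q : SpacePoly) (u : Evo) : q • u = spaceAction q u := rfl

instance : IsScalarTower ℝ SpacePoly Evo := ⟨fun c q u => by
  simp [spacePoly_smul_def]⟩

lemma X_smul (i : Fin 3) (u : Evo) :
    (MvPolynomial.X i : SpacePoly) • u = dirDeriv (spaceDir i) u := by
  rw [spacePoly_smul_def, spaceAction_X]

end Evo

/-- A linear map that commutes with the space derivatives commutes with all polynomials in them. -/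
lemma map_spacePoly_smul {M N : Type*} [AddCommGroup M] [AddCommGroup N] [Module ℝ M] [Module ℝ N]
    [Module SpacePoly M] [Module SpacePoly N] [IsScalarTower ℝ SpacePoly M]
    [IsScalarTower ℝ SpacePoly N] (f : M →ₗ[ℝ] N)
    (hf : ∀ i u, f ((MvPolynomial.X i : SpacePoly) • u) = (MvPolynomial.X i : SpacePoly) • f u)
    (q : SpacePoly) (u : M) : f (q • u) = q • f u := by
  induction q using MvPolynomial.induction_on generalizing u with
  | C a =>
    have h : (MvPolynomial.C a : SpacePoly) = a • 1 := by
      rw [MvPolynomial.smul_eq_C_mul, mul_one]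
    rw [h, smul_assoc, smul_assoc, one_smul, one_smul, map_smul]
  | add p q hp hq => rw [add_smul, add_smul, map_add, hp, hq]
  | mul_X p i hp => rw [mul_smul, mul_smul, hp, hf]

namespace Evo

/-- The time derivative. -/
def timeDeriv : Evo →ₗ[SpacePoly] Evo where
  toFun := dirDeriv (1, 0)
  map_add' := map_add _
  map_smul' q u := map_spacePoly_smul _ (fun i u => by
    rw [X_smul, X_smul]
    exact LinearMap.congr_fun (dirDeriv_comm _ _) u) q u

instance : Module Symb Evo :=
  Module.compHom Evo (Polynomial.aeval (R := SpacePoly) timeDeriv).toRingHom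

lemma symb_smul_def (P : Symb) (u : Evo) : P • u = Polynomial.aeval timeDeriv P u := rfl

instance : IsScalarTower SpacePoly Symb Evo := ⟨fun c q u => by
  simp [symb_smul_def]⟩

instance : IsScalarTower ℝ Symb Evo := ⟨fun c q u => by
  rw [← smul_one_smul SpacePoly c q, smul_assoc, smul_assoc, one_smul]⟩

lemma symbX_smul (u : Evo) : (Polynomial.X : Symb) • u = dirDeriv (1, 0) u := by
  rw [symb_smul_def, Polynomial.aeval_X]; rfl

lemma C_smul (q : SpacePoly) (u : Evo) : (Polynomial.C q : Symb) • u = q • u := by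
  rw [symb_smul_def, Polynomial.aeval_C]; rfl

end Evo

/-- The linear functional with the given coordinates. -/
def gradCLM (v : Fin 3 → ℝ) : Space →L[ℝ] ℝ := ∑ i, v i • EuclideanSpace.proj i

lemma gradCLM_apply (v : Fin 3 → ℝ) (y : Space) : gradCLM v y = ∑ i, v i * y i := by
  simp [gradCLM]

lemma clm_eq_gradCLM (L : Space →L[ℝ] ℝ) :
    L = gradCLM fun i => L (EuclideanSpace.single i 1) := by
  ext y
  conv_lhs => rw [← (EuclideanSpace.basisFun (Fin 3) ℝ).sum_repr y]
  simp [gradCLM_apply, mul_comm]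

lemma norm_gradCLM_le (v : Fin 3 → ℝ) : ‖gradCLM v‖ ≤ ∑ i, |v i| := by
  refine (norm_sum_le _ _).trans (Finset.sum_le_sum fun i _ => ?_)
  rw [norm_smul, Real.norm_eq_abs]
  refine mul_le_of_le_one_right (abs_nonneg _) ?_
  refine ContinuousLinearMap.opNorm_le_bound _ zero_le_one fun y => ?_
  rw [one_mul]
  exact PiLp.norm_apply_le y i

/-! ### Bounds on strips and the module `BEvo`. -/

/-- `|u| ≤ C` on the strip `0 < t ≤ T`. -/
def StripBdd (T C : ℝ) (u : ℝ → Space → ℝ) : Prop := ∀ t ∈ Ioc 0 T, ∀ x, |u t x| ≤ C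

lemma StripBdd.mono {T C C' : ℝ} {u : ℝ → Space → ℝ} (h : StripBdd T C u) (hC : C ≤ C') :
    StripBdd T C' u := fun t ht x => (h t ht x).trans hC

lemma StripBdd.add {T C C' : ℝ} {u v : Evo} (h : StripBdd T C u) (h' : StripBdd T C' v) :
    StripBdd T (C + C') (u + v : Evo) := fun t ht x =>
  (abs_add_le _ _).trans (add_le_add (h t ht x) (h' t ht x))

lemma StripBdd.smul {T C : ℝ} {u : Evo} (h : StripBdd T C u) (c : ℝ) :
    StripBdd T (|c| * C) (c • u : Evo) := fun t ht x => by
  rw [Evo.smul_apply, abs_mul]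
  exact mul_le_mul_of_nonneg_left (h t ht x) (abs_nonneg _)

lemma stripBdd_zero {T C : ℝ} (hC : 0 ≤ C) : StripBdd T C (0 : Evo) := fun t _ x => by
  simpa using hC

/-- The monomial of order `α` in the space derivatives. -/
def spaceMonomial (α : Fin 3 → ℕ) : SpacePoly :=
  MvPolynomial.X 0 ^ α 0 * MvPolynomial.X 1 ^ α 1 * MvPolynomial.X 2 ^ α 2

/-- The symbol of the mixed derivative of order `m` in time and `α` in space. -/
def symbMonomial (m : ℕ) (α : Fin 3 → ℕ) : Symb :=
  Polynomial.X ^ m * Polynomial.C (spaceMonomial α)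

lemma spacePoly_induction {p : SpacePoly → Prop} (hadd : ∀ P Q, p P → p Q → p (P + Q))
    (hmon : ∀ (c : ℝ) α, p (c • spaceMonomial α)) (P : SpacePoly) : p P := by
  induction P using MvPolynomial.induction_on' with
  | add P Q hP hQ => exact hadd _ _ hP hQ
  | monomial s a =>
    have : MvPolynomial.monomial s a = a • spaceMonomial s := by
      rw [MvPolynomial.monomial_eq, MvPolynomial.smul_eq_C_mul, spaceMonomial,
        Finsupp.prod_fintype _ _ (by simp), Fin.prod_univ_three]
    rw [this]; exact hmon _ _

lemma symb_induction {p : Symb → Prop} (hadd : ∀ P Q, p P → p Q → p (P + Q))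
    (hmon : ∀ (c : ℝ) m α, p (c • symbMonomial m α)) (P : Symb) : p P := by
  induction P using Polynomial.induction_on' with
  | add P Q hP hQ => exact hadd _ _ hP hQ
  | monomial n a =>
    induction a using spacePoly_induction with
    | hadd P Q hP hQ => rw [map_add]; exact hadd _ _ hP hQ
    | hmon c α =>
      have : Polynomial.monomial n (c • spaceMonomial α) = c • symbMonomial n α := by
        rw [← Polynomial.smul_monomial, symbMonomial, mul_comm, Polynomial.C_mul_X_pow_eq_monomial]
      rw [this]; exact hmon _ _ _

/-- The smooth functions that are bounded on strips together with all derivatives. -/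
def bddFunctions : Submodule Symb Evo where
  carrier := {u | ∀ (P : Symb) (T : ℝ), ∃ C, StripBdd T C (P • u : Evo)}
  add_mem' := fun {u v} hu hv P T => by
    obtain ⟨C, hC⟩ := hu P T
    obtain ⟨C', hC'⟩ := hv P T
    exact ⟨C + C', by rw [smul_add]; exact hC.add hC'⟩
  zero_mem' := fun P T => ⟨0, by rw [smul_zero]; exact stripBdd_zero le_rfl⟩
  smul_mem' := fun Q u hu P T => by
    obtain ⟨C, hC⟩ := hu (P * Q) T
    exact ⟨C, by rwa [mul_smul] at hC⟩

/-- Smooth functions for `t > 0`, bounded on strips together with all derivatives. -/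
def BEvo : Type := bddFunctions

instance : AddCommGroup BEvo := inferInstanceAs (AddCommGroup bddFunctions)
instance : Module ℝ BEvo := inferInstanceAs (Module ℝ bddFunctions)
instance : Module SpacePoly BEvo := inferInstanceAs (Module SpacePoly bddFunctions)
instance : Module Symb BEvo := inferInstanceAs (Module Symb bddFunctions)
instance : IsScalarTower ℝ SpacePoly BEvo := inferInstanceAs (IsScalarTower ℝ SpacePoly bddFunctions)
instance : IsScalarTower ℝ Symb BEvo := inferInstanceAs (IsScalarTower ℝ Symb bddFunctions)
instance : IsScalarTower SpacePoly Symb BEvo :=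
  inferInstanceAs (IsScalarTower SpacePoly Symb bddFunctions)
instance : CoeFun BEvo (fun _ => ℝ → Space → ℝ) := ⟨fun u => u.1.1⟩

lemma mem_bddFunctions_of_monomials {u : Evo}
    (h : ∀ (T : ℝ) m α, ∃ C, StripBdd T C (symbMonomial m α • u : Evo)) : u ∈ bddFunctions := by
  intro P
  induction P using symb_induction with
  | hadd P Q hP hQ =>
    intro T
    obtain ⟨C, hC⟩ := hP T
    obtain ⟨C', hC'⟩ := hQ T
    exact ⟨C + C', by rw [add_smul]; exact hC.add hC'⟩
  | hmon c m α =>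
    intro T
    obtain ⟨C, hC⟩ := h T m α
    exact ⟨_, by rw [smul_assoc]; exact hC.smul c⟩

namespace Evo

lemma hasFDerivAt (u : Evo) {t : ℝ} (ht : 0 < t) (x : Space) :
    HasFDerivAt (fun p : ℝ × Space => u p.1 p.2)
      (fderiv ℝ (fun p : ℝ × Space => u p.1 p.2) (t, x)) (t, x) :=
  ((u.contDiffAt ht x).differentiableAt (by simp)).hasFDerivAt

lemma hasDerivAt_time (u : Evo) {t : ℝ} (ht : 0 < t) (x : Space) :
    HasDerivAt (fun s => u s x) (((Polynomial.X : Symb) • u : Evo) t x) t := by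
  rw [symbX_smul, dirDeriv_apply _ _ ht]
  have h : HasDerivAt (fun s : ℝ => (s, x)) ((1, 0) : ℝ × Space) t :=
    (hasDerivAt_id t).prodMk (hasDerivAt_const t x)
  exact (u.hasFDerivAt ht x).comp_hasDerivAt t h

lemma hasFDerivAt_space (u : Evo) {t : ℝ} (ht : 0 < t) (x : Space) :
    HasFDerivAt (u t) (gradCLM fun i => ((MvPolynomial.X i : SpacePoly) • u : Evo) t x) x := by
  have h : HasFDerivAt (fun y : Space => (t, y)) (ContinuousLinearMap.inr ℝ ℝ Space) x :=
    (hasFDerivAt_const t x).prodMk (hasFDerivAt_id x)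
  have h2 := (u.hasFDerivAt ht x).comp x h
  rw [clm_eq_gradCLM (ContinuousLinearMap.comp _ _)] at h2
  simp only [X_smul, dirDeriv_apply _ _ ht, spaceDir]
  exact h2

end Evo

/-! ### Smoothness and bounds from closure under first derivatives. -/

/-- A set of functions on the half-space `t > 0`, bounded on strips, that contains the first
derivatives of its members. -/
structure IsSmoothClass (S : Set (ℝ → Space → ℝ)) : Prop where
  zero : ∀ u ∈ S, ∀ t ≤ 0, ∀ x, u t x = 0
  bdd : ∀ u ∈ S, ∀ T, ∃ C, StripBdd T C u
  time : ∀ u ∈ S, ∃ v ∈ S, ∀ t > 0, ∀ x, HasDerivAt (fun s => u s x) (v t x) t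
  space : ∀ u ∈ S, ∃ v : Fin 3 → ℝ → Space → ℝ, (∀ i, v i ∈ S) ∧
    ∀ t > 0, ∀ x, HasFDerivAt (u t) (gradCLM fun i => v i t x) x

namespace IsSmoothClass

variable {S : Set (ℝ → Space → ℝ)}

/-- Each `u t` is continuous in space, and the bounded time derivative makes `u` Lipschitz in time
uniformly in space; together this is joint continuity. -/
lemma cont (hS : IsSmoothClass S) {u : ℝ → Space → ℝ} (hu : u ∈ S) :
    ContinuousOn (fun p : ℝ × Space => u p.1 p.2) posHalf := by
  obtain ⟨v₀, hv₀, h₀⟩ := hS.time u hu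
  obtain ⟨v, -, h⟩ := hS.space u hu
  rintro ⟨t₀, x₀⟩ hp
  have ht₀ : 0 < t₀ := mem_posHalf.1 hp
  obtain ⟨C, hC⟩ := hS.bdd v₀ hv₀ (t₀ + 1)
  refine ContinuousAt.continuousWithinAt ?_
  have h1 : Tendsto (fun p : ℝ × Space => u t₀ p.2 - u t₀ x₀) (𝓝 (t₀, x₀)) (𝓝 0) := by
    have := ((h t₀ ht₀ x₀).continuousAt.tendsto.comp
      (continuous_snd.tendsto (t₀, x₀))).sub_const (u t₀ x₀)
    simpa using this
  have h2 : Tendsto (fun p : ℝ × Space => u p.1 p.2 - u t₀ p.2) (𝓝 (t₀, x₀)) (𝓝 0) := by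
    have hb : Tendsto (fun p : ℝ × Space => C * |p.1 - t₀|) (𝓝 (t₀, x₀)) (𝓝 0) := by
      have : Continuous fun p : ℝ × Space => C * |p.1 - t₀| := by fun_prop
      simpa using this.tendsto (t₀, x₀)
    refine squeeze_zero_norm' ?_ hb
    have hmem : ∀ᶠ p : ℝ × Space in 𝓝 (t₀, x₀), p.1 ∈ Ioo 0 (t₀ + 1) :=
      (continuous_fst.tendsto (t₀, x₀)).eventually (Ioo_mem_nhds ht₀ (by simp))
    filter_upwards [hmem] with p hp
    exact (convex_Ioo 0 (t₀ + 1)).norm_image_sub_le_of_norm_hasDerivWithin_le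
      (f := fun s => u s p.2) (f' := fun s => v₀ s p.2)
      (fun s hs => (h₀ s hs.1 p.2).hasDerivWithinAt) (fun s hs => hC s ⟨hs.1, hs.2.le⟩ p.2)
      ⟨ht₀, by simp⟩ hp
  have h3 := (h2.add h1).add_const (u t₀ x₀)
  simpa [ContinuousAt] using h3

/-- The partial derivatives belong to the class, so they are jointly continuous by `cont`, and
continuous partial derivatives give a total derivative. -/
lemma hasFDerivAt (hS : IsSmoothClass S) {u v₀ : ℝ → Space → ℝ} {v : Fin 3 → ℝ → Space → ℝ}
    (hv₀ : v₀ ∈ S) (hv : ∀ i, v i ∈ S)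
    (h₀ : ∀ t > 0, ∀ x, HasDerivAt (fun s => u s x) (v₀ t x) t)
    (h : ∀ t > 0, ∀ x, HasFDerivAt (u t) (gradCLM fun i => v i t x) x)
    {p : ℝ × Space} (hp : p ∈ posHalf) :
    HasFDerivAt (fun p : ℝ × Space => u p.1 p.2)
      ((ContinuousLinearMap.toSpanSingleton ℝ (v₀ p.1 p.2)).coprod
        (gradCLM fun i => v i p.1 p.2)) p := by
  have hnear : ∀ᶠ q in 𝓝 p, q ∈ posHalf := isOpen_posHalf.mem_nhds hp
  have hc : ∀ w ∈ S, ContinuousAt (fun p : ℝ × Space => w p.1 p.2) p := fun w hw =>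
    (hS.cont hw).continuousAt hnear
  refine HasStrictFDerivAt.hasFDerivAt (hasStrictFDerivAt_uncurry_coprod (f := u)
    (f₁ := fun t x => ContinuousLinearMap.toSpanSingleton ℝ (v₀ t x))
    (f₂ := fun t x => gradCLM fun i => v i t x) ?_ ?_ ?_ ?_)
  · filter_upwards [hnear] with q hq
    exact (h₀ q.1 (mem_posHalf.1 hq) q.2).hasFDerivAt
  · filter_upwards [hnear] with q hq
    exact h q.1 (mem_posHalf.1 hq) q.2
  · exact (ContinuousLinearMap.toSpanSingletonCLE (𝕜 := ℝ) (E := ℝ)).continuous.continuousAt.comp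
      (hc v₀ hv₀)
  · have : ContinuousAt (fun q : ℝ × Space =>
        ∑ i, v i q.1 q.2 • (EuclideanSpace.proj i : Space →L[ℝ] ℝ)) p :=
      tendsto_finsetSum _ fun i _ => (hc _ (hv i)).smul tendsto_const_nhds
    exact this

/-- Induction on the order of differentiability: the total derivative is assembled linearly from
members of the class. -/
lemma contDiffOn (hS : IsSmoothClass S) {u : ℝ → Space → ℝ} (hu : u ∈ S) :
    ContDiffOn ℝ ∞ (fun p : ℝ × Space => u p.1 p.2) posHalf := by
  rw [contDiffOn_infty]
  intro n
  induction n generalizing u with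
  | zero => exact contDiffOn_zero.2 (hS.cont hu)
  | succ n ih =>
    obtain ⟨v₀, hv₀, h₀⟩ := hS.time u hu
    obtain ⟨v, hv, h⟩ := hS.space u hu
    have hd := fun p hp => hS.hasFDerivAt hv₀ hv h₀ h (p := p) hp
    rw [Nat.cast_succ, contDiffOn_succ_iff_fderiv_of_isOpen isOpen_posHalf]
    refine ⟨fun p hp => (hd p hp).differentiableAt.differentiableWithinAt, by simp, ?_⟩
    refine ContDiffOn.congr ?_ fun p hp => (hd p hp).fderiv
    have e : ∀ p : ℝ × Space, (ContinuousLinearMap.toSpanSingleton ℝ (v₀ p.1 p.2)).coprod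
        (gradCLM fun i => v i p.1 p.2) = v₀ p.1 p.2 • ContinuousLinearMap.fst ℝ ℝ Space +
        ∑ i, v i p.1 p.2 • (EuclideanSpace.proj i : Space →L[ℝ] ℝ).comp
          (ContinuousLinearMap.snd ℝ ℝ Space) := by
      intro p
      ext <;> simp [gradCLM]
    simp only [e]
    exact ((ih hv₀).smul contDiffOn_const).add
      (ContDiffOn.sum fun i _ => (ih (hv i)).smul contDiffOn_const)

lemma mem_bddFunctions (hS : IsSmoothClass S) {u : Evo} (hu : u.1 ∈ S) : u ∈ bddFunctions := by
  have htime : ∀ w : Evo, w.1 ∈ S → ((Polynomial.X : Symb) • w : Evo).1 ∈ S := by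
    intro w hw
    obtain ⟨v, hv, h⟩ := hS.time w.1 hw
    convert hv using 1
    funext t x
    rcases lt_or_ge 0 t with ht | ht
    · exact (w.hasDerivAt_time ht x).unique (h t ht x)
    · rw [Evo.zero_of_nonpos _ ht, hS.zero v hv t ht]
  have hspace : ∀ i, ∀ w : Evo, w.1 ∈ S → ((MvPolynomial.X i : SpacePoly) • w : Evo).1 ∈ S := by
    intro i w hw
    obtain ⟨v, hv, h⟩ := hS.space w.1 hw
    convert hv i using 1
    funext t x
    rcases lt_or_ge 0 t with ht | ht
    · have := congrArg (fun L : Space →L[ℝ] ℝ => L (EuclideanSpace.single i 1))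
        ((w.hasFDerivAt_space ht x).unique (h t ht x))
      simpa [gradCLM_apply] using this
    · rw [Evo.zero_of_nonpos _ ht, hS.zero _ (hv i) t ht]
  have hspacePow : ∀ i n, ∀ w : Evo, w.1 ∈ S →
      ((MvPolynomial.X i ^ n : SpacePoly) • w : Evo).1 ∈ S := by
    intro i n
    induction n with
    | zero => intro w hw; simpa using hw
    | succ n ih => intro w hw; rw [pow_succ, mul_smul]; exact ih _ (hspace _ _ hw)
  have htimePow : ∀ n, ∀ w : Evo, w.1 ∈ S → ((Polynomial.X ^ n : Symb) • w : Evo).1 ∈ S := by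
    intro n
    induction n with
    | zero => intro w hw; simpa using hw
    | succ n ih => intro w hw; rw [pow_succ, mul_smul]; exact ih _ (htime _ hw)
  refine mem_bddFunctions_of_monomials fun T m α => ?_
  rw [symbMonomial, mul_smul, Evo.C_smul, spaceMonomial, mul_smul, mul_smul]
  exact hS.bdd _ (htimePow _ _ (hspacePow _ _ _ (hspacePow _ _ _ (hspacePow _ _ _ hu)))) T

/-- A member of a smooth class, as a bundled function. -/
def toBEvo (hS : IsSmoothClass S) {u : ℝ → Space → ℝ} (hu : u ∈ S) : BEvo :=
  ⟨⟨u, mem_smoothFunctions.2 ⟨hS.zero u hu, hS.contDiffOn hu⟩⟩, hS.mem_bddFunctions hu⟩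

end IsSmoothClass

namespace BEvo

lemma ext {u v : BEvo} (h : ∀ t > 0, ∀ x, u t x = v t x) : u = v := Subtype.ext (Evo.ext h)

@[simp] lemma add_apply (u v : BEvo) (t : ℝ) (x : Space) : (u + v) t x = u t x + v t x := rfl
@[simp] lemma sub_apply (u v : BEvo) (t : ℝ) (x : Space) : (u - v) t x = u t x - v t x := rfl
@[simp] lemma zero_apply (t : ℝ) (x : Space) : (0 : BEvo) t x = 0 := rfl
@[simp] lemma smul_apply (c : ℝ) (u : BEvo) (t : ℝ) (x : Space) : (c • u) t x = c * u t x := rfl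

/-- Evaluation at a point, as a linear map. -/
def evalAt (t : ℝ) (x : Space) : BEvo →ₗ[ℝ] ℝ where
  toFun u := u t x
  map_add' _ _ := rfl
  map_smul' _ _ := rfl

lemma sum_apply {ι : Type*} (s : Finset ι) (u : ι → BEvo) (t : ℝ) (x : Space) :
    (∑ i ∈ s, u i) t x = ∑ i ∈ s, u i t x :=
  map_sum (evalAt t x) u s

lemma zero_of_nonpos (u : BEvo) {t : ℝ} (ht : t ≤ 0) (x : Space) : u t x = 0 :=
  u.1.zero_of_nonpos ht x

lemma exists_stripBdd (u : BEvo) (T : ℝ) : ∃ C, 0 ≤ C ∧ StripBdd T C u := by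
  obtain ⟨C, hC⟩ := u.2 1 T
  rw [one_smul] at hC
  exact ⟨max C 0, le_max_right _ _, hC.mono (le_max_left _ _)⟩

lemma C_smul (q : SpacePoly) (u : BEvo) : (Polynomial.C q : Symb) • u = q • u :=
  Subtype.ext (Evo.C_smul q u.1)

/-- The gradient in space. -/
def grad (u : BEvo) (t : ℝ) (x : Space) : Space →L[ℝ] ℝ :=
  gradCLM fun i => ((MvPolynomial.X i : SpacePoly) • u) t x

lemma hasDerivAt_time (u : BEvo) {t : ℝ} (ht : 0 < t) (x : Space) :
    HasDerivAt (fun s => u s x) (((Polynomial.X : Symb) • u) t x) t :=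
  u.1.hasDerivAt_time ht x

lemma hasFDerivAt_space (u : BEvo) {t : ℝ} (ht : 0 < t) (x : Space) :
    HasFDerivAt (u t) (u.grad t x) x :=
  u.1.hasFDerivAt_space ht x

lemma hasFDerivAt (u : BEvo) {t : ℝ} (ht : 0 < t) (x : Space) :
    HasFDerivAt (fun p : ℝ × Space => u p.1 p.2)
      ((ContinuousLinearMap.toSpanSingleton ℝ (((Polynomial.X : Symb) • u) t x)).coprod
        (u.grad t x)) (t, x) := by
  have h := u.1.hasFDerivAt ht x
  convert h using 1
  have h1 : HasDerivAt (fun s : ℝ => (s, x)) ((1, 0) : ℝ × Space) t :=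
    (hasDerivAt_id t).prodMk (hasDerivAt_const t x)
  have h2 : HasFDerivAt (fun y : Space => (t, y)) (ContinuousLinearMap.inr ℝ ℝ Space) x :=
    (hasFDerivAt_const t x).prodMk (hasFDerivAt_id x)
  have h3 : HasDerivAt (fun s => u s x) (fderiv ℝ (fun p : ℝ × Space => u p.1 p.2) (t, x) (1, 0)) t :=
    HasFDerivAt.comp_hasDerivAt (l := fun p : ℝ × Space => u p.1 p.2) (f := fun s => (s, x)) t h h1
  have h4 : HasFDerivAt (u t) ((fderiv ℝ (fun p : ℝ × Space => u p.1 p.2) (t, x)).comp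
      (ContinuousLinearMap.inr ℝ ℝ Space)) x := h.comp x h2
  have e1 := h3.unique (u.hasDerivAt_time ht x)
  have e2 := h4.unique (u.hasFDerivAt_space ht x)
  refine ContinuousLinearMap.prod_ext ?_ ?_
  · ext
    simpa using e1.symm
  · simpa using e2.symm

lemma exists_norm_grad_le (u : BEvo) (T : ℝ) :
    ∃ C, 0 ≤ C ∧ ∀ t ∈ Ioc 0 T, ∀ x, ‖u.grad t x‖ ≤ C := by
  choose C hC0 hC using fun i => ((MvPolynomial.X i : SpacePoly) • u).exists_stripBdd T
  exact ⟨∑ i, C i, Finset.sum_nonneg fun i _ => hC0 i, fun t ht x =>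
    (norm_gradCLM_le _).trans (Finset.sum_le_sum fun i _ => hC i t ht x)⟩

lemma contDiffOn (u : BEvo) : ContDiffOn ℝ ∞ (fun p : ℝ × Space => u p.1 p.2) posHalf :=
  u.1.contDiffOn

lemma continuousAt (u : BEvo) {t : ℝ} (ht : 0 < t) (x : Space) :
    ContinuousAt (fun p : ℝ × Space => u p.1 p.2) (t, x) :=
  (u.1.contDiffAt ht x).continuousAt

lemma continuous_space (u : BEvo) (t : ℝ) : Continuous (u t) := by
  rcases lt_or_ge 0 t with ht | ht
  · exact continuous_iff_continuousAt.2 fun x => (u.hasFDerivAt_space ht x).continuousAt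
  · have : u t = fun _ => 0 := funext fun x => u.zero_of_nonpos ht x
    rw [this]; exact continuous_const

lemma continuousOn_time (u : BEvo) (x : Space) : ContinuousOn (fun s => u s x) (Ioi 0) :=
  fun _ ht => (u.hasDerivAt_time ht x).continuousAt.continuousWithinAt

end BEvo

/-! ### Primitives in time and initial values. -/

open MeasureTheory in
lemma BEvo.integrableOn_time (u : BEvo) (T : ℝ) (x : Space) :
    IntegrableOn (fun s => u s x) (Ioc 0 T) := by
  obtain ⟨C, -, hC⟩ := u.exists_stripBdd T
  exact Integrable.of_bound (((u.continuousOn_time x).mono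
    Ioc_subset_Ioi_self).aestronglyMeasurable measurableSet_Ioc) C
    ((ae_restrict_iff' measurableSet_Ioc).2 (ae_of_all _ fun s hs => hC s hs x))

/-- The primitive in time that vanishes at `t = 0`. -/
def timeIntFun (u : ℝ → Space → ℝ) : ℝ → Space → ℝ := fun t x => ∫ s in Ioc 0 t, u s x

open MeasureTheory in
lemma timeIntFun_hasDerivAt (u : BEvo) {t : ℝ} (ht : 0 < t) (x : Space) :
    HasDerivAt (fun s => timeIntFun u s x) (u t x) t := by
  have h := intervalIntegral.integral_hasDerivAt_right (f := fun s => u s x) (a := 0) (b := t)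
    ((intervalIntegrable_iff_integrableOn_Ioc_of_le ht.le).2 (u.integrableOn_time t x))
    ((u.continuousOn_time x).stronglyMeasurableAtFilter isOpen_Ioi t ht)
    (u.hasDerivAt_time ht x).continuousAt
  refine h.congr_of_eventuallyEq ?_
  filter_upwards [lt_mem_nhds ht] with s hs
  rw [timeIntFun, intervalIntegral.integral_of_le hs.le]

open MeasureTheory in
lemma timeIntFun_hasFDerivAt (u : BEvo) {t : ℝ} (x : Space) :
    HasFDerivAt (timeIntFun u t)
      (gradCLM fun i => timeIntFun ((MvPolynomial.X i : SpacePoly) • u : BEvo) t x) x := by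
  obtain ⟨C, hC0, hC⟩ := u.exists_norm_grad_le t
  have h := hasFDerivAt_integral_of_dominated_of_fderiv_le (𝕜 := ℝ)
    (μ := volume.restrict (Ioc 0 t)) (F := fun y s => u s y) (F' := fun y s => u.grad s y)
    (x₀ := x) (s := univ) (bound := fun _ => C) univ_mem
    (Eventually.of_forall fun y => (u.integrableOn_time t y).aestronglyMeasurable)
    (u.integrableOn_time t x) ?_
    ((ae_restrict_iff' measurableSet_Ioc).2 (ae_of_all _ fun s hs y _ => hC s hs y))
    (integrable_const _)
    ((ae_restrict_iff' measurableSet_Ioc).2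
      (ae_of_all _ fun s hs y _ => u.hasFDerivAt_space hs.1 y))
  · refine HasFDerivAt.congr_fderiv h ?_
    simp only [BEvo.grad, gradCLM]
    rw [integral_finsetSum]
    · refine Finset.sum_congr rfl fun i _ => ?_
      rw [integral_smul_const]; rfl
    · exact fun i _ => (BEvo.integrableOn_time _ _ _).smul_const _
  · simp only [BEvo.grad, gradCLM]
    exact Finset.aestronglyMeasurable_fun_sum _ fun i _ =>
      (BEvo.integrableOn_time _ _ _).aestronglyMeasurable.smul_const _

open MeasureTheory in
lemma abs_timeIntFun_le {u : ℝ → Space → ℝ} {T C : ℝ} (hC : StripBdd T C u)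
    {t : ℝ} (ht : t ∈ Ioc 0 T) (x : Space) : |timeIntFun u t x| ≤ C * t := by
  have := norm_setIntegral_le_of_norm_le_const (μ := volume) (s := Ioc 0 t) (C := C)
    (f := fun s => u s x) (by simp) (fun s hs => hC s ⟨hs.1, hs.2.trans ht.2⟩ x)
  simpa [timeIntFun, Measure.real, ht.1.le] using this

/-- The second set is needed because the time derivative of a primitive is the integrand itself. -/
lemma isSmoothClass_timeInt :
    IsSmoothClass (range (fun u : BEvo => timeIntFun u) ∪ range fun u : BEvo => u.1.1) where
  zero := by
    rintro _ (⟨u, rfl⟩ | ⟨u, rfl⟩) t ht x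
    · simp [timeIntFun, Ioc_eq_empty ht.not_gt]
    · exact u.zero_of_nonpos ht x
  bdd := by
    rintro _ (⟨u, rfl⟩ | ⟨u, rfl⟩) T
    · obtain ⟨C, hC0, hC⟩ := u.exists_stripBdd T
      exact ⟨C * T, fun t ht x => (abs_timeIntFun_le hC ht x).trans
        (mul_le_mul_of_nonneg_left ht.2 hC0)⟩
    · obtain ⟨C, -, hC⟩ := u.exists_stripBdd T
      exact ⟨C, hC⟩
  time := by
    rintro _ (⟨u, rfl⟩ | ⟨u, rfl⟩)
    · exact ⟨_, Or.inr ⟨u, rfl⟩, fun t ht x => timeIntFun_hasDerivAt u ht x⟩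
    · exact ⟨_, Or.inr ⟨(Polynomial.X : Symb) • u, rfl⟩, fun t ht x => u.hasDerivAt_time ht x⟩
  space := by
    rintro _ (⟨u, rfl⟩ | ⟨u, rfl⟩)
    · exact ⟨_, fun i => Or.inl ⟨(MvPolynomial.X i : SpacePoly) • u, rfl⟩,
        fun t ht x => timeIntFun_hasFDerivAt u x⟩
    · exact ⟨_, fun i => Or.inr ⟨(MvPolynomial.X i : SpacePoly) • u, rfl⟩,
        fun t ht x => u.hasFDerivAt_space ht x⟩

namespace BEvo

lemma eq_of_hasDerivAt {u v : BEvo} (h : ∀ t > 0, ∀ x, HasDerivAt (fun s => u s x) (v t x) t) :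
    (Polynomial.X : Symb) • u = v :=
  ext fun t ht x => (u.hasDerivAt_time ht x).unique (h t ht x)

lemma eq_of_hasFDerivAt {u : BEvo} {v : Fin 3 → BEvo}
    (h : ∀ t > 0, ∀ x, HasFDerivAt (u t) (gradCLM fun i => v i t x) x) (i : Fin 3) :
    (MvPolynomial.X i : SpacePoly) • u = v i :=
  ext fun t ht x => by
    have := congrArg (fun L : Space →L[ℝ] ℝ => L (EuclideanSpace.single i 1))
      ((u.hasFDerivAt_space ht x).unique (h t ht x))
    simpa [grad, gradCLM_apply] using this

/-- The primitive in time that vanishes at `t = 0`. -/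
def timeInt₀ (u : BEvo) : BEvo := isSmoothClass_timeInt.toBEvo (Or.inl ⟨u, rfl⟩)

/-- A linear map that commutes with the space derivatives, as a map linear over polynomials. -/
def mkLin (f : BEvo →ₗ[ℝ] BEvo) (hf : ∀ i u, f ((MvPolynomial.X i : SpacePoly) • u) =
    (MvPolynomial.X i : SpacePoly) • f u) : BEvo →ₗ[SpacePoly] BEvo where
  toFun := f
  map_add' := f.map_add
  map_smul' := map_spacePoly_smul f hf

/-- The primitive in time that vanishes at `t = 0`, as a linear map. -/
def timeInt : BEvo →ₗ[SpacePoly] BEvo :=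
  mkLin
    { toFun := timeInt₀
      map_add' := fun u v => ext fun t _ x =>
        MeasureTheory.integral_add (u.integrableOn_time t x) (v.integrableOn_time t x)
      map_smul' := fun c _ => ext fun _ _ _ =>
        MeasureTheory.integral_const_mul c _ }
    fun i u => (eq_of_hasFDerivAt (u := timeInt₀ u)
      (v := fun i => timeInt₀ ((MvPolynomial.X i : SpacePoly) • u))
      (fun _ _ x => timeIntFun_hasFDerivAt u x) i).symm

lemma X_timeInt (u : BEvo) : (Polynomial.X : Symb) • timeInt u = u :=
  eq_of_hasDerivAt fun _ ht x => timeIntFun_hasDerivAt u ht x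

lemma abs_timeInt_le {u : BEvo} {T C : ℝ} (hC : StripBdd T C u)
    {t : ℝ} (ht : t ∈ Ioc 0 T) (x : Space) : |timeInt u t x| ≤ C * t :=
  abs_timeIntFun_le hC ht x

/-- Multiplication by the time derivative, as a linear map. -/
def dtLin : BEvo →ₗ[SpacePoly] BEvo where
  toFun u := (Polynomial.X : Symb) • u
  map_add' u v := smul_add _ u v
  map_smul' q u := by
    rw [← C_smul, ← C_smul, RingHom.id_apply, ← mul_smul, ← mul_smul, mul_comm]

/-- The initial value, extended to a function that is constant in time. -/
def trace : BEvo →ₗ[SpacePoly] BEvo := LinearMap.id - timeInt ∘ₗ dtLin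

lemma trace_def (u : BEvo) : trace u = u - timeInt ((Polynomial.X : Symb) • u) := rfl

lemma X_trace (u : BEvo) : (Polynomial.X : Symb) • trace u = 0 := by
  rw [trace_def, smul_sub, X_timeInt, sub_self]

lemma trace_timeInt (u : BEvo) : trace (timeInt u) = 0 := by
  rw [trace_def, X_timeInt, sub_self]

lemma trace_of_X_smul_eq_zero {u : BEvo} (h : (Polynomial.X : Symb) • u = 0) : trace u = u := by
  rw [trace_def, h, map_zero, sub_zero]

lemma eq_timeInt_of_trace {u : BEvo} (h : trace u = 0) :
    u = timeInt ((Polynomial.X : Symb) • u) := sub_eq_zero.1 h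

lemma const_of_X_smul_eq_zero {u : BEvo} (h : (Polynomial.X : Symb) • u = 0) {s t : ℝ}
    (hs : 0 < s) (ht : 0 < t) (x : Space) : u s x = u t x := by
  have := (convex_Ioi (0 : ℝ)).norm_image_sub_le_of_norm_hasDerivWithin_le (C := 0)
    (f := fun s => u s x) (f' := fun s => ((Polynomial.X : Symb) • u) s x)
    (fun s hs => (u.hasDerivAt_time hs x).hasDerivWithinAt) (fun s _ => by simp [h]) ht hs
  rw [zero_mul, norm_le_zero_iff, sub_eq_zero] at this
  exact this

lemma exists_abs_le_of_trace {u : BEvo} (h : trace u = 0) (T : ℝ) :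
    ∃ C, ∀ t ∈ Ioc 0 T, ∀ x, |u t x| ≤ C * t := by
  obtain ⟨C, -, hC⟩ := ((Polynomial.X : Symb) • u).exists_stripBdd T
  refine ⟨C, fun t ht x => ?_⟩
  rw [eq_timeInt_of_trace h]
  exact abs_timeInt_le hC ht x

/-- The primitive of the bounded function `∂u/∂t` is `O(t)`, and `u` minus this primitive is
constant in time. So the limit at `t = 0` exists without any continuity assumption there. -/
lemma tendsto_trace (u : BEvo) (x : Space) {s : ℝ} (hs : 0 < s) :
    Tendsto (fun t => u t x) (𝓝[>] 0) (𝓝 (trace u s x)) := by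
  obtain ⟨C, -, hC⟩ := ((Polynomial.X : Symb) • u).exists_stripBdd 1
  have h0 : Tendsto (fun t => timeInt ((Polynomial.X : Symb) • u) t x) (𝓝[>] 0) (𝓝 0) := by
    have hb : Tendsto (fun t : ℝ => C * t) (𝓝[>] 0) (𝓝 0) := by
      have : Continuous fun t : ℝ => C * t := by fun_prop
      simpa using (this.tendsto 0).mono_left nhdsWithin_le_nhds
    refine squeeze_zero_norm' ?_ hb
    filter_upwards [Ioc_mem_nhdsGT (zero_lt_one' ℝ)] with t ht
    exact abs_timeInt_le hC ht x
  have h1 := h0.const_add (trace u s x)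
  rw [add_zero] at h1
  refine h1.congr' ?_
  filter_upwards [self_mem_nhdsWithin] with t ht
  rw [const_of_X_smul_eq_zero (X_trace u) hs ht, trace_def]
  simp

lemma trace_eq_of_tendsto {u v : BEvo}
    (h : ∀ x, Tendsto (fun t => u t x - v t x) (𝓝[>] 0) (𝓝 0)) : trace u = trace v := by
  rw [← sub_eq_zero, ← map_sub]
  refine ext fun t ht x => ?_
  exact tendsto_nhds_unique (tendsto_trace (u - v) x ht) (h x)

end BEvo

/-! ### Transport equations along characteristics. -/

/-- The change of variables to a frame moving with velocity `c` in direction `i`, with an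
exponential weight of rate `a`. -/
def shiftFun (a c : ℝ) (i : Fin 3) (u : ℝ → Space → ℝ) : ℝ → Space → ℝ :=
  fun t x => Real.exp (a * t) * u t (x + (c * t) • EuclideanSpace.single i 1)

lemma stripBdd_shiftFun {a c : ℝ} {i : Fin 3} {u : ℝ → Space → ℝ} {T C : ℝ}
    (h : StripBdd T C u) : StripBdd T (Real.exp (|a| * T) * C) (shiftFun a c i u) := by
  intro t ht x
  rw [shiftFun, abs_mul, Real.abs_exp]
  have h1 : a * t ≤ |a| * T := (mul_le_mul_of_nonneg_right (le_abs_self a) ht.1.le).trans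
    (mul_le_mul_of_nonneg_left ht.2 (abs_nonneg a))
  exact mul_le_mul (Real.exp_le_exp.2 h1) (h t ht _) (abs_nonneg _) (Real.exp_nonneg _)

lemma shiftFun_hasDerivAt (a c : ℝ) (i : Fin 3) (u : BEvo) {t : ℝ} (ht : 0 < t) (x : Space) :
    HasDerivAt (fun s => shiftFun a c i u s x) (shiftFun a c i ((Polynomial.X : Symb) • u +
      c • (MvPolynomial.X i : SpacePoly) • u + a • u : BEvo) t x) t := by
  have h1 : HasDerivAt (fun s : ℝ => (s, x + (c * s) • (EuclideanSpace.single i 1 : Space)))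
      ((1, c • EuclideanSpace.single i 1) : ℝ × Space) t := by
    refine (hasDerivAt_id t).prodMk ?_
    have h : HasDerivAt (fun s : ℝ => c * s) c t := by
      simpa using (hasDerivAt_id t).const_mul c
    exact (h.smul_const _).const_add x
  have h2 := HasFDerivAt.comp_hasDerivAt (l := fun p : ℝ × Space => u p.1 p.2)
    (f := fun s : ℝ => (s, x + (c * s) • (EuclideanSpace.single i 1 : Space))) t
    (u.hasFDerivAt ht (x + (c * t) • EuclideanSpace.single i 1)) h1
  have h3 : HasDerivAt (fun s => Real.exp (a * s)) (Real.exp (a * t) * a) t := by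
    simpa using ((hasDerivAt_id t).const_mul a).exp
  refine (h3.mul h2).congr_deriv ?_
  simp [shiftFun, BEvo.grad, gradCLM_apply]
  ring

lemma shiftFun_hasFDerivAt (a c : ℝ) (i : Fin 3) (u : BEvo) {t : ℝ} (ht : 0 < t) (x : Space) :
    HasFDerivAt (shiftFun a c i u t) (gradCLM fun j =>
      shiftFun a c i ((MvPolynomial.X j : SpacePoly) • u : BEvo) t x) x := by
  have h1 : HasFDerivAt (fun y : Space => y + (c * t) • (EuclideanSpace.single i 1 : Space))
      (ContinuousLinearMap.id ℝ Space) x := (hasFDerivAt_id x).add_const _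
  have h2 := ((u.hasFDerivAt_space ht (x + (c * t) • EuclideanSpace.single i 1)).comp x h1).const_mul
    (Real.exp (a * t))
  refine h2.congr_fderiv ?_
  ext y
  simp [BEvo.grad, gradCLM_apply, shiftFun, Finset.mul_sum, mul_assoc]

lemma isSmoothClass_shift (a c : ℝ) (i : Fin 3) :
    IsSmoothClass (range fun u : BEvo => shiftFun a c i u) where
  zero := by
    rintro _ ⟨u, rfl⟩ t ht x
    simp [shiftFun, u.zero_of_nonpos ht]
  bdd := by
    rintro _ ⟨u, rfl⟩ T
    obtain ⟨C, -, hC⟩ := u.exists_stripBdd T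
    exact ⟨_, stripBdd_shiftFun hC⟩
  time := by
    rintro _ ⟨u, rfl⟩
    exact ⟨_, ⟨_, rfl⟩, fun t ht x => shiftFun_hasDerivAt a c i u ht x⟩
  space := by
    rintro _ ⟨u, rfl⟩
    exact ⟨_, fun j => ⟨_, rfl⟩, fun t ht x => shiftFun_hasFDerivAt a c i u ht x⟩

namespace BEvo

/-- The change of variables to a moving frame. -/
def shift (a c : ℝ) (i : Fin 3) : BEvo →ₗ[SpacePoly] BEvo :=
  mkLin
    { toFun := fun u => (isSmoothClass_shift a c i).toBEvo ⟨u, rfl⟩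
      map_add' := fun _ _ => ext fun _ _ _ => mul_add _ _ _
      map_smul' := fun _ _ => ext fun _ _ _ => mul_left_comm _ _ _ }
    fun j u => (eq_of_hasFDerivAt (u := (isSmoothClass_shift a c i).toBEvo ⟨u, rfl⟩)
      (v := fun j => (isSmoothClass_shift a c i).toBEvo ⟨(MvPolynomial.X j : SpacePoly) • u, rfl⟩)
      (fun _ ht x => shiftFun_hasFDerivAt a c i u ht x) j).symm

lemma shift_apply (a c : ℝ) (i : Fin 3) (u : BEvo) (t : ℝ) (x : Space) :
    shift a c i u t x = Real.exp (a * t) * u t (x + (c * t) • EuclideanSpace.single i 1) := rfl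

/-- The frame follows the characteristics and the exponential is the integrating factor, so the
transport operator becomes `∂/∂t`. -/
lemma X_shift (a c : ℝ) (i : Fin 3) (u : BEvo) :
    (Polynomial.X : Symb) • shift a c i u = shift a c i ((Polynomial.X : Symb) • u +
      c • (MvPolynomial.X i : SpacePoly) • u + a • u) :=
  eq_of_hasDerivAt fun _ ht x => shiftFun_hasDerivAt a c i u ht x

lemma shift_shift_neg (a c : ℝ) (i : Fin 3) (u : BEvo) : shift a c i (shift (-a) (-c) i u) = u := by
  refine ext fun t _ x => ?_
  rw [shift_apply, shift_apply, ← mul_assoc, ← Real.exp_add, add_assoc, ← add_smul]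
  simp

lemma trace_shift {a c : ℝ} {i : Fin 3} {u : BEvo} (h : trace u = 0) : trace (shift a c i u) = 0 := by
  rw [← map_zero trace]
  refine trace_eq_of_tendsto fun x => ?_
  obtain ⟨C, hC⟩ := exists_abs_le_of_trace h 1
  have hb : Tendsto (fun t : ℝ => Real.exp (a * t) * (C * t)) (𝓝[>] 0) (𝓝 0) := by
    have : Continuous fun t : ℝ => Real.exp (a * t) * (C * t) := by fun_prop
    simpa using (this.tendsto 0).mono_left nhdsWithin_le_nhds
  refine squeeze_zero_norm' ?_ hb
  filter_upwards [Ioc_mem_nhdsGT (zero_lt_one' ℝ)] with t ht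
  rw [zero_apply, sub_zero, shift_apply, Real.norm_eq_abs, abs_mul, Real.abs_exp]
  gcongr
  exact hC t ht _

end BEvo

/-- The symbol `∂/∂t + c ∂/∂xᵢ + a`. -/
def transport (a c : ℝ) (i : Fin 3) : Symb :=
  Polynomial.X + Polynomial.C (c • MvPolynomial.X i + a • 1)

lemma transport_smul (a c : ℝ) (i : Fin 3) (u : BEvo) : transport a c i • u =
    (Polynomial.X : Symb) • u + c • (MvPolynomial.X i : SpacePoly) • u + a • u := by
  rw [transport, add_smul, BEvo.C_smul, add_smul, smul_assoc, smul_assoc, one_smul, add_assoc]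

namespace BEvo

/-- The solution operator of `∂u/∂t + c ∂u/∂xᵢ + a u = v` with zero initial values. -/
def transportInv (a c : ℝ) (i : Fin 3) : BEvo →ₗ[SpacePoly] BEvo :=
  shift (-a) (-c) i ∘ₗ timeInt ∘ₗ shift a c i

lemma transportInv_def (a c : ℝ) (i : Fin 3) (u : BEvo) :
    transportInv a c i u = shift (-a) (-c) i (timeInt (shift a c i u)) := rfl

lemma map_real_smul (f : BEvo →ₗ[SpacePoly] BEvo) (c : ℝ) (u : BEvo) : f (c • u) = c • f u := by
  rw [← smul_one_smul SpacePoly c u, map_smul, smul_assoc, one_smul]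

variable (a c : ℝ) (i : Fin 3)

lemma trace_transportInv (u : BEvo) : trace (transportInv a c i u) = 0 :=
  trace_shift (trace_timeInt _)

lemma shift_neg_shift (u : BEvo) : shift (-a) (-c) i (shift a c i u) = u := by
  simpa using shift_shift_neg (-a) (-c) i u

lemma X_shift' (u : BEvo) :
    (Polynomial.X : Symb) • shift a c i u = shift a c i (transport a c i • u) := by
  rw [X_shift, transport_smul]

lemma transport_transportInv (u : BEvo) : transport a c i • transportInv a c i u = u := by
  rw [transport_smul, transportInv_def, X_shift, X_timeInt]
  simp only [map_add, map_real_smul, map_smul, shift_neg_shift]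
  module

/-- Zero trace is essential: integration in time recovers a function only up to its initial value.
-/
lemma transportInv_transport {u : BEvo} (h : trace u = 0) :
    transportInv a c i (transport a c i • u) = u := by
  rw [transportInv_def, ← X_shift', ← eq_timeInt_of_trace (trace_shift h), shift_neg_shift]

lemma transportInv_apply (u : BEvo) (t : ℝ) (x : Space) : transportInv a c i u t x =
    Real.exp (-a * t) * ∫ s in Ioc 0 t, shift a c i u s (x + (-c * t) • EuclideanSpace.single i 1) :=
  rfl

open MeasureTheory in
-- `m` is a majorant of the source and `G` an antiderivative of the weighted majorant. The three
-- estimates below differ only in the choice of `m` and `G`.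
lemma abs_transportInv_le {u : BEvo} {T : ℝ} {m G : ℝ → ℝ}
    (hm : ∀ s ∈ Ioc 0 T, ∀ y, |u s y| ≤ m s) (hm_cont : Continuous m)
    (hG : ∀ s, HasDerivAt G (Real.exp (a * s) * m s) s) {t : ℝ} (ht : t ∈ Ioc 0 T) (x : Space) :
    |transportInv a c i u t x| ≤ Real.exp (-a * t) * (G t - G 0) := by
  have hc : Continuous fun s => Real.exp (a * s) * m s := by fun_prop
  rw [transportInv_apply, abs_mul, Real.abs_exp,
    ← intervalIntegral.integral_eq_sub_of_hasDerivAt (fun s _ => hG s) (hc.intervalIntegrable 0 t),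
    intervalIntegral.integral_of_le ht.1.le]
  gcongr
  rw [← Real.norm_eq_abs]
  refine norm_integral_le_of_norm_le (hc.integrableOn_Ioc (μ := volume)) ?_
  refine (ae_restrict_iff' measurableSet_Ioc).2 (ae_of_all _ fun s hs => ?_)
  rw [shift_apply, Real.norm_eq_abs, abs_mul, Real.abs_exp]
  gcongr
  exact hm s ⟨hs.1, hs.2.trans ht.2⟩ _

variable {a} {c} {i}

lemma abs_transportInv_le_linear (ha : 0 ≤ a) {u : BEvo} {T C : ℝ} (h : StripBdd T C u) {t : ℝ}
    (ht : t ∈ Ioc 0 T) (x : Space) : |transportInv a c i u t x| ≤ C * t := by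
  have hC : 0 ≤ C := (abs_nonneg _).trans (h t ht x)
  -- The majorant `C` is enlarged to `C (1 + a s)`, whose weighted antiderivative `C s exp (a s)`
  -- involves no division by `a`; thus `a = 0` is allowed.
  have h1 := abs_transportInv_le a c i (u := u) (T := T) (m := fun s => C * (1 + a * s))
    (G := fun s => C * s * Real.exp (a * s))
    (fun s hs y => (h s hs y).trans (le_mul_of_one_le_right hC
      (by have := mul_nonneg ha hs.1.le; linarith))) (by fun_prop)
    (fun s => by
      have e1 : HasDerivAt (fun s => C * s) C s := by simpa using (hasDerivAt_id s).const_mul C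
      have e2 : HasDerivAt (fun s => Real.exp (a * s)) (Real.exp (a * s) * a) s := by
        simpa using ((hasDerivAt_id s).const_mul a).exp
      refine (e1.mul e2).congr_deriv ?_
      ring) ht x
  refine h1.trans_eq ?_
  have : Real.exp (-a * t) * Real.exp (a * t) = 1 := by rw [← Real.exp_add]; simp
  linear_combination C * t * this

/-- The weighted integral of `1 + a s` over `0 < s ≤ t`, times `exp (-a t)`, is exactly `t`. With `a
= 6b`, six such terms with factor `b` give `6bt`, so `r (1 + 6bt)` reproduces itself in the renewal
equation with source `r`. -/
lemma abs_transportInv_le_renewal {u : BEvo} {T r : ℝ}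
    (h : ∀ s ∈ Ioc 0 T, ∀ y, |u s y| ≤ r * (1 + a * s)) {t : ℝ}
    (ht : t ∈ Ioc 0 T) (x : Space) : |transportInv a c i u t x| ≤ r * t := by
  have h1 := abs_transportInv_le a c i h (G := fun s => r * s * Real.exp (a * s)) (by fun_prop)
    (fun s => by
      have e1 : HasDerivAt (fun s => r * s) r s := by simpa using (hasDerivAt_id s).const_mul r
      have e2 : HasDerivAt (fun s => Real.exp (a * s)) (Real.exp (a * s) * a) s := by
        simpa using ((hasDerivAt_id s).const_mul a).exp
      refine (e1.mul e2).congr_deriv ?_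
      ring) ht x
  refine h1.trans_eq ?_
  have : Real.exp (-a * t) * Real.exp (a * t) = 1 := by rw [← Real.exp_add]; simp
  linear_combination r * t * this

/-- After multiplication by `a` the factor is `1 - exp (-a T) < 1`: on a strip of finite height this
is a contraction. -/
lemma abs_transportInv_le_contraction (ha : 0 < a) {u : BEvo} {T C : ℝ} (h : StripBdd T C u) {t : ℝ}
    (ht : t ∈ Ioc 0 T) (x : Space) :
    |transportInv a c i u t x| ≤ C * ((1 - Real.exp (-a * T)) / a) := by
  have hC : 0 ≤ C := (abs_nonneg _).trans (h t ht x)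
  have h1 := abs_transportInv_le a c i (u := u) (T := T) (m := fun s => C)
    (G := fun s => C / a * Real.exp (a * s)) h continuous_const
    (fun s => by
      have e2 : HasDerivAt (fun s => Real.exp (a * s)) (Real.exp (a * s) * a) s := by
        simpa using ((hasDerivAt_id s).const_mul a).exp
      refine (e2.const_mul (C / a)).congr_deriv ?_
      field_simp) ht x
  refine h1.trans ?_
  have e : Real.exp (-a * t) * Real.exp (a * t) = 1 := by rw [← Real.exp_add]; simp
  calc Real.exp (-a * t) * (C / a * Real.exp (a * t) - C / a * Real.exp (a * 0))
      = C * ((1 - Real.exp (-a * t)) / a) := by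
        rw [mul_zero, Real.exp_zero]; linear_combination C / a * e
    _ ≤ _ := by
        gcongr 2
        have : Real.exp (-a * T) ≤ Real.exp (-a * t) := Real.exp_le_exp.2 (by nlinarith [ht.2])
        linarith

end BEvo

/-! ### Gaussian means and the heat equation. -/

section Gauss

open MeasureTheory

/-- The standard Gaussian density. -/
def gauss (z : Space) : ℝ :=
  (∫ w : Space, Real.exp (-(1 / 2) * ‖w‖ ^ 2))⁻¹ * Real.exp (-(1 / 2) * ‖z‖ ^ 2)

lemma integrable_exp_neg_mul_sq {b : ℝ} (hb : 0 < b) :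
    Integrable fun z : Space => Real.exp (-b * ‖z‖ ^ 2) := by
  have h := GaussianFourier.integrable_cexp_neg_mul_sq_norm_add (V := Space) (b := b)
    (by simpa using hb) 0 0
  have h2 := h.re
  refine h2.congr (ae_of_all _ fun z => ?_)
  simp only [zero_mul, add_zero]
  rw [show -(b : ℂ) * (‖z‖ : ℂ) ^ 2 = ((-b * ‖z‖ ^ 2 : ℝ) : ℂ) by push_cast; ring]
  exact Complex.exp_ofReal_re _

lemma gauss_const_pos : 0 < ∫ w : Space, Real.exp (-(1 / 2) * ‖w‖ ^ 2) := by
  rw [GaussianFourier.integral_rexp_neg_mul_sq_norm (by norm_num)]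
  positivity

lemma gauss_nonneg (z : Space) : 0 ≤ gauss z :=
  mul_nonneg (inv_nonneg.2 gauss_const_pos.le) (Real.exp_nonneg _)

lemma continuous_gauss : Continuous gauss := by unfold gauss; fun_prop

lemma integrable_gauss : Integrable gauss :=
  (integrable_exp_neg_mul_sq (by norm_num)).const_mul _

lemma integral_gauss : ∫ z, gauss z = 1 := by
  simp only [gauss]
  rw [integral_const_mul, inv_mul_cancel₀ gauss_const_pos.ne']

lemma integrable_norm_mul_gauss : Integrable fun z : Space => ‖z‖ * gauss z := by
  refine Integrable.mono' ((integrable_exp_neg_mul_sq (b := 1 / 4) (by norm_num)).const_mul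
    (∫ w : Space, Real.exp (-(1 / 2) * ‖w‖ ^ 2))⁻¹)
    (by have := continuous_gauss; fun_prop) (ae_of_all _ fun z => ?_)
  rw [Real.norm_of_nonneg (mul_nonneg (norm_nonneg z) (gauss_nonneg z)), gauss, mul_left_comm]
  refine mul_le_mul_of_nonneg_left ?_ (inv_nonneg.2 gauss_const_pos.le)
  -- Half of the Gaussian exponent pays for the factor `‖z‖`: the square `(1 - ‖z‖ / 2) ^ 2 ≥ 0`
  -- gives `‖z‖ ≤ 1 + ‖z‖ ^ 2 / 4`.
  have h1 : ‖z‖ ≤ Real.exp (1 / 4 * ‖z‖ ^ 2) := by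
    nlinarith [Real.add_one_le_exp (1 / 4 * ‖z‖ ^ 2), sq_nonneg (1 - ‖z‖ / 2)]
  calc ‖z‖ * Real.exp (-(1 / 2) * ‖z‖ ^ 2)
      ≤ Real.exp (1 / 4 * ‖z‖ ^ 2) * Real.exp (-(1 / 2) * ‖z‖ ^ 2) := by gcongr
    _ = Real.exp (-(1 / 4) * ‖z‖ ^ 2) := by rw [← Real.exp_add]; ring_nf

lemma hasFDerivAt_gauss (z : Space) : HasFDerivAt gauss (-gauss z • innerSL ℝ z) z := by
  have h := ((((hasStrictFDerivAt_norm_sq z).hasFDerivAt.const_mul (-(1 / 2) : ℝ)).exp).const_mul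
    (∫ w : Space, Real.exp (-(1 / 2) * ‖w‖ ^ 2))⁻¹)
  refine HasFDerivAt.congr_fderiv h ?_
  ext y
  simp [gauss]
  ring

/-- The mean of a function over a Gaussian cloud of width `σ` around `x`. -/
def gaussMean (φ : Space → ℝ) (σ : ℝ) (x : Space) : ℝ := ∫ z, φ (x + σ • z) * gauss z

lemma integrable_mul_gauss {φ : Space → ℝ} (hφ : Continuous φ) {C : ℝ} (hC : ∀ x, |φ x| ≤ C) :
    Integrable fun z => φ z * gauss z :=
  integrable_gauss.bdd_mul (c := C) hφ.aestronglyMeasurable (ae_of_all _ hC)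

lemma abs_gaussMean_le {φ : Space → ℝ} {C : ℝ} (hC : ∀ x, |φ x| ≤ C) (σ : ℝ) (x : Space) :
    |gaussMean φ σ x| ≤ C := by
  have := norm_integral_le_of_norm_le (f := fun z => φ (x + σ • z) * gauss z)
    (integrable_gauss.const_mul C) (ae_of_all _ fun z => by
      rw [norm_mul, Real.norm_of_nonneg (gauss_nonneg z)]
      exact mul_le_mul_of_nonneg_right (hC _) (gauss_nonneg z))
  rwa [integral_const_mul, integral_gauss, mul_one] at this

end Gauss

namespace BEvo

open MeasureTheory

lemma integrable_gaussMean (u : BEvo) (t σ : ℝ) (x : Space) :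
    Integrable fun z => u t (x + σ • z) * gauss z := by
  obtain ⟨C, hC0, hC⟩ := u.exists_stripBdd t
  refine integrable_mul_gauss ((u.continuous_space t).comp (by fun_prop)) (C := C) fun z => ?_
  rcases lt_or_ge 0 t with ht | ht
  · exact hC t ⟨ht, le_rfl⟩ _
  · rwa [u.zero_of_nonpos ht, abs_zero]

lemma abs_gaussMean_le {u : BEvo} {T C : ℝ} (h : StripBdd T C u) {t : ℝ} (ht : t ∈ Ioc 0 T)
    (σ : ℝ) (x : Space) : |gaussMean (u t) σ x| ≤ C :=
  RandomMotion.abs_gaussMean_le (h t ht) σ x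

/-- A Lipschitz function moves under averaging by at most its Lipschitz constant times the first
moment. This gives the initial value of the heat flow and the end value in the maximum principle. -/
lemma abs_gaussMean_sub_le {u : BEvo} {C t : ℝ} (ht : 0 < t)
    (h : ∀ x, ‖u.grad t x‖ ≤ C) (σ : ℝ) (x : Space) :
    |gaussMean (u t) σ x - u t x| ≤ C * |σ| * ∫ z : Space, ‖z‖ * gauss z := by
  have e : gaussMean (u t) σ x - u t x = ∫ z, (u t (x + σ • z) - u t x) * gauss z := by
    simp only [sub_mul]
    rw [integral_sub (u.integrable_gaussMean t σ x) (integrable_gauss.const_mul _),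
      integral_const_mul, integral_gauss, mul_one]
    rfl
  rw [e, ← Real.norm_eq_abs, ← integral_const_mul]
  refine norm_integral_le_of_norm_le (integrable_norm_mul_gauss.const_mul _)
    (ae_of_all _ fun z => ?_)
  rw [norm_mul, Real.norm_of_nonneg (gauss_nonneg z), ← mul_assoc]
  refine mul_le_mul_of_nonneg_right ?_ (gauss_nonneg z)
  have := convex_univ.norm_image_sub_le_of_norm_hasFDerivWithin_le (f := u t)
    (fun y _ => (u.hasFDerivAt_space ht y).hasFDerivWithinAt) (fun y _ => h y) (mem_univ x)
    (mem_univ (x + σ • z))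
  rwa [add_sub_cancel_left, norm_smul, Real.norm_eq_abs σ, ← mul_assoc] at this

lemma gaussMean_hasFDerivAt (u : BEvo) {t : ℝ} (ht : 0 < t) (σ : ℝ) (x : Space) :
    HasFDerivAt (gaussMean (u t) σ) (gradCLM fun i =>
      gaussMean (((MvPolynomial.X i : SpacePoly) • u) t) σ x) x := by
  obtain ⟨C, hC0, hC⟩ := u.exists_norm_grad_le t
  have h := hasFDerivAt_integral_of_dominated_of_fderiv_le (𝕜 := ℝ)
    (μ := volume) (F := fun y z => u t (y + σ • z) * gauss z)
    (F' := fun y z => gauss z • u.grad t (y + σ • z))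
    (x₀ := x) (s := univ) (bound := fun z => C * gauss z) univ_mem
    (Eventually.of_forall fun y => (u.integrable_gaussMean t σ y).aestronglyMeasurable)
    (u.integrable_gaussMean t σ x) ?_
    (ae_of_all _ fun z y _ => ?_)
    (integrable_gauss.const_mul C)
    (ae_of_all _ fun z y _ => ?_)
  · refine HasFDerivAt.congr_fderiv h ?_
    simp only [BEvo.grad, gradCLM, Finset.smul_sum, smul_smul]
    rw [integral_finsetSum]
    · refine Finset.sum_congr rfl fun i _ => ?_
      rw [integral_smul_const]; simp only [mul_comm (gauss _)]; rfl
    · intro i _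
      simp only [mul_comm (gauss _)]
      exact (BEvo.integrable_gaussMean _ _ _ _).smul_const _
  · simp only [BEvo.grad, gradCLM, Finset.smul_sum, smul_smul, mul_comm (gauss _)]
    exact Finset.aestronglyMeasurable_fun_sum _ fun i _ =>
      (BEvo.integrable_gaussMean _ _ _ _).aestronglyMeasurable.smul_const _
  · rw [norm_smul, Real.norm_of_nonneg (gauss_nonneg z), mul_comm]
    exact mul_le_mul_of_nonneg_right (hC t ⟨ht, le_rfl⟩ _) (gauss_nonneg z)
  · have h1 : HasFDerivAt (fun y : Space => y + σ • z) (ContinuousLinearMap.id ℝ Space) y :=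
      (hasFDerivAt_id y).add_const _
    exact (((u.hasFDerivAt_space ht _).comp y h1).mul_const (gauss z))

/-- Since the gradient of the density is `-z` times the density, a factor `z_i` trades for a
derivative of `u` and a factor `σ`. That `σ` cancels the singular `1 / σ` produced by
differentiating the width in time. -/
lemma gauss_integration_by_parts (u : BEvo) {t : ℝ} (ht : 0 < t) (σ : ℝ) (x : Space) (i : Fin 3) :
    ∫ z : Space, u t (x + σ • z) * (z i * gauss z) =
      σ * gaussMean (((MvPolynomial.X i : SpacePoly) • u) t) σ x := by
  have hd : ∀ z, HasFDerivAt (fun z : Space => u t (x + σ • z)) (σ • u.grad t (x + σ • z)) z := by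
    intro z
    have h1 : HasFDerivAt (fun z : Space => x + σ • z) (σ • ContinuousLinearMap.id ℝ Space) z :=
      ((hasFDerivAt_id z).const_smul σ).const_add _
    refine ((u.hasFDerivAt_space ht _).comp z h1).congr_fderiv ?_
    ext; simp
  have e1 : ∀ z : Space, fderiv ℝ gauss z (EuclideanSpace.single i 1) = -(z i * gauss z) := by
    intro z
    rw [(hasFDerivAt_gauss z).fderiv]
    simp [EuclideanSpace.inner_single_right, mul_comm]
  have e2 : ∀ z : Space, fderiv ℝ (fun z : Space => u t (x + σ • z)) z (EuclideanSpace.single i 1) =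
      σ * ((MvPolynomial.X i : SpacePoly) • u) t (x + σ • z) := by
    intro z
    rw [(hd z).fderiv]
    simp [grad, gradCLM_apply]
  have hint : Integrable fun z : Space => u t (x + σ • z) * (z i * gauss z) := by
    obtain ⟨C, hC0, hC⟩ := u.exists_stripBdd t
    refine (integrable_norm_mul_gauss.const_mul C).mono' ?_ (ae_of_all _ fun z => ?_)
    · have := continuous_gauss
      have := (u.continuous_space t)
      exact Continuous.aestronglyMeasurable (by fun_prop)
    · rw [norm_mul, norm_mul, Real.norm_of_nonneg (gauss_nonneg z)]
      have := PiLp.norm_apply_le z i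
      have := gauss_nonneg z
      gcongr
      exact hC t ⟨ht, le_rfl⟩ _
  have key := integral_mul_fderiv_eq_neg_fderiv_mul_of_integrable (μ := volume) (𝕜 := ℝ)
    (f := fun z : Space => u t (x + σ • z)) (g := gauss) (v := EuclideanSpace.single i 1)
    (by
      simp only [e2, mul_assoc]
      exact (integrable_gaussMean _ _ _ _).const_mul σ)
    (by
      simp only [e1, mul_neg]
      exact hint.neg)
    (integrable_gaussMean u t σ x)
    (fun z _ => (hd z).differentiableAt) (fun z _ => (hasFDerivAt_gauss z).differentiableAt)
  simp only [e1, e2, mul_neg, mul_assoc, integral_neg, integral_const_mul, neg_inj] at key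
  exact key

end BEvo

/-- The symbol of the Laplacian. -/
def lapPoly : SpacePoly := ∑ i, MvPolynomial.X i ^ 2

namespace BEvo

open MeasureTheory

lemma gaussMean_add (u v : BEvo) (t σ : ℝ) (x : Space) :
    gaussMean ((u + v) t) σ x = gaussMean (u t) σ x + gaussMean (v t) σ x := by
  simp only [gaussMean, add_apply, add_mul]
  exact integral_add (u.integrable_gaussMean t σ x) (v.integrable_gaussMean t σ x)

lemma gaussMean_smul (c : ℝ) (u : BEvo) (t σ : ℝ) (x : Space) :
    gaussMean ((c • u) t) σ x = c * gaussMean (u t) σ x := by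
  simp only [gaussMean, smul_apply, mul_assoc]
  exact integral_const_mul _ _

lemma gaussMean_sum {ι : Type*} (s : Finset ι) (u : ι → BEvo) (t σ : ℝ) (x : Space) :
    gaussMean ((∑ i ∈ s, u i) t) σ x = ∑ i ∈ s, gaussMean (u i t) σ x := by
  simp only [gaussMean, sum_apply, Finset.sum_mul]
  exact integral_finsetSum _ fun i _ => (u i).integrable_gaussMean t σ x

/-- The derivative of a Gaussian mean along a curve on which the variance is affine in time. -/
lemma hasDerivAt_gaussMean (u : BEvo) {p q s : ℝ} (hs : 0 < s) (hl : 0 < p + q * s) (x : Space) :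
    HasDerivAt (fun s => gaussMean (u s) √(p + q * s) x)
      (gaussMean (((Polynomial.X : Symb) • u + (q / 2) • lapPoly • u) s) √(p + q * s) x) s := by
  set F' : ℝ → Space → ℝ := fun r z => (((Polynomial.X : Symb) • u) r (x + √(p + q * r) • z) +
    q / (2 * √(p + q * r)) * u.grad r (x + √(p + q * r) • z) z) * gauss z with hF'
  have hsplit : ∀ r z, F' r z =
      ((Polynomial.X : Symb) • u) r (x + √(p + q * r) • z) * gauss z + ∑ i, q / (2 * √(p + q * r)) *
      (((MvPolynomial.X i : SpacePoly) • u) r (x + √(p + q * r) • z) * (z i * gauss z)) := by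
    intro r z
    simp only [hF', grad, gradCLM_apply, add_mul, Finset.mul_sum, Finset.sum_mul, mul_assoc]
  have hint : ∀ i, Integrable fun z : Space =>
      ((MvPolynomial.X i : SpacePoly) • u) s (x + √(p + q * s) • z) * (z i * gauss z) := by
    intro i
    obtain ⟨C, hC0, hC⟩ := ((MvPolynomial.X i : SpacePoly) • u).exists_stripBdd s
    refine (integrable_norm_mul_gauss.const_mul C).mono' ?_ (ae_of_all _ fun z => ?_)
    · have := continuous_gauss
      have := ((MvPolynomial.X i : SpacePoly) • u).continuous_space s
      exact Continuous.aestronglyMeasurable (by fun_prop)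
    · rw [norm_mul, norm_mul, Real.norm_of_nonneg (gauss_nonneg z)]
      have := PiLp.norm_apply_le z i
      have := gauss_nonneg z
      gcongr
      exact hC s ⟨hs, le_rfl⟩ _
  obtain ⟨C₀, hC₀0, hC₀⟩ := ((Polynomial.X : Symb) • u).exists_stripBdd (s + 1)
  obtain ⟨C₁, hC₁0, hC₁⟩ := u.exists_norm_grad_le (s + 1)
  -- A positive lower bound for the variance near `s`; it bounds `1 / √(p + q * r)` and so provides
  -- the dominating function.
  set l : ℝ := (p + q * s) / 2
  have hl0 : 0 < l := by positivity
  have hN : {r : ℝ | r ∈ Ioo 0 (s + 1) ∧ l < p + q * r} ∈ 𝓝 s := by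
    refine Filter.inter_mem (Ioo_mem_nhds hs (by simp)) ?_
    have hc : Continuous fun r : ℝ => p + q * r := by fun_prop
    exact (isOpen_lt continuous_const hc).mem_nhds (half_lt_self hl)
  have h := (hasDerivAt_integral_of_dominated_loc_of_deriv_le (μ := volume)
    (F := fun r z => u r (x + √(p + q * r) • z) * gauss z) (F' := F') (x₀ := s)
    (bound := fun z => C₀ * gauss z + |q| / (2 * √l) * C₁ * (‖z‖ * gauss z)) hN
    (Eventually.of_forall fun r => (u.integrable_gaussMean r _ x).aestronglyMeasurable)
    (u.integrable_gaussMean s _ x) ?_ (ae_of_all _ fun z r hr => ?_)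
    ((integrable_gauss.const_mul _).add (integrable_norm_mul_gauss.const_mul _))
    (ae_of_all _ fun z r hr => ?_)).2
  · refine h.congr_deriv ?_
    simp only [hsplit]
    rw [integral_add (BEvo.integrable_gaussMean _ _ _ _)
      (integrable_finsetSum _ fun i _ => (hint i).const_mul _), integral_finsetSum _
      (fun i _ => (hint i).const_mul _), gaussMean_add, gaussMean_smul, lapPoly, Finset.sum_smul,
      gaussMean_sum, Finset.mul_sum]
    refine congrArg₂ _ rfl (Finset.sum_congr rfl fun i _ => ?_)
    rw [integral_const_mul, gauss_integration_by_parts _ hs, ← mul_smul, ← pow_two, ← mul_assoc]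
    congr 1
    have : √(p + q * s) ≠ 0 := (Real.sqrt_pos.2 hl).ne'
    field_simp
  · rw [funext (hsplit s)]
    exact (BEvo.integrable_gaussMean _ _ _ _).aestronglyMeasurable.add
      (Finset.aestronglyMeasurable_fun_sum _ fun i _ => ((hint i).const_mul _).aestronglyMeasurable)
  · rw [hF', norm_mul, Real.norm_of_nonneg (gauss_nonneg z), ← mul_assoc, ← add_mul]
    refine mul_le_mul_of_nonneg_right ((norm_add_le _ _).trans ?_) (gauss_nonneg z)
    refine add_le_add (hC₀ r ⟨hr.1.1, hr.1.2.le⟩ _) ?_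
    rw [norm_mul, mul_assoc]
    have h1 : √l ≤ √(p + q * r) := Real.sqrt_le_sqrt hr.2.le
    have h0 : 0 < √l := Real.sqrt_pos.2 hl0
    refine mul_le_mul ?_ ((ContinuousLinearMap.le_opNorm _ _).trans (mul_le_mul_of_nonneg_right
      (hC₁ r ⟨hr.1.1, hr.1.2.le⟩ _) (norm_nonneg z))) (norm_nonneg _) (by positivity)
    rw [norm_div, Real.norm_eq_abs, Real.norm_of_nonneg (by positivity : 0 ≤ 2 * √(p + q * r))]
    gcongr
  · have hr0 : 0 < p + q * r := hl0.trans hr.2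
    have h0 : HasDerivAt (fun r => p + q * r) q r := by
      simpa using ((hasDerivAt_id r).const_mul q).const_add p
    have h1 : HasDerivAt (fun r : ℝ => (r, x + √(p + q * r) • z))
        ((1, (q / (2 * √(p + q * r))) • z) : ℝ × Space) r :=
      (hasDerivAt_id r).prodMk (((h0.sqrt hr0.ne').smul_const z).const_add x)
    have h2 := (HasFDerivAt.comp_hasDerivAt (l := fun p : ℝ × Space => u p.1 p.2)
      (f := fun r : ℝ => (r, x + √(p + q * r) • z)) r (u.hasFDerivAt hr.1.1 _) h1).mul_const (gauss z)
    refine h2.congr_deriv ?_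
    simp [hF']

/-- The heat flow of variable data. -/
def heatFun (u : BEvo) : ℝ → Space → ℝ := fun t x => gaussMean (u t) √(5 / 9 * t) x

/-- The variance grows at rate `5 / 9`, twice the diffusion coefficient, because half the Laplacian
generates Gaussian averaging. -/
lemma heatFun_hasDerivAt (u : BEvo) {t : ℝ} (ht : 0 < t) (x : Space) :
    HasDerivAt (fun s => heatFun u s x)
      (heatFun ((Polynomial.X : Symb) • u + (5 / 18 : ℝ) • lapPoly • u) t x) t := by
  have h := hasDerivAt_gaussMean u (p := 0) (q := 5 / 9) ht (by positivity) x
  rw [show (5 / 18 : ℝ) = 5 / 9 / 2 by norm_num]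
  simp only [zero_add] at h
  exact h

/-- All first derivatives of a heat flow are again heat flows of members of `BEvo`, so the width
`√(5 / 9 * t)` causes no singularity at `t = 0`. -/
lemma isSmoothClass_heat : IsSmoothClass (range heatFun) where
  zero := by
    rintro _ ⟨u, rfl⟩ t ht x
    simp [heatFun, gaussMean, u.zero_of_nonpos ht]
  bdd := by
    rintro _ ⟨u, rfl⟩ T
    obtain ⟨C, -, hC⟩ := u.exists_stripBdd T
    exact ⟨C, fun t ht x => abs_gaussMean_le hC ht _ x⟩
  time := by
    rintro _ ⟨u, rfl⟩
    exact ⟨_, ⟨_, rfl⟩, fun t ht x => heatFun_hasDerivAt u ht x⟩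
  space := by
    rintro _ ⟨u, rfl⟩
    exact ⟨_, fun j => ⟨_, rfl⟩, fun t ht x => gaussMean_hasFDerivAt u ht _ x⟩

/-- The heat flow, as an operator on functions of space and time: at time `t` the data are
`u t`. -/
def heat : BEvo →ₗ[SpacePoly] BEvo :=
  mkLin
    { toFun := fun u => isSmoothClass_heat.toBEvo ⟨u, rfl⟩
      map_add' := fun u v => ext fun t _ x => gaussMean_add u v t _ x
      map_smul' := fun c u => ext fun t _ x => gaussMean_smul c u t _ x }
    fun j u => (eq_of_hasFDerivAt (u := isSmoothClass_heat.toBEvo ⟨u, rfl⟩)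
      (v := fun j => isSmoothClass_heat.toBEvo ⟨(MvPolynomial.X j : SpacePoly) • u, rfl⟩)
      (fun _ ht x => gaussMean_hasFDerivAt u ht _ x) j).symm

lemma X_heat (u : BEvo) : (Polynomial.X : Symb) • heat u =
    heat ((Polynomial.X : Symb) • u + (5 / 18 : ℝ) • lapPoly • u) :=
  eq_of_hasDerivAt fun _ ht x => heatFun_hasDerivAt u ht x

lemma trace_heat (u : BEvo) : trace (heat u) = trace u := by
  refine trace_eq_of_tendsto fun x => ?_
  obtain ⟨C, -, hC⟩ := u.exists_norm_grad_le 1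
  have hb : Tendsto (fun t : ℝ => C * |√(5 / 9 * t)| * ∫ z : Space, ‖z‖ * gauss z)
      (𝓝[>] 0) (𝓝 0) := by
    have : Continuous fun t : ℝ => C * |√(5 / 9 * t)| * ∫ z : Space, ‖z‖ * gauss z := by fun_prop
    simpa using (this.tendsto 0).mono_left nhdsWithin_le_nhds
  refine squeeze_zero_norm' ?_ hb
  filter_upwards [Ioc_mem_nhdsGT (zero_lt_one' ℝ)] with t ht
  exact abs_gaussMean_sub_le ht.1 (hC t ht) _ x

/-- The heat symbol. -/
def heatSymb : Symb := Polynomial.X - Polynomial.C ((5 / 18 : ℝ) • lapPoly)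

lemma heatSymb_smul (u : BEvo) :
    heatSymb • u = (Polynomial.X : Symb) • u - (5 / 18 : ℝ) • lapPoly • u := by
  rw [heatSymb, sub_smul, C_smul, smul_assoc]

/-- The maximum principle for the heat equation with source and zero initial values. -/
lemma abs_le_of_heatSymb {u : BEvo} (hu : trace u = 0) {T A : ℝ}
    (hA : StripBdd T A (heatSymb • u : BEvo))
    {t : ℝ} (ht : t ∈ Ioc 0 T) (x : Space) : |u t x| ≤ A * t := by
  have ht0 : 0 < t := ht.1
  obtain ⟨C, hC⟩ := exists_abs_le_of_trace hu t
  obtain ⟨C₁, -, hC₁⟩ := u.exists_norm_grad_le t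
  -- The backward heat kernel ending at `(t, x)`: the variance decreases at rate `5 / 9` to zero at
  -- `s = t`, so `q` runs from the zero initial value to `u t x`, and its derivative is the mean of
  -- the source.
  set q : ℝ → ℝ := fun s => gaussMean (u s) √(5 / 9 * t + (-(5 / 9)) * s) x with hq
  have hpos : ∀ s < t, 0 < 5 / 9 * t + (-(5 / 9)) * s := fun s hs => by linarith
  have hder : ∀ s ∈ Ioo 0 t, HasDerivWithinAt q
      (gaussMean ((heatSymb • u) s) √(5 / 9 * t + (-(5 / 9)) * s) x) (Ioo 0 t) s := by
    intro s hs
    have h := hasDerivAt_gaussMean u hs.1 (hpos s hs.2) x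
    rw [heatSymb_smul, sub_eq_add_neg, ← neg_smul,
      show -(5 / 18 : ℝ) = -(5 / 9) / 2 by norm_num]
    exact h.hasDerivWithinAt
  have hlip : ∀ s₁ ∈ Ioo 0 t, ∀ s₂ ∈ Ioo 0 t, |q s₂ - q s₁| ≤ A * |s₂ - s₁| := fun s₁ h₁ s₂ h₂ =>
    (convex_Ioo 0 t).norm_image_sub_le_of_norm_hasDerivWithin_le hder
      (fun s hs => abs_gaussMean_le hA ⟨hs.1, hs.2.le.trans ht.2⟩ _ x) h₁ h₂
  have hA0 : 0 ≤ A := (abs_nonneg _).trans (hA t ht x)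
  -- Both endpoints are excluded: at time `0` nothing is differentiable, and at time `t` the
  -- variance vanishes. So `q` is compared at `s` and `t - s`, with errors that tend to zero with
  -- `s`.
  have hbound : ∀ᶠ s in 𝓝[>] (0 : ℝ), |u t x| ≤ |u t x - u (t - s) x| +
      C₁ * |√(5 / 9 * s)| * (∫ z : Space, ‖z‖ * gauss z) + A * t + C * s := by
    filter_upwards [Ioo_mem_nhdsGT (half_pos ht0)] with s hs
    have hs0 : 0 < s := hs.1
    have hst : s < t / 2 := hs.2
    have h1 : |q (t - s) - u (t - s) x| ≤ C₁ * |√(5 / 9 * s)| * ∫ z : Space, ‖z‖ * gauss z := by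
      have := abs_gaussMean_sub_le (u := u) (t := t - s) (by linarith)
        (hC₁ _ ⟨by linarith, by linarith⟩) √(5 / 9 * s) x
      rwa [show 5 / 9 * s = 5 / 9 * t + (-(5 / 9)) * (t - s) by ring] at this ⊢
    have h2 : |q (t - s) - q s| ≤ A * t := by
      refine (hlip s ⟨hs0, by linarith⟩ (t - s) ⟨by linarith, by linarith⟩).trans ?_
      refine mul_le_mul_of_nonneg_left ?_ hA0
      rw [abs_le]; constructor <;> linarith
    have h3 : |q s| ≤ C * s :=
      RandomMotion.abs_gaussMean_le (fun y => hC s ⟨hs0, by linarith⟩ y) _ x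
    rw [abs_le] at h1 h2 h3
    have h4 := le_abs_self (u t x - u (t - s) x)
    have h5 := neg_abs_le (u t x - u (t - s) x)
    rw [abs_le]
    constructor <;> linarith
  have hlim : Tendsto (fun s => |u t x - u (t - s) x| +
      C₁ * |√(5 / 9 * s)| * (∫ z : Space, ‖z‖ * gauss z) + A * t + C * s) (𝓝[>] 0) (𝓝 (A * t)) := by
    have hc : ContinuousAt (fun s => |u t x - u (t - s) x| +
        C₁ * |√(5 / 9 * s)| * (∫ z : Space, ‖z‖ * gauss z) + A * t + C * s) 0 := by
      have h1 : ContinuousAt (fun s : ℝ => u (t - s) x) 0 := by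
        have := (u.hasDerivAt_time ht0 x).continuousAt
        have h2 : ContinuousAt (fun s : ℝ => t - s) 0 := by fun_prop
        exact ContinuousAt.comp (g := fun s => u s x) (by simpa using this) h2
      fun_prop
    have := hc.tendsto.mono_left (nhdsWithin_le_nhds (s := Ioi 0))
    simpa using this
  exact ge_of_tendsto hlim hbound

end BEvo

/-! ### Passage between plain functions and the modules. -/

/-- The function `u` agrees with `U` for `t > 0`. -/
def Rep (u : ℝ → Space → ℝ) (U : BEvo) : Prop := ∀ t > 0, ∀ x, u t x = U t x

/-- The function `u` agrees with the smooth function `U` for `t > 0`. -/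
def SmoothRep (u : ℝ → Space → ℝ) (U : Evo) : Prop := ∀ t > 0, ∀ x, u t x = U t x

namespace SmoothRep

variable {u v : ℝ → Space → ℝ} {U V : Evo}

lemma add (hu : SmoothRep u U) (hv : SmoothRep v V) : SmoothRep (u + v) (U + V) :=
  fun t ht x => congrArg₂ (· + ·) (hu t ht x) (hv t ht x)

lemma sub (hu : SmoothRep u U) (hv : SmoothRep v V) : SmoothRep (u - v) (U - V) :=
  fun t ht x => congrArg₂ (· - ·) (hu t ht x) (hv t ht x)

lemma smul (hu : SmoothRep u U) (c : ℝ) : SmoothRep (c • u) (c • U) :=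
  fun t ht x => congrArg (c * ·) (hu t ht x)

lemma zero : SmoothRep 0 0 := fun _ _ _ => rfl

lemma sum {ι : Type*} {s : Finset ι} {u : ι → ℝ → Space → ℝ} {U : ι → Evo}
    (h : ∀ i ∈ s, SmoothRep (u i) (U i)) : SmoothRep (∑ i ∈ s, u i) (∑ i ∈ s, U i) := by
  intro t ht x
  rw [Evo.sum_apply, Finset.sum_apply, Finset.sum_apply]
  exact Finset.sum_congr rfl fun i hi => h i hi t ht x

lemma dt (hu : SmoothRep u U) : SmoothRep (dt u) ((Polynomial.X : Symb) • U) := fun t ht x => by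
  rw [← (U.hasDerivAt_time ht x).deriv]
  refine Filter.EventuallyEq.deriv_eq ?_
  filter_upwards [lt_mem_nhds ht] with s hs
  exact hu s hs x

lemma dx (hu : SmoothRep u U) (i : Fin 3) : SmoothRep (dx i u) ((MvPolynomial.X i : SpacePoly) • U) :=
  fun t ht x => by
    have h : u t = U t := funext fun y => hu t ht y
    rw [RandomMotion.dx, pd, h, ((U.hasFDerivAt_space ht x).hasLineDerivAt _).lineDeriv,
      gradCLM_apply]
    simp

lemma iter_dt (hu : SmoothRep u U) (n : ℕ) :
    SmoothRep (RandomMotion.dt^[n] u) ((Polynomial.X ^ n : Symb) • U) := by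
  induction n with
  | zero => simpa using hu
  | succ n ih => rw [Function.iterate_succ_apply', pow_succ', mul_smul]; exact ih.dt

lemma iter_dx (hu : SmoothRep u U) (i : Fin 3) (n : ℕ) :
    SmoothRep ((RandomMotion.dx i)^[n] u) ((MvPolynomial.X i ^ n : SpacePoly) • U) := by
  induction n with
  | zero => simpa using hu
  | succ n ih => rw [Function.iterate_succ_apply', pow_succ', mul_smul]; exact ih.dx i

end SmoothRep

lemma iterate_pd (i : Fin 3) (n : ℕ) (u : ℝ → Space → ℝ) :
    (fun t => (pd i)^[n] (u t)) = (dx i)^[n] u := by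
  induction n with
  | zero => rfl
  | succ n ih =>
    rw [Function.iterate_succ_apply', ← ih]
    funext t
    rw [Function.iterate_succ_apply']; rfl

lemma pdMulti_eq_iterate_dx (α : Fin 3 → ℕ) (u : ℝ → Space → ℝ) :
    (fun t => pdMulti α (u t)) = (dx 0)^[α 0] ((dx 1)^[α 1] ((dx 2)^[α 2] u)) := by
  simp only [← iterate_pd]; rfl

lemma SmoothRep.mixedDeriv {u : ℝ → Space → ℝ} {U : Evo} (hu : SmoothRep u U) (m : ℕ)
    (α : Fin 3 → ℕ) : SmoothRep (mixedDeriv m α u) (symbMonomial m α • U) := by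
  rw [RandomMotion.mixedDeriv, pdMulti_eq_iterate_dx, symbMonomial, mul_smul, Evo.C_smul,
    spaceMonomial, mul_smul, mul_smul]
  exact (((hu.iter_dx _ _).iter_dx _ _).iter_dx _ _).iter_dt _

/-- The symbol of `Δ⁽²⁾`. -/
def lap2Poly : SpacePoly :=
  MvPolynomial.X 0 ^ 2 * MvPolynomial.X 1 ^ 2 + MvPolynomial.X 1 ^ 2 * MvPolynomial.X 2 ^ 2 +
    MvPolynomial.X 0 ^ 2 * MvPolynomial.X 2 ^ 2

/-- The symbol of `∂⁶/∂x²∂y²∂z²`. -/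
def lap3Poly : SpacePoly := MvPolynomial.X 0 ^ 2 * MvPolynomial.X 1 ^ 2 * MvPolynomial.X 2 ^ 2

open Polynomial in
/-- The symbols of the operators `corr`. -/
def corrSymb : ℕ → Symb
  | 1 => (25 / 6 : ℝ) • (X ^ 2 - (1 / 3 : ℝ) • (C lapPoly * X) + (5 / 54 : ℝ) • C lap2Poly)
  | 2 => (125 / 18 : ℝ) • (X ^ 3 - (1 / 3 : ℝ) • (C lapPoly * X ^ 2)
      + (25 / 216 : ℝ) • (C lap2Poly * X) - (25 / 432 : ℝ) • C lap3Poly)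
  | 3 => (625 / 108 : ℝ) • (X ^ 4 - (5 / 18 : ℝ) • (C lapPoly * X ^ 3)
      + (5 / 72 : ℝ) • (C lap2Poly * X ^ 2))
  | 4 => (3125 / 1296 : ℝ) • (X ^ 5 - (1 / 6 : ℝ) • (C lapPoly * X ^ 4))
  | 5 => (3125 / 7776 : ℝ) • X ^ 6
  | _ => 0

lemma corrSymb_zero : corrSymb 0 = 0 := rfl

lemma corrSymb_add_six (n : ℕ) : corrSymb (n + 6) = 0 := rfl

/-- The symbol of the operator `regOp`. -/
def regSymb (ε : ℝ) : Symb :=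
  Polynomial.X - (5 / 18 : ℝ) • Polynomial.C lapPoly +
    ∑ j ∈ Finset.Icc 1 5, ε ^ (2 * j) • corrSymb j

namespace SmoothRep

variable {u v : ℝ → Space → ℝ} {U V : Evo}

lemma lap (hu : SmoothRep u U) : SmoothRep (lap u) (lapPoly • U) := by
  rw [lapPoly, Fin.sum_univ_three]
  simp only [add_smul, pow_two, mul_smul]
  exact (((hu.dx _).dx _).add ((hu.dx _).dx _)).add ((hu.dx _).dx _)

lemma lap2 (hu : SmoothRep u U) : SmoothRep (lap2 u) (lap2Poly • U) := by
  simp only [lap2Poly, add_smul, pow_two, mul_smul]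
  exact (((((hu.dx _).dx _).dx _).dx _).add ((((hu.dx _).dx _).dx _).dx _)).add
    ((((hu.dx _).dx _).dx _).dx _)

lemma lap3 (hu : SmoothRep u U) : SmoothRep (lap3 u) (lap3Poly • U) := by
  simp only [lap3Poly, pow_two, mul_smul]
  exact (((((hu.dx _).dx _).dx _).dx _).dx _).dx _

lemma corr (hu : SmoothRep u U) (j : ℕ) : SmoothRep (corr j u) (corrSymb j • U) := by
  match j with
  | 0 => rw [corrSymb_zero, zero_smul]; exact zero
  | 1 =>
    simp only [corrSymb, smul_assoc, add_smul, sub_smul, mul_smul, Evo.C_smul]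
    exact (((hu.iter_dt 2).sub (hu.dt.lap.smul _)).add (hu.lap2.smul _)).smul _
  | 2 =>
    simp only [corrSymb, smul_assoc, add_smul, sub_smul, mul_smul, Evo.C_smul]
    exact ((((hu.iter_dt 3).sub ((hu.iter_dt 2).lap.smul _)).add (hu.dt.lap2.smul _)).sub
      (hu.lap3.smul _)).smul _
  | 3 =>
    simp only [corrSymb, smul_assoc, add_smul, sub_smul, mul_smul, Evo.C_smul]
    exact (((hu.iter_dt 4).sub ((hu.iter_dt 3).lap.smul _)).add ((hu.iter_dt 2).lap2.smul _)).smul _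
  | 4 =>
    simp only [corrSymb, smul_assoc, sub_smul, mul_smul, Evo.C_smul]
    exact ((hu.iter_dt 5).sub ((hu.iter_dt 4).lap.smul _)).smul _
  | 5 =>
    simp only [corrSymb, smul_assoc]
    exact (hu.iter_dt 6).smul _
  | n + 6 => rw [corrSymb_add_six, zero_smul]; exact zero

lemma regOp (hu : SmoothRep u U) (ε : ℝ) : SmoothRep (regOp ε u) (regSymb ε • U) := by
  simp only [regSymb, smul_assoc, add_smul, sub_smul, Evo.C_smul, Finset.sum_smul]
  exact (hu.dt.sub (hu.lap.smul _)).add (sum fun j _ => (hu.corr j).smul _)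

end SmoothRep

namespace Rep

variable {u v : ℝ → Space → ℝ} {U V : BEvo}

lemma sub (hu : Rep u U) (hv : Rep v V) : Rep (u - v) (U - V) := SmoothRep.sub hu hv
lemma smul (hu : Rep u U) (c : ℝ) : Rep (c • u) (c • U) := SmoothRep.smul hu c
lemma dt (hu : Rep u U) : Rep (dt u) ((Polynomial.X : Symb) • U) :=
  SmoothRep.dt (U := U.1) hu
lemma lap (hu : Rep u U) : Rep (lap u) (lapPoly • U) := SmoothRep.lap (U := U.1) hu
lemma corr (hu : Rep u U) (j : ℕ) : Rep (corr j u) (corrSymb j • U) :=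
  SmoothRep.corr (U := U.1) hu j
lemma regOp (hu : Rep u U) (ε : ℝ) : Rep (regOp ε u) (regSymb ε • U) :=
  SmoothRep.regOp (U := U.1) hu ε
lemma mixedDeriv (hu : Rep u U) (m : ℕ) (α : Fin 3 → ℕ) :
    Rep (mixedDeriv m α u) (symbMonomial m α • U) :=
  SmoothRep.mixedDeriv (U := U.1) hu m α

lemma sum {ι : Type*} {s : Finset ι} {u : ι → ℝ → Space → ℝ} {U : ι → BEvo}
    (h : ∀ i ∈ s, Rep (u i) (U i)) : Rep (∑ i ∈ s, u i) (∑ i ∈ s, U i) := by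
  intro t ht x
  rw [BEvo.sum_apply, Finset.sum_apply, Finset.sum_apply]
  exact Finset.sum_congr rfl fun i hi => h i hi t ht x

lemma unique (hu : Rep u U) (hv : Rep u V) : U = V :=
  BEvo.ext fun t ht x => (hu t ht x).symm.trans (hv t ht x)

lemma stripBdd_iff (hu : Rep u U) {T C : ℝ} : StripBdd T C u ↔ StripBdd T C U :=
  forall₂_congr fun t ht => forall_congr' fun x => by rw [hu t ht.1 x]

end Rep

lemma SmoothBdd.exists_rep {u : ℝ → Space → ℝ} (hu : SmoothBdd u) : ∃ U : BEvo, Rep u U := by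
  have h : SmoothRep u (Evo.mk' u hu.contDiffOn) := fun t ht x => (Evo.mk'_apply _ ht x).symm
  refine ⟨⟨Evo.mk' u hu.contDiffOn, mem_bddFunctions_of_monomials fun T m α => ?_⟩, h⟩
  obtain ⟨C, hC⟩ := hu.bounded T m α
  exact ⟨C, fun t ht x => by rw [← h.mixedDeriv m α t ht.1 x]; exact hC t ht x⟩

lemma iterate_dt_zero (m : ℕ) : dt^[m] (0 : ℝ → Space → ℝ) = 0 := by
  induction m with
  | zero => rfl
  | succ m ih =>
    rw [Function.iterate_succ_apply]
    have : dt (0 : ℝ → Space → ℝ) = 0 := by funext t x; simp [dt]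
    rw [this, ih]

lemma mixedDeriv_succ_const (m : ℕ) (α : Fin 3 → ℕ) (φ : Space → ℝ) :
    mixedDeriv (m + 1) α (fun _ => φ) = 0 := by
  have : dt (fun _ : ℝ => pdMulti α φ) = 0 := by funext t x; simp [dt]
  rw [mixedDeriv, Function.iterate_succ_apply, this, iterate_dt_zero]

lemma SmoothBddData.smoothBdd_const {φ : Space → ℝ} (hφ : SmoothBddData φ) :
    SmoothBdd fun _ => φ where
  continuousOn := (hφ.1.continuous.comp continuous_snd).continuousOn
  contDiffOn := (hφ.1.comp contDiff_snd).contDiffOn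
  bounded := fun T m α => by
    cases m with
    | zero =>
      obtain ⟨C, hC⟩ := hφ.2 α
      exact ⟨C, fun t _ x => hC x⟩
    | succ m =>
      refine ⟨0, fun t _ x => ?_⟩
      rw [mixedDeriv_succ_const]
      simp

namespace BEvo

lemma X_smul_of_rep_const {φ : Space → ℝ} {Φ : BEvo} (h : Rep (fun _ => φ) Φ) :
    (Polynomial.X : Symb) • Φ = 0 :=
  ext fun t ht x => by
    rw [← h.dt t ht x]
    simp [dt]

/-- The function that agrees with `U` for `t > 0` and with `φ` for `t ≤ 0`. -/
def extend (U : BEvo) (φ : Space → ℝ) : ℝ → Space → ℝ := fun t x => if 0 < t then U t x else φ x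

lemma rep_extend (U : BEvo) (φ : Space → ℝ) : Rep (U.extend φ) U := fun _ ht _ => if_pos ht

lemma extend_zero (U : BEvo) (φ : Space → ℝ) (x : Space) : U.extend φ 0 x = φ x :=
  if_neg (lt_irrefl _)

lemma smoothBdd_extend {U : BEvo} {φ : Space → ℝ} (h : Rep (fun _ => φ) (trace U)) :
    SmoothBdd (U.extend φ) where
  contDiffOn := U.contDiffOn.congr fun _ hp => if_pos (mem_posHalf.1 hp)
  bounded := fun T m α => by
    obtain ⟨C, -, hC⟩ := (symbMonomial m α • U).exists_stripBdd T
    exact ⟨C, (((U.rep_extend φ).mixedDeriv m α).stripBdd_iff).2 hC⟩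
  continuousOn := by
    rintro ⟨t₀, x₀⟩ hp
    have ht₀ : 0 ≤ t₀ := by simpa using hp
    rcases ht₀.eq_or_lt with rfl | ht₀
    · obtain ⟨C, hC0, hC⟩ := ((Polynomial.X : Symb) • U).exists_stripBdd 1
      have hφ : Continuous φ := by
        have : φ = trace U 1 := funext fun x => h 1 one_pos x
        rw [this]; exact continuous_space _ _
      -- Joint continuity at `t = 0`: the function differs from its initial value by a primitive,
      -- which is `O(t)` uniformly in space.
      have h1 : Tendsto (fun p : ℝ × Space => U.extend φ p.1 p.2 - φ p.2)
          (𝓝[Ici 0 ×ˢ univ] (0, x₀)) (𝓝 0) := by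
        have hb : Tendsto (fun p : ℝ × Space => C * p.1) (𝓝[Ici 0 ×ˢ univ] (0, x₀)) (𝓝 0) := by
          have : Continuous fun p : ℝ × Space => C * p.1 := by fun_prop
          simpa using (this.tendsto (0, x₀)).mono_left nhdsWithin_le_nhds
        refine squeeze_zero_norm' ?_ hb
        have h2 : ∀ᶠ p : ℝ × Space in 𝓝[Ici 0 ×ˢ univ] (0, x₀), p.1 < 1 :=
          nhdsWithin_le_nhds ((continuous_fst.tendsto (0, x₀)).eventually_lt_const one_pos)
        filter_upwards [h2, self_mem_nhdsWithin] with p hp1 hp0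
        have hp0 : 0 ≤ p.1 := hp0.1
        rcases hp0.eq_or_lt with h0 | h0
        · rw [← h0, extend_zero]; simp
        · have e : U.extend φ p.1 p.2 - φ p.2 = timeInt ((Polynomial.X : Symb) • U) p.1 p.2 := by
            rw [U.rep_extend φ _ h0, show φ p.2 = _ from h p.1 h0 p.2, trace_def]; simp
          rw [e]
          exact abs_timeInt_le hC ⟨h0, hp1.le⟩ _
      have h3 : Tendsto (fun p : ℝ × Space => φ p.2) (𝓝[Ici 0 ×ˢ univ] (0, x₀)) (𝓝 (φ x₀)) :=
        ((hφ.comp continuous_snd).tendsto (0, x₀)).mono_left nhdsWithin_le_nhds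
      have h4 := h1.add h3
      rw [zero_add] at h4
      simpa [ContinuousWithinAt, extend_zero] using h4
    · refine ContinuousAt.continuousWithinAt ((U.continuousAt ht₀ x₀).congr ?_)
      filter_upwards [isOpen_posHalf.mem_nhds (mem_posHalf.2 ht₀)] with p hp
      exact (U.rep_extend φ _ (mem_posHalf.1 hp) _).symm

end BEvo

/-- Continuity up to `t = 0` identifies the limit that defines `trace` with the value at `t = 0`. -/
lemma SmoothBdd.rep_trace {u : ℝ → Space → ℝ} (hu : SmoothBdd u) {U : BEvo} (h : Rep u U) :
    Rep (fun _ => u 0) (BEvo.trace U) := by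
  intro t ht x
  refine tendsto_nhds_unique ?_ (BEvo.tendsto_trace U x ht)
  have h1 : ContinuousWithinAt (fun s => u s x) (Ici 0) 0 :=
    (hu.continuousOn (0, x) (by simp)).comp (f := fun s : ℝ => (s, x))
      (by fun_prop) fun s hs => by simpa using hs
  refine (h1.tendsto.mono_left (nhdsWithin_mono _ Ioi_subset_Ici_self)).congr' ?_
  filter_upwards [self_mem_nhdsWithin] with s hs
  exact h s hs x

/-! ### Induction on symbols and infinite sums in `BEvo`. -/

lemma symb_mul_induction {p : Symb → Prop} (hadd : ∀ P Q, p P → p Q → p (P + Q))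
    (hmul : ∀ P Q, p P → p Q → p (P * Q)) (hC : ∀ c : ℝ, p (c • 1)) (hX : p Polynomial.X)
    (hXi : ∀ i, p (Polynomial.C (MvPolynomial.X i))) (P : Symb) : p P := by
  have h1 : ∀ q : SpacePoly, p (Polynomial.C q) := by
    intro q
    induction q using MvPolynomial.induction_on with
    | C a =>
      have : (Polynomial.C (MvPolynomial.C a) : Symb) = a • 1 := by
        rw [← mul_one (MvPolynomial.C a), ← MvPolynomial.smul_eq_C_mul, ← Polynomial.smul_C]; rfl
      rw [this]; exact hC a
    | add p q hp hq => rw [map_add]; exact hadd _ _ hp hq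
    | mul_X q i hq => rw [map_mul]; exact hmul _ _ hq (hXi i)
  induction P using Polynomial.induction_on with
  | C a => exact h1 a
  | add P Q hP hQ => exact hadd _ _ hP hQ
  | monomial n a h => rw [pow_succ, ← mul_assoc]; exact hmul _ _ h hX

lemma symb_monomial_induction {p : Symb → Prop} (hadd : ∀ P Q, p P → p Q → p (P + Q))
    (hmon : ∀ m q, p (Polynomial.X ^ m * Polynomial.C q)) (P : Symb) : p P := by
  induction P using Polynomial.induction_on' with
  | add P Q hP hQ => exact hadd _ _ hP hQ
  | monomial n a => rw [← Polynomial.C_mul_X_pow_eq_monomial, mul_comm]; exact hmon _ _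

lemma BEvo.mul_smul_symb (P Q : Symb) (u : BEvo) : (P * Q) • u = P • Q • u := mul_smul P Q u

/-- A sequence whose members are bounded on every strip by a summable sequence. -/
def SummableBdd (v : ℕ → BEvo) : Prop :=
  ∀ T, ∃ M : ℕ → ℝ, Summable M ∧ ∀ n, StripBdd T (M n) (v n)

lemma SummableBdd.congr {v w : ℕ → BEvo} (h : SummableBdd v) (e : ∀ n, v n = w n) :
    SummableBdd w := funext e ▸ h

lemma SummableBdd.summable {v : ℕ → BEvo} (h : SummableBdd v) (t : ℝ) (x : Space) :
    Summable fun n => v n t x := by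
  rcases lt_or_ge 0 t with ht | ht
  · obtain ⟨M, hM, hb⟩ := h t
    exact hM.of_norm_bounded fun n => hb n t ⟨ht, le_rfl⟩ x
  · simp [(v _).zero_of_nonpos ht, summable_zero]

/-- The pointwise sum of a sequence. -/
def sumFun (v : ℕ → BEvo) : ℝ → Space → ℝ := fun t x => ∑' n, v n t x

lemma sumFun_hasDerivAt {v : ℕ → BEvo} (h : SummableBdd v)
    (h' : SummableBdd fun n => (Polynomial.X : Symb) • v n) {t : ℝ} (ht : 0 < t) (x : Space) :
    HasDerivAt (fun s => sumFun v s x) (sumFun (fun n => (Polynomial.X : Symb) • v n) t x) t := by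
  obtain ⟨M, hM, hb⟩ := h' (t + 1)
  exact hasDerivAt_tsum_of_isPreconnected (t := Ioo 0 (t + 1)) hM isOpen_Ioo isPreconnected_Ioo
    (fun n s hs => (v n).hasDerivAt_time hs.1 x) (fun n s hs => hb n s ⟨hs.1, hs.2.le⟩ x)
    ⟨ht, by simp⟩ (h.summable t x) ⟨ht, by simp⟩

lemma sumFun_hasFDerivAt {v : ℕ → BEvo} (h : SummableBdd v)
    (h' : ∀ i, SummableBdd fun n => (MvPolynomial.X i : SpacePoly) • v n) {t : ℝ} (ht : 0 < t)
    (x : Space) : HasFDerivAt (sumFun v t)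
      (gradCLM fun i => sumFun (fun n => (MvPolynomial.X i : SpacePoly) • v n) t x) x := by
  choose M hM hb using fun i => h' i t
  have h1 := hasFDerivAt_tsum (f := fun n => v n t) (f' := fun n => (v n).grad t)
    (summable_sum fun i _ => hM i) (fun n y => (v n).hasFDerivAt_space ht y)
    (fun n y => (norm_gradCLM_le _).trans (Finset.sum_le_sum fun i _ => hb i n t ⟨ht, le_rfl⟩ y))
    (h.summable t 0) x
  refine h1.congr_fderiv ?_
  simp only [BEvo.grad, gradCLM]
  rw [Summable.tsum_finsetSum fun i _ => ((h' i).summable t x).smul_const _]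
  exact Finset.sum_congr rfl fun i _ => ((h' i).summable t x).tsum_smul_const _

/-- Termwise differentiation stays inside the family indexed by symbols, so smoothness of the sum
follows from summable bounds alone. -/
lemma isSmoothClass_sum {v : ℕ → BEvo} (h : ∀ P : Symb, SummableBdd fun n => P • v n) :
    IsSmoothClass (range fun P : Symb => sumFun fun n => P • v n) where
  zero := by
    rintro _ ⟨P, rfl⟩ t ht x
    simp [sumFun, BEvo.zero_of_nonpos _ ht]
  bdd := by
    rintro _ ⟨P, rfl⟩ T
    obtain ⟨M, hM, hb⟩ := h P T
    exact ⟨∑' n, M n, fun t ht x =>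
      tsum_of_norm_bounded (f := fun n => (P • v n) t x) hM.hasSum fun n => hb n t ht x⟩
  time := by
    rintro _ ⟨P, rfl⟩
    refine ⟨_, ⟨Polynomial.X * P, rfl⟩, fun t ht x => ?_⟩
    simp only [BEvo.mul_smul_symb]
    exact sumFun_hasDerivAt (h P) ((h (Polynomial.X * P)).congr fun n => mul_smul _ _ _) ht x
  space := by
    rintro _ ⟨P, rfl⟩
    refine ⟨_, fun i => ⟨Polynomial.C (MvPolynomial.X i) * P, rfl⟩, fun t ht x => ?_⟩
    simp only [BEvo.mul_smul_symb, BEvo.C_smul]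
    exact sumFun_hasFDerivAt (h P) (fun i =>
      (h (Polynomial.C (MvPolynomial.X i) * P)).congr fun n => by rw [mul_smul, BEvo.C_smul]) ht x

lemma exists_hasSum {v : ℕ → BEvo} (h : ∀ P : Symb, SummableBdd fun n => P • v n) :
    ∃ S : BEvo, ∀ (P : Symb) t x, HasSum (fun n => (P • v n) t x) ((P • S) t x) := by
  set F : Symb → BEvo := fun P => (isSmoothClass_sum h).toBEvo ⟨P, rfl⟩ with hF
  have hFa : ∀ P t x, F P t x = ∑' n, (P • v n) t x := fun P t x => rfl
  -- Symbols act termwise on the sum; this passes to sums and products of symbols and is verified on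
  -- the generators.
  have key : ∀ Q P, Q • F P = F (Q * P) := by
    intro Q
    induction Q using symb_mul_induction with
    | hadd Q Q' hQ hQ' =>
      intro P
      rw [add_smul, hQ, hQ', add_mul]
      refine BEvo.ext fun t _ x => ?_
      simp only [BEvo.add_apply, hFa, add_smul]
      exact (((h _).summable t x).tsum_add ((h _).summable t x)).symm
    | hmul Q Q' hQ hQ' => intro P; rw [mul_smul, hQ', hQ, mul_assoc]
    | hC c =>
      intro P
      rw [smul_assoc, one_smul, smul_mul_assoc, one_mul]
      refine BEvo.ext fun t _ x => ?_
      simp only [BEvo.smul_apply, hFa, smul_assoc]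
      exact tsum_mul_left.symm
    | hX =>
      intro P
      refine BEvo.eq_of_hasDerivAt fun t ht x => ?_
      have := sumFun_hasDerivAt (h P) ((h (Polynomial.X * P)).congr fun n => mul_smul _ _ _) ht x
      simpa only [← BEvo.mul_smul_symb] using! this
    | hXi i =>
      intro P
      rw [BEvo.C_smul]
      refine BEvo.eq_of_hasFDerivAt (v := fun i => F (Polynomial.C (MvPolynomial.X i) * P))
        (fun t ht x => ?_) i
      have := sumFun_hasFDerivAt (h P) (fun i =>
        (h (Polynomial.C (MvPolynomial.X i) * P)).congr fun n => by rw [mul_smul, BEvo.C_smul]) ht x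
      simpa only [← BEvo.C_smul, ← BEvo.mul_smul_symb] using! this
  refine ⟨F 1, fun P t x => ?_⟩
  rw [key, mul_one, hFa]
  exact ((h P).summable t x).hasSum

/-! ### Smallness of families and the renewal equation. -/

namespace BEvo

/-- Space derivatives commute with `transportInv`, time derivatives do not. The transport equation
exchanges one time derivative of the solution for the source and terms with one time derivative
less. -/
lemma X_pow_transportInv (m : ℕ) (q : SpacePoly) (a c : ℝ) (i : Fin 3) (u : BEvo) :
    ((Polynomial.X ^ (m + 1) * Polynomial.C q : Symb)) • transportInv a c i u =
      (Polynomial.X ^ m * Polynomial.C q : Symb) • u -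
      c • (Polynomial.X ^ m * Polynomial.C (q * MvPolynomial.X i) : Symb) • transportInv a c i u -
      a • (Polynomial.X ^ m * Polynomial.C q : Symb) • transportInv a c i u := by
  have h := transport_transportInv a c i u
  conv_rhs => enter [1, 1, 2]; rw [← h]
  rw [← mul_smul, ← smul_assoc, ← smul_assoc, ← sub_smul, ← sub_smul]
  congr 1
  rw [transport, map_add, ← Polynomial.smul_C, ← Polynomial.smul_C, map_mul, map_one]
  simp only [mul_add, mul_smul_comm, mul_one]
  rw [add_sub_assoc, add_sub_assoc]
  simp only [pow_succ, mul_assoc]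
  rw [mul_comm (Polynomial.C q) Polynomial.X]
  abel

/-- A notion of smallness of families of functions, in the sense of bounds of their values, that
is compatible with the solution operators of a family of transport equations. -/
structure IsSmallness {ι J : Type*} (a : ι → ℝ) (c : J → ι → ℝ) (d : J → Fin 3)
    (Sm : (ι → BEvo) → Prop) : Prop where
  add : ∀ v w, Sm v → Sm w → Sm (v + w)
  zero : Sm 0
  smul_const : ∀ (r : ℝ) v, Sm v → Sm fun i => r • v i
  smul_rate : ∀ v, Sm v → Sm fun i => a i • v i
  smul_speed : ∀ j v, Sm v → Sm fun i => c j i • v i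
  inv : ∀ j v, Sm v → Sm fun i => transportInv (a i) (c j i) (d j) (v i)

namespace IsSmallness

variable {ι J : Type*} {a : ι → ℝ} {c : J → ι → ℝ} {d : J → Fin 3} {Sm : (ι → BEvo) → Prop}

lemma neg (h : IsSmallness a c d Sm) {v : ι → BEvo} (hv : Sm v) : Sm fun i => -v i := by
  simpa only [neg_one_smul] using h.smul_const (-1) v hv

lemma sum (h : IsSmallness a c d Sm) {κ : Type*} (s : Finset κ) {v : κ → ι → BEvo}
    (hv : ∀ j ∈ s, Sm (v j)) : Sm fun i => ∑ j ∈ s, v j i := by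
  classical
  induction s using Finset.induction_on with
  | empty => simp only [Finset.sum_empty]; exact h.zero
  | insert j s hj ih =>
    simp only [Finset.sum_insert hj]
    exact h.add _ _ (hv j (by simp)) (ih fun k hk => hv k (by simp [hk]))

/-- The solution operator gains one time derivative: control up to order `m` of the source gives
control up to order `m + 1`. This gain lets the renewal equation be bootstrapped. -/
lemma transportInv (h : IsSmallness a c d Sm) (j : J) {v : ι → BEvo} {m : ℕ}
    (hv : ∀ k ≤ m, ∀ q, Sm fun i => (Polynomial.X ^ k * Polynomial.C q : Symb) • v i) :
    ∀ k ≤ m + 1, ∀ q, Sm fun i => (Polynomial.X ^ k * Polynomial.C q : Symb) •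
      transportInv (a i) (c j i) (d j) (v i) := by
  intro k
  induction k with
  | zero =>
    intro _ q
    have := h.inv j _ (hv 0 (Nat.zero_le _) q)
    simpa only [pow_zero, one_mul, C_smul, map_smul] using this
  | succ k ih =>
    intro hk q
    simp only [X_pow_transportInv, sub_eq_add_neg]
    have hk' : k ≤ m := Nat.succ_le_succ_iff.1 hk
    exact h.add _ _ (h.add _ _ (hv k hk' q) (h.neg (h.smul_speed j _ (ih (by lia) _))))
      (h.neg (h.smul_rate _ (ih (by lia) q)))

end IsSmallness

end BEvo

namespace BEvo

section Volterra

variable {b : ℝ}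

/-- The integral operator of the renewal equation. -/
def jumpOp (b : ℝ) (c : Fin 6 → ℝ) (d : Fin 6 → Fin 3) : BEvo →ₗ[SpacePoly] BEvo :=
  (b • 1 : SpacePoly) • ∑ j, transportInv (6 * b) (c j) (d j)

variable {c : Fin 6 → ℝ} {d : Fin 6 → Fin 3}

lemma jumpOp_apply (u : BEvo) :
    jumpOp b c d u = b • ∑ j, transportInv (6 * b) (c j) (d j) u := by
  rw [jumpOp, LinearMap.smul_apply, smul_assoc, one_smul, LinearMap.sum_apply]

lemma abs_jumpOp_le (hb : 0 < b) {u : BEvo} {t B : ℝ} {x : Space}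
    (h : ∀ j, |transportInv (6 * b) (c j) (d j) u t x| ≤ B) :
    |jumpOp b c d u t x| ≤ 6 * b * B := by
  rw [jumpOp_apply, smul_apply, sum_apply, abs_mul, abs_of_pos hb]
  have : |∑ j, transportInv (6 * b) (c j) (d j) u t x| ≤ 6 * B := by
    refine (Finset.abs_sum_le_sum_abs _ _).trans ((Finset.sum_le_sum fun j _ => h j).trans ?_)
    simp
  nlinarith

lemma abs_jumpOp_le_renewal (hb : 0 < b) {u : BEvo} {T r : ℝ}
    (h : ∀ s ∈ Ioc 0 T, ∀ y, |u s y| ≤ r * (1 + 6 * b * s)) {t : ℝ}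
    (ht : t ∈ Ioc 0 T) (x : Space) : |jumpOp b c d u t x| ≤ r * (6 * b * t) :=
  (abs_jumpOp_le hb fun _ => abs_transportInv_le_renewal h ht x).trans_eq (by ring)

lemma stripBdd_jumpOp (hb : 0 < b) {u : BEvo} {T C : ℝ} (h : StripBdd T C u) :
    StripBdd T ((1 - Real.exp (-(6 * b) * T)) * C) (jumpOp b c d u) := fun t ht x =>
  (abs_jumpOp_le hb fun _ => abs_transportInv_le_contraction (by positivity) h ht x).trans_eq
    (by field_simp)

lemma stripBdd_transportInv {a : ℝ} {c : ℝ} {i : Fin 3} (ha : 0 ≤ a) {u : BEvo} {T C : ℝ}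
    (h : StripBdd T C u) : StripBdd T (T * C) (transportInv a c i u) := fun t ht x => by
  have hC : 0 ≤ C := (abs_nonneg _).trans (h t ht x)
  have := abs_transportInv_le_linear (c := c) (i := i) ha h ht x
  nlinarith [ht.2]

lemma isSmallness_summableBdd (hb : 0 < b) :
    IsSmallness (fun _ : ℕ => 6 * b) (fun j _ => c j) d SummableBdd := by
  have hs : ∀ (r : ℝ) v, SummableBdd v → SummableBdd fun i => r • v i := fun r v hv T => by
    obtain ⟨M, hM, h⟩ := hv T
    exact ⟨_, hM.mul_left |r|, fun n => (h n).smul r⟩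
  refine ⟨fun v w hv hw T => ?_, fun T => ?_, hs, hs _, fun j => hs _, fun j v hv T => ?_⟩
  · obtain ⟨M, hM, h⟩ := hv T
    obtain ⟨M', hM', h'⟩ := hw T
    exact ⟨_, hM.add hM', fun n => (h n).add (h' n)⟩
  · exact ⟨0, summable_zero, fun n => stripBdd_zero le_rfl⟩
  · obtain ⟨M, hM, h⟩ := hv T
    exact ⟨_, hM.mul_left T, fun n => stripBdd_transportInv (by positivity) (h n)⟩

lemma SummableBdd_of_succ {v : ℕ → BEvo} (h : SummableBdd fun n => v (n + 1)) : SummableBdd v := by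
  intro T
  obtain ⟨M, hM, hb⟩ := h T
  obtain ⟨C, -, hC⟩ := (v 0).exists_stripBdd T
  refine ⟨fun n => Nat.casesOn n C M, (summable_nat_add_iff 1).1 hM, fun n => ?_⟩
  cases n with
  | zero => exact hC
  | succ n => exact hb n

/-- The Neumann series converges geometrically on each strip. The ratio depends on `b` and tends to
one as `b` grows, so this serves for convergence only, not for bounds uniform in `ε`. -/
lemma summableBdd_iterate_jumpOp (hb : 0 < b) (R : BEvo) :
    SummableBdd fun n => (jumpOp b c d)^[n] R := by
  intro T
  rcases lt_or_ge 0 T with hT | hT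
  · obtain ⟨C, hC0, hC⟩ := R.exists_stripBdd T
    set q := 1 - Real.exp (-(6 * b) * T) with hq
    have hq0 : 0 ≤ q := sub_nonneg.2 (Real.exp_le_one_iff.2 (by nlinarith [mul_pos hb hT]))
    have hq1 : q < 1 := sub_lt_self _ (Real.exp_pos _)
    refine ⟨fun n => q ^ n * C, (summable_geometric_of_lt_one hq0 hq1).mul_right C, fun n => ?_⟩
    induction n with
    | zero => simpa using hC
    | succ n ih =>
      change StripBdd T (q ^ (n + 1) * C) ((jumpOp b c d)^[n + 1] R)
      rw [Function.iterate_succ_apply']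
      have := stripBdd_jumpOp (c := c) (d := d) hb ih
      rwa [← hq, ← mul_assoc, ← pow_succ'] at this
  · exact ⟨0, summable_zero, fun n t ht => absurd ht.1 (ht.2.trans hT).not_gt⟩

lemma iterate_map_smul (f : BEvo →ₗ[SpacePoly] BEvo) (q : SpacePoly) (u : BEvo) (n : ℕ) :
    f^[n] (q • u) = q • f^[n] u := by
  induction n with
  | zero => rfl
  | succ n ih => rw [Function.iterate_succ_apply', Function.iterate_succ_apply', ih, map_smul]

lemma summableBdd_smul_iterate_jumpOp (hb : 0 < b) (R : BEvo) (P : Symb) :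
    SummableBdd fun n => P • (jumpOp b c d)^[n] R := by
  have hSm := isSmallness_summableBdd (c := c) (d := d) hb
  have key : ∀ m, ∀ k ≤ m, ∀ q, SummableBdd fun n =>
      (Polynomial.X ^ k * Polynomial.C q : Symb) • (jumpOp b c d)^[n] R := by
    intro m
    induction m with
    | zero =>
      intro k hk q
      obtain rfl := Nat.le_zero.1 hk
      refine (summableBdd_iterate_jumpOp (c := c) (d := d) hb (q • R)).congr fun n => ?_
      rw [pow_zero, one_mul, C_smul, iterate_map_smul]
    | succ m ih =>
      intro k hk q
      -- From the second term on, each iterate is `jumpOp` of the preceding one, and `jumpOp` gains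
      -- a time derivative.
      refine SummableBdd_of_succ ?_
      have h1 := hSm.smul_const b _ (hSm.sum Finset.univ fun j _ => hSm.transportInv j ih k hk q)
      refine h1.congr fun n => ?_
      rw [Function.iterate_succ_apply', jumpOp_apply, ← Finset.smul_sum, smul_comm]
  induction P using symb_monomial_induction with
  | hadd P Q hP hQ => exact (hSm.add _ _ hP hQ).congr fun n => (add_smul _ _ _).symm
  | hmon m q => exact key m m le_rfl q

variable (c d) in
/-- The renewal equation. -/
theorem exists_renewal (hb : 0 < b) (R : BEvo) : ∃ S : BEvo, S = R + jumpOp b c d S ∧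
    ∀ (q : SpacePoly) T r, StripBdd T r (q • R : BEvo) →
      ∀ t ∈ Ioc 0 T, ∀ x, |(q • S) t x| ≤ r * (1 + 6 * b * t) := by
  have hSm := isSmallness_summableBdd (c := c) (d := d) hb
  set v : ℕ → BEvo := fun n => (jumpOp b c d)^[n] R with hv
  have hvP : ∀ P : Symb, SummableBdd fun n => P • v n := summableBdd_smul_iterate_jumpOp hb R
  obtain ⟨S, hS⟩ := exists_hasSum hvP
  have hS1 : ∀ t x, HasSum (fun n => v n t x) (S t x) := fun t x => by simpa using! hS 1 t x
  -- The solution operator may be applied termwise: the sum `S'` of the termwise solutions has zero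
  -- trace and solves the transport equation with source `S`, which determines it.
  have hT : ∀ j t x, HasSum (fun n => transportInv (6 * b) (c j) (d j) (v n) t x)
      (transportInv (6 * b) (c j) (d j) S t x) := by
    intro j
    have hTP : ∀ P : Symb, SummableBdd fun n => P • transportInv (6 * b) (c j) (d j) (v n) := by
      intro P
      induction P using symb_monomial_induction with
      | hadd P Q hP hQ => exact (hSm.add _ _ hP hQ).congr fun n => (add_smul _ _ _).symm
      | hmon m q => exact hSm.transportInv j (m := m) (fun k _ q => hvP _) m (by lia) q
    obtain ⟨S', hS'⟩ := exists_hasSum hTP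
    have h1 : ∀ t x, HasSum (fun n => transportInv (6 * b) (c j) (d j) (v n) t x) (S' t x) :=
      fun t x => by simpa using! hS' 1 t x
    have h2 : transport (6 * b) (c j) (d j) • S' = S := ext fun t _ x => by
      have := hS' (transport (6 * b) (c j) (d j)) t x
      simp only [transport_transportInv] at this
      exact this.unique (hS1 t x)
    have h3 : trace S' = 0 := by
      rw [← map_zero trace]
      refine trace_eq_of_tendsto fun x => ?_
      obtain ⟨M, hM, hMb⟩ := hvP 1 1
      have hb0 : Tendsto (fun t : ℝ => (∑' n, M n) * t) (𝓝[>] 0) (𝓝 0) := by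
        have : Continuous fun t : ℝ => (∑' n, M n) * t := by fun_prop
        simpa using (this.tendsto 0).mono_left nhdsWithin_le_nhds
      refine squeeze_zero_norm' ?_ hb0
      filter_upwards [Ioc_mem_nhdsGT (zero_lt_one' ℝ)] with t ht
      rw [zero_apply, sub_zero, ← (h1 t x).tsum_eq]
      refine tsum_of_norm_bounded (hM.hasSum.mul_right t) fun n => ?_
      refine abs_transportInv_le_linear (by positivity) ?_ ht x
      simpa using! hMb n
    rw [← h2, transportInv_transport _ _ _ h3]
    exact h1
  refine ⟨S, ext fun t ht x => ?_, fun q T r hr t ht x => ?_⟩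
  · have h1 : HasSum (fun n => v (n + 1) t x) (jumpOp b c d S t x) := by
      have e : ∀ n, v (n + 1) t x = b * ∑ j, transportInv (6 * b) (c j) (d j) (v n) t x := by
        intro n
        rw [hv]
        simp only [Function.iterate_succ_apply']
        rw [jumpOp_apply, smul_apply, sum_apply]
      simp only [e]
      rw [jumpOp_apply, smul_apply, sum_apply]
      exact (hasSum_sum fun j _ => hT j t x).mul_left b
    have h2 := (hasSum_nat_add_iff' (f := fun n => v n t x) 1).2 (hS1 t x)
    have h3 := h2.unique h1
    simp only [Finset.sum_range_one] at h3
    rw [add_apply, ← h3]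
    simp [hv]
  -- Partial sums satisfy `P_{N+1} = R + J P_N`, where `J` is `jumpOp`, and `r (1 + 6bs)` is
  -- preserved by this recursion. Since `J` commutes with `q`, the bound needs only `q • R`.
  · have hpart : ∀ N, ∀ s ∈ Ioc 0 T, ∀ y, |(∑ n ∈ Finset.range N, q • v n) s y| ≤
        r * (1 + 6 * b * s) := by
      intro N
      induction N with
      | zero =>
        intro s hs y
        have hr0 : 0 ≤ r := (abs_nonneg _).trans (hr s hs y)
        have := hs.1
        simp only [Finset.range_zero, Finset.sum_empty, zero_apply, abs_zero]
        positivity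
      | succ N ih =>
        intro s hs y
        have e : ∑ n ∈ Finset.range (N + 1), q • v n =
            jumpOp b c d (∑ n ∈ Finset.range N, q • v n) + q • R := by
          rw [Finset.sum_range_succ', map_sum]
          refine congrArg₂ _ (Finset.sum_congr rfl fun n _ => ?_) rfl
          rw [map_smul, hv]
          simp only [Function.iterate_succ_apply']
        rw [e, add_apply]
        refine (abs_add_le _ _).trans ?_
        have h1 := abs_jumpOp_le_renewal (c := c) (d := d) hb ih hs y
        have h2 := hr s hs y
        linarith
    have hlim := (hS (Polynomial.C q) t x).tendsto_sum_nat
    simp only [C_smul] at hlim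
    refine le_of_tendsto hlim.abs (Eventually.of_forall fun N => ?_)
    rw [← sum_apply]
    exact hpart N t ht x

end Volterra

/-- Both sides solve the second transport equation with the same source, so only the zero trace of
the left side is at stake. The two symbols differ by a polynomial in the space derivatives, hence
the left side is `y` plus such a polynomial applied to a function of zero trace. -/
lemma transport_smul_transportInv (a c a' c' : ℝ) (i i' : Fin 3) {y : BEvo} (hy : trace y = 0) :
    transport a c i • transportInv a' c' i' y = transportInv a' c' i' (transport a c i • y) := by
  set z := transport a c i • transportInv a' c' i' y with hz
  have h1 : transport a' c' i' • z = transport a c i • y := by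
    rw [hz, smul_comm, transport_transportInv]
  have h2 : trace z = 0 := by
    have e : z = y + ((c • MvPolynomial.X i + a • 1) - (c' • MvPolynomial.X i' + a' • 1) :
        SpacePoly) • transportInv a' c' i' y := by
      conv_rhs => enter [1]; rw [← transport_transportInv a' c' i' y]
      rw [← C_smul, ← add_smul, hz, transport, transport, map_sub]
      congr 1
      ring
    rw [e, map_add, map_smul, hy, trace_transportInv, smul_zero, add_zero]
  rw [← h1, transportInv_transport _ _ _ h2]

lemma transportInv_comm (a c a' c' : ℝ) (i i' : Fin 3) :
    Commute (transportInv a c i : Module.End SpacePoly BEvo) (transportInv a' c' i') := by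
  refine LinearMap.ext fun v => ?_
  rw [Module.End.mul_apply, Module.End.mul_apply]
  have h := transport_smul_transportInv a' c' a c i' i (trace_transportInv a' c' i' v)
  rw [transport_transportInv] at h
  rw [← h, transportInv_transport _ _ _ (trace_transportInv _ _ _ _)]

end BEvo

/-! ### The determinant and the inversion of its factors. -/

/-- The directions of the six velocities. -/
def velDir : Fin 6 → Fin 3 := ![0, 0, 1, 1, 2, 2]

/-- The six velocities. -/
def vel (ε : ℝ) : Fin 6 → ℝ := ![ε⁻¹, -ε⁻¹, ε⁻¹, -ε⁻¹, ε⁻¹, -ε⁻¹]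

/-- The rate of the jumps between two given velocities. -/
def jumpRate (ε : ℝ) : ℝ := ε⁻¹ ^ 2 / 5

lemma jumpRate_pos {ε : ℝ} (hε : 0 < ε) : 0 < jumpRate ε := by unfold jumpRate; positivity

/-- The diagonal entries of the operator matrix, increased by the jump rate. -/
def diagSymb (ε : ℝ) (j : Fin 6) : Symb := transport (6 * jumpRate ε) (vel ε j) (velDir j)

lemma symb_funext {P Q : Symb}
    (h : ∀ (r : SpacePoly) (ξ : Fin 3 → ℝ), MvPolynomial.eval ξ (P.eval r) =
      MvPolynomial.eval ξ (Q.eval r)) : P = Q :=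
  Polynomial.funext fun r => MvPolynomial.funext fun ξ => h r ξ

/-- The regularized equation as a determinant. -/
lemma regSymb_eq {ε : ℝ} (hε : ε ≠ 0) : regSymb ε = (3125 / 7776 * ε ^ 10) • (∏ j, diagSymb ε j -
    jumpRate ε • ∑ j, ∏ k ∈ Finset.univ.erase j, diagSymb ε k) := by
  have e0 : (Finset.univ.erase (0 : Fin 6)) = {1, 2, 3, 4, 5} := by decide
  have e1 : (Finset.univ.erase (1 : Fin 6)) = {0, 2, 3, 4, 5} := by decide
  have e2 : (Finset.univ.erase (2 : Fin 6)) = {0, 1, 3, 4, 5} := by decide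
  have e3 : (Finset.univ.erase (3 : Fin 6)) = {0, 1, 2, 4, 5} := by decide
  have e4 : (Finset.univ.erase (4 : Fin 6)) = {0, 1, 2, 3, 5} := by decide
  have e5 : (Finset.univ.erase (5 : Fin 6)) = {0, 1, 2, 3, 4} := by decide
  have ev : ∀ (a c : ℝ) (i : Fin 3) (r : SpacePoly) (ξ : Fin 3 → ℝ),
      MvPolynomial.eval ξ ((transport a c i).eval r) = MvPolynomial.eval ξ r + (c * ξ i + a) := by
    intro a c i r ξ
    simp [transport, MvPolynomial.smul_eval]
  have s5 : ∀ (f : Fin 6 → Symb) {a b c d e : Fin 6}, a ≠ b → a ≠ c → a ≠ d → a ≠ e → b ≠ c →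
      b ≠ d → b ≠ e → c ≠ d → c ≠ e → d ≠ e →
      ∏ k ∈ ({a, b, c, d, e} : Finset (Fin 6)), f k = f a * f b * f c * f d * f e := by
    intro f a b c d e _ _ _ _ _ _ _ _ _ _
    rw [Finset.prod_insert (by simp [*]), Finset.prod_insert (by simp [*]),
      Finset.prod_insert (by simp [*]), Finset.prod_insert (by simp [*]), Finset.prod_singleton]
    ring
  have hI : Finset.Icc 1 5 = ({1, 2, 3, 4, 5} : Finset ℕ) := by decide
  -- Evaluation at points turns the identity of symbols into a scalar identity that is rational in
  -- `ε`.
  refine symb_funext fun r ξ => ?_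
  rw [Fin.sum_univ_six, Fin.prod_univ_six, e0, e1, e2, e3, e4, e5]
  simp only [s5 _ (by decide : (1 : Fin 6) ≠ 2) (by decide : (1 : Fin 6) ≠ 3)
    (by decide : (1 : Fin 6) ≠ 4) (by decide : (1 : Fin 6) ≠ 5) (by decide : (2 : Fin 6) ≠ 3)
    (by decide : (2 : Fin 6) ≠ 4) (by decide : (2 : Fin 6) ≠ 5) (by decide : (3 : Fin 6) ≠ 4)
    (by decide : (3 : Fin 6) ≠ 5) (by decide : (4 : Fin 6) ≠ 5)]
  rw [s5, s5, s5, s5, s5] <;> try decide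
  simp only [regSymb, hI, corrSymb, lapPoly, lap2Poly, lap3Poly, Fin.sum_univ_three,
    diagSymb, Polynomial.eval_smul, Polynomial.eval_add, Polynomial.eval_sub, Polynomial.eval_mul,
    ev, MvPolynomial.smul_eval, map_add, map_sub, map_mul]
  simp [vel, velDir, jumpRate, MvPolynomial.smul_eval]
  set τ := MvPolynomial.eval ξ r
  field_simp
  ring

namespace BEvo

/-- The solution operators of the six transport equations. -/
def diagInv (ε : ℝ) (j : Fin 6) : Module.End SpacePoly BEvo :=
  transportInv (6 * jumpRate ε) (vel ε j) (velDir j)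

lemma diagInv_comm (ε : ℝ) (i j : Fin 6) : Commute (diagInv ε i) (diagInv ε j) :=
  transportInv_comm _ _ _ _ _ _

lemma diagInv_pairwise (ε : ℝ) (s : Set (Fin 6)) :
    s.Pairwise (Function.onFun Commute (diagInv ε)) := fun _ _ _ _ _ => diagInv_comm ε _ _

/-- The product of the solution operators of some of the transport equations. -/
def prodInv (ε : ℝ) (s : Finset (Fin 6)) : Module.End SpacePoly BEvo :=
  s.noncommProd (diagInv ε) (diagInv_pairwise ε s)

lemma prodInv_insert (ε : ℝ) {s : Finset (Fin 6)} {j : Fin 6} (hj : j ∉ s) (u : BEvo) :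
    prodInv ε (insert j s) u = diagInv ε j (prodInv ε s u) := by
  rw [prodInv, Finset.noncommProd_insert_of_notMem _ _ _ _ hj]; rfl

lemma prod_smul_prodInv (ε : ℝ) (s : Finset (Fin 6)) (u : BEvo) :
    (∏ j ∈ s, diagSymb ε j) • prodInv ε s u = u := by
  induction s using Finset.induction_on with
  | empty =>
    rw [prodInv, Finset.noncommProd_empty, Finset.prod_empty, one_smul, Module.End.one_apply]
  | insert j s hj ih =>
    rw [Finset.prod_insert hj, prodInv_insert ε hj, mul_comm, mul_smul]
    have : diagSymb ε j • diagInv ε j (prodInv ε s u) = prodInv ε s u := transport_transportInv _ _ _ _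
    rw [this, ih]

/-- The inverses commute, so the `j`-th can be applied first; the remaining five cancel against the
product. -/
lemma prod_erase_smul_prodInv (ε : ℝ) (j : Fin 6) (u : BEvo) :
    (∏ k ∈ Finset.univ.erase j, diagSymb ε k) • prodInv ε Finset.univ u = diagInv ε j u := by
  have h : prodInv ε Finset.univ u = prodInv ε (Finset.univ.erase j) (diagInv ε j u) := by
    have := Finset.noncommProd_erase_mul (Finset.univ : Finset (Fin 6)) (Finset.mem_univ j)
      (diagInv ε) (diagInv_pairwise ε _)
    rw [prodInv, ← this]; rfl
  rw [h, prod_smul_prodInv]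

lemma trace_prodInv (ε : ℝ) (u : BEvo) : trace (prodInv ε Finset.univ u) = 0 := by
  have h : (Finset.univ : Finset (Fin 6)) = insert 0 (Finset.univ.erase 0) := by decide
  rw [h, prodInv_insert ε (by simp)]
  exact trace_transportInv _ _ _ _

/-- Composed with `∏ L_j⁻¹`, the determinant becomes `1 - b ∑ L_j⁻¹`, and the renewal equation says
that this maps `S` to `R`. -/
lemma regSymb_smul_prodInv {ε : ℝ} (hε : 0 < ε) {R S : BEvo}
    (hS : S = R + jumpOp (jumpRate ε) (vel ε) velDir S) :
    regSymb ε • ((3125 / 7776 * ε ^ 10)⁻¹ • prodInv ε Finset.univ S) = R := by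
  have hk : (3125 / 7776 * ε ^ 10) ≠ 0 := by positivity
  rw [regSymb_eq hε.ne', smul_assoc, smul_comm _ (_⁻¹ : ℝ), smul_inv_smul₀ hk, sub_smul,
    prod_smul_prodInv, smul_assoc, Finset.sum_smul]
  simp only [prod_erase_smul_prodInv]
  have : jumpRate ε • ∑ j, diagInv ε j S = jumpOp (jumpRate ε) (vel ε) velDir S :=
    (jumpOp_apply S).symm
  rw [this]
  exact sub_eq_of_eq_add hS

end BEvo

/-! ### Orders in `ε` and rapidly vanishing sources. -/

/-- `w ε = O(ε ^ p)` as `ε → 0+`, uniformly on strips. -/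
def SupBigO (w : ℝ → BEvo) (p : ℕ) : Prop :=
  ∀ T, ∃ C, ∀ᶠ ε in 𝓝[>] (0 : ℝ), StripBdd T (C * ε ^ p) (w ε)

/-- `w ε = O(ε ^ p)` as `ε → 0+`, with all derivatives, uniformly on strips. -/
def BigO (w : ℝ → BEvo) (p : ℕ) : Prop := ∀ P : Symb, SupBigO (fun ε => P • w ε) p

lemma eventually_pos_small (δ : ℝ) (hδ : 0 < δ) : ∀ᶠ ε in 𝓝[>] (0 : ℝ), 0 < ε ∧ ε < δ :=
  Ioo_mem_nhdsGT hδ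

namespace SupBigO

variable {v w : ℝ → BEvo} {p q : ℕ}

lemma congr' (h : SupBigO v p) (e : ∀ᶠ ε in 𝓝[>] (0 : ℝ), v ε = w ε) : SupBigO w p := fun T => by
  obtain ⟨C, hC⟩ := h T
  exact ⟨C, by filter_upwards [hC, e] with ε h1 h2; rwa [← h2]⟩

lemma congr (h : SupBigO v p) (e : ∀ ε, v ε = w ε) : SupBigO w p := funext e ▸ h

lemma exists_pos (h : SupBigO v p) (T : ℝ) :
    ∃ C, 0 ≤ C ∧ ∀ᶠ ε in 𝓝[>] (0 : ℝ), StripBdd T (C * ε ^ p) (v ε) := by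
  obtain ⟨C, hC⟩ := h T
  refine ⟨max C 0, le_max_right _ _, ?_⟩
  filter_upwards [hC, eventually_pos_small 1 one_pos] with ε h1 h2
  exact h1.mono (mul_le_mul_of_nonneg_right (le_max_left _ _) (pow_nonneg h2.1.le p))

lemma mono (h : SupBigO v p) (hq : q ≤ p) : SupBigO v q := fun T => by
  obtain ⟨C, hC0, hC⟩ := h.exists_pos T
  refine ⟨C, ?_⟩
  filter_upwards [hC, eventually_pos_small 1 one_pos] with ε h1 h2
  exact h1.mono (mul_le_mul_of_nonneg_left (pow_le_pow_of_le_one h2.1.le h2.2.le hq) hC0)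

lemma add (hv : SupBigO v p) (hw : SupBigO w p) : SupBigO (v + w) p := fun T => by
  obtain ⟨C, hC⟩ := hv T
  obtain ⟨C', hC'⟩ := hw T
  refine ⟨C + C', ?_⟩
  filter_upwards [hC, hC'] with ε h1 h2
  rw [add_mul]
  exact h1.add h2

lemma zero : SupBigO 0 p := fun _ => ⟨0, Eventually.of_forall fun ε => by
  rw [zero_mul]; exact stripBdd_zero le_rfl⟩

lemma smul_const (hv : SupBigO v p) (r : ℝ) : SupBigO (fun ε => r • v ε) p := fun T => by
  obtain ⟨C, hC⟩ := hv T
  refine ⟨|r| * C, ?_⟩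
  filter_upwards [hC] with ε h1
  rw [mul_assoc]
  exact h1.smul r

lemma smul_pow (hv : SupBigO v p) (k : ℕ) : SupBigO (fun ε => ε ^ k • v ε) (p + k) := fun T => by
  obtain ⟨C, hC⟩ := hv T
  refine ⟨C, ?_⟩
  filter_upwards [hC, eventually_pos_small 1 one_pos] with ε h1 h2
  have := h1.smul (ε ^ k)
  rwa [abs_of_pos (pow_pos h2.1 k), mul_left_comm, mul_comm (ε ^ k), ← pow_add] at this

lemma smul_inv_pow {k : ℕ} (hv : SupBigO v (p + k)) : SupBigO (fun ε => ε⁻¹ ^ k • v ε) p :=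
  fun T => by
  obtain ⟨C, hC⟩ := hv T
  refine ⟨C, ?_⟩
  filter_upwards [hC, eventually_pos_small 1 one_pos] with ε h1 h2
  have := h1.smul (ε⁻¹ ^ k)
  have h0 : ε ≠ 0 := h2.1.ne'
  have e : |ε⁻¹ ^ k| * (C * ε ^ (p + k)) = C * ε ^ p := by
    have := h2.1
    rw [abs_of_pos (by positivity), pow_add, inv_pow]
    field_simp
  rwa [e] at this

lemma const (u : BEvo) : SupBigO (fun _ => u) 0 := fun T => by
  obtain ⟨C, -, hC⟩ := u.exists_stripBdd T
  exact ⟨C, Eventually.of_forall fun ε => by rwa [pow_zero, mul_one]⟩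

end SupBigO

lemma vel_eq (ε : ℝ) (j : Fin 6) : vel ε j = ![1, -1, 1, -1, 1, -1] j * ε⁻¹ := by
  fin_cases j <;> simp [vel]

/-- Smallness must be of every order here: the rate costs `ε⁻²` and the speed `ε⁻¹`, so no fixed
order would be preserved. -/
lemma isSmallness_supBigO : BEvo.IsSmallness (fun ε => 6 * jumpRate ε) (fun j ε => vel ε j) velDir
    fun w => ∀ p, SupBigO w p where
  add v w hv hw p := (hv p).add (hw p)
  zero p := SupBigO.zero
  smul_const r v hv p := (hv p).smul_const r
  smul_rate v hv p := (((hv (p + 2)).smul_inv_pow).smul_const (6 / 5)).congr fun ε => by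
    rw [smul_smul]; congr 1; unfold jumpRate; ring
  smul_speed j v hv p := (((hv (p + 1)).smul_inv_pow).smul_const _).congr fun ε => by
    rw [vel_eq, smul_smul, pow_one]
  inv j v hv p T := by
    obtain ⟨C, hC⟩ := hv p T
    refine ⟨T * C, ?_⟩
    filter_upwards [hC, eventually_pos_small 1 one_pos] with ε h1 h2
    have := jumpRate_pos h2.1
    rw [mul_assoc]
    exact BEvo.stripBdd_transportInv (by positivity) h1

namespace BEvo

/-- Space derivatives are controlled by the linear bound `hb`; for time derivatives, `R + jumpOp S`
replaces `S` and `jumpOp` gains one derivative at a time. -/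
lemma bigO_renewal {R S : ℝ → BEvo} (hR : ∀ P : Symb, ∀ p, SupBigO (fun ε => P • R ε) p)
    (hS : ∀ ε > 0, S ε = R ε + jumpOp (jumpRate ε) (vel ε) velDir (S ε))
    (hb : ∀ ε > 0, ∀ (q : SpacePoly) T r, StripBdd T r (q • R ε : BEvo) →
      ∀ t ∈ Ioc 0 T, ∀ x, |(q • S ε) t x| ≤ r * (1 + 6 * jumpRate ε * t)) (m : ℕ) :
    ∀ k ≤ m, ∀ q, ∀ p, SupBigO (fun ε => (Polynomial.X ^ k * Polynomial.C q : Symb) • S ε) p := by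
  have hSm := isSmallness_supBigO
  induction m with
  | zero =>
    intro k hk q p T
    obtain rfl := Nat.le_zero.1 hk
    -- Two extra orders, because `1 + 6bt` is of size `ε⁻²`.
    obtain ⟨C, hC0, hC⟩ := (hR (Polynomial.C q) (p + 2)).exists_pos T
    refine ⟨C * (1 + 6 / 5 * T), ?_⟩
    filter_upwards [hC, eventually_pos_small 1 one_pos] with ε h1 h2
    intro t ht x
    rw [pow_zero, one_mul, C_smul]
    rw [C_smul] at h1
    have ht0 : 0 < t := ht.1
    have htT : t ≤ T := ht.2
    have h0 : 0 < ε := h2.1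
    refine (hb ε h2.1 q T _ h1 t ht x).trans ?_
    have e : C * ε ^ (p + 2) * (1 + 6 * jumpRate ε * t) = C * ε ^ p * (ε ^ 2 + 6 / 5 * t) := by
      unfold jumpRate; field_simp; ring
    have e2 : ε ^ 2 ≤ 1 := pow_le_one₀ h0.le h2.2.le
    calc C * ε ^ (p + 2) * (1 + 6 * jumpRate ε * t) = C * ε ^ p * (ε ^ 2 + 6 / 5 * t) := e
      _ ≤ C * ε ^ p * (1 + 6 / 5 * T) := by gcongr
      _ = _ := by ring
  | succ m ih =>
    intro k hk q
    -- Smallness is known to survive the factor `6b`, while `jumpOp` carries `b`; hence the `1 / 6`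
    -- below.
    have h1 := hSm.smul_rate _ (hSm.sum Finset.univ fun j _ => hSm.transportInv j ih k hk q)
    have h2 := hSm.add _ _ (hR (Polynomial.X ^ k * Polynomial.C q)) (hSm.smul_const (1 / 6) _ h1)
    intro p
    refine (h2 p).congr' ?_
    filter_upwards [eventually_pos_small 1 one_pos] with ε hε
    conv_rhs => rw [hS ε hε.1]
    rw [smul_add, jumpOp_apply, smul_comm _ (jumpRate ε), Finset.smul_sum]
    simp only [Pi.add_apply, smul_smul]
    congr 2
    ring

lemma bigO_prodInv {S : ℝ → BEvo} (hS : ∀ P : Symb, ∀ p, SupBigO (fun ε => P • S ε) p)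
    (s : Finset (Fin 6)) (P : Symb) : ∀ p, SupBigO (fun ε => P • prodInv ε s (S ε)) p := by
  induction s using Finset.induction_on generalizing P with
  | empty =>
    simpa only [prodInv, Finset.noncommProd_empty, Module.End.one_apply] using hS P
  | insert j s hj ih =>
    simp only [prodInv_insert _ hj]
    induction P using symb_monomial_induction with
    | hadd P Q hP hQ =>
      exact fun p => ((hP p).add (hQ p)).congr fun ε => (add_smul _ _ _).symm
    | hmon m q =>
      exact isSmallness_supBigO.transportInv j (m := m) (fun k _ q => ih _) m (by lia) q

/-- The regularized equation with a rapidly vanishing source has a rapidly vanishing solution with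
zero initial values. -/
theorem exists_regSymb_smul_eq {R : ℝ → BEvo} (hR : ∀ p, BigO R p) :
    ∃ w : ℝ → BEvo, (∀ ε > 0, regSymb ε • w ε = R ε ∧ trace (w ε) = 0) ∧ ∀ p, BigO w p := by
  have h := fun ε (hε : ε > 0) => exists_renewal (vel ε) velDir (jumpRate_pos hε) (R ε)
  choose! S hS using h
  have hSP : ∀ P : Symb, ∀ p, SupBigO (fun ε => P • S ε) p := by
    intro P
    induction P using symb_monomial_induction with
    | hadd P Q hP hQ =>
      exact fun p => ((hP p).add (hQ p)).congr fun ε => (add_smul _ _ _).symm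
    | hmon m q =>
      exact bigO_renewal (fun P p => hR p P) (fun ε hε => (hS ε hε).1) (fun ε hε => (hS ε hε).2)
        m m le_rfl q
  refine ⟨fun ε => (3125 / 7776 * ε ^ 10)⁻¹ • prodInv ε Finset.univ (S ε), fun ε hε =>
    ⟨regSymb_smul_prodInv hε (hS ε hε).1, ?_⟩, fun p P => ?_⟩
  · rw [map_real_smul, trace_prodInv, smul_zero]
  -- Ten extra orders compensate the division by `ε ^ 10`.
  · refine (((bigO_prodInv hSP Finset.univ P (p + 10)).smul_inv_pow).smul_const (7776 / 3125)).congr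
      fun ε => ?_
    rw [smul_comm P, smul_smul]
    congr 1
    rw [mul_inv, inv_pow, inv_div]

end BEvo

/-! ### Calculus of orders and the hierarchy. -/

section

namespace BigO

variable {v w : ℝ → BEvo} {p q : ℕ}

lemma congr' (h : BigO v p) (e : ∀ᶠ ε in 𝓝[>] (0 : ℝ), v ε = w ε) : BigO w p := fun P =>
  (h P).congr' (e.mono fun _ h => by rw [h])

lemma congr (h : BigO v p) (e : ∀ ε, v ε = w ε) : BigO w p := funext e ▸ h

lemma mono (h : BigO v p) (hq : q ≤ p) : BigO v q := fun P => (h P).mono hq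

lemma symb_smul (h : BigO v p) (Q : Symb) : BigO (fun ε => Q • v ε) p := fun P =>
  (h (P * Q)).congr fun _ => mul_smul _ _ _

lemma add (hv : BigO v p) (hw : BigO w p) : BigO (fun ε => v ε + w ε) p := fun P =>
  ((hv P).add (hw P)).congr fun _ => (smul_add _ _ _).symm

lemma smul_const (hv : BigO v p) (r : ℝ) : BigO (fun ε => r • v ε) p := fun P =>
  ((hv P).smul_const r).congr fun _ => smul_comm _ _ _

lemma neg (hv : BigO v p) : BigO (fun ε => -v ε) p :=
  (hv.smul_const (-1)).congr fun _ => neg_one_smul _ _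

lemma sub (hv : BigO v p) (hw : BigO w p) : BigO (fun ε => v ε - w ε) p :=
  (hv.add hw.neg).congr fun _ => (sub_eq_add_neg _ _).symm

lemma smul_pow (hv : BigO v p) (k : ℕ) : BigO (fun ε => ε ^ k • v ε) (p + k) := fun P =>
  ((hv P).smul_pow k).congr fun _ => smul_comm _ _ _

lemma zero : BigO (fun _ => 0) p := fun P => SupBigO.zero.congr fun _ => (smul_zero P).symm

lemma const (u : BEvo) : BigO (fun _ => u) 0 := fun P => SupBigO.const (P • u)

lemma sum {ι : Type*} {s : Finset ι} {v : ι → ℝ → BEvo} (h : ∀ i ∈ s, BigO (v i) p) :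
    BigO (fun ε => ∑ i ∈ s, v i ε) p := by
  classical
  induction s using Finset.induction_on with
  | empty => simpa only [Finset.sum_empty] using zero
  | insert j s hj ih =>
    simp only [Finset.sum_insert hj]
    exact (h j (by simp)).add (ih fun k hk => h k (by simp [hk]))

lemma of_monomials (h : ∀ m α, SupBigO (fun ε => symbMonomial m α • w ε) p) : BigO w p := by
  intro P
  induction P using symb_induction with
  | hadd P Q hP hQ => exact (hP.add hQ).congr fun _ => (add_smul _ _ _).symm
  | hmon c m α => exact ((h m α).smul_const c).congr fun _ => (smul_assoc _ _ _).symm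

/-- The trace is the function minus the primitive of its time derivative, both controlled on the
strip; its own time derivatives vanish. -/
lemma trace (hv : BigO v p) : BigO (fun ε => BEvo.trace (v ε)) p := by
  intro P
  induction P using symb_monomial_induction with
  | hadd P Q hP hQ => exact (hP.add hQ).congr fun _ => (add_smul _ _ _).symm
  | hmon m q =>
    cases m with
    | zero =>
      intro T
      obtain ⟨C, hC0, hC⟩ := (hv (Polynomial.C q)).exists_pos T
      obtain ⟨C', hC'0, hC'⟩ := (hv (Polynomial.X * Polynomial.C q)).exists_pos T
      refine ⟨C + C' * T, ?_⟩
      filter_upwards [hC, hC', eventually_pos_small 1 one_pos] with ε h1 h2 hε t ht x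
      rw [mul_smul, BEvo.C_smul] at h2
      rw [BEvo.C_smul] at h1
      rw [pow_zero, one_mul, BEvo.C_smul, ← map_smul, BEvo.trace_def, BEvo.sub_apply]
      have hε0 := hε.1
      have h3 := h1 t ht x
      have h4 : |BEvo.timeInt ((Polynomial.X : Symb) • q • v ε) t x| ≤ C' * ε ^ p * T :=
        (BEvo.abs_timeInt_le h2 ht x).trans (by have := ht.2; gcongr)
      refine (abs_sub _ _).trans ?_
      linarith
    | succ m =>
      refine SupBigO.zero.congr fun ε => ?_
      rw [pow_succ, mul_assoc, mul_comm Polynomial.X, ← mul_assoc, mul_smul, BEvo.X_trace, smul_zero]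
      rfl

end BigO

open BEvo

lemma regSymb_smul (ε : ℝ) (u : BEvo) : regSymb ε • u =
    heatSymb • u + ∑ j ∈ Finset.Icc 1 5, ε ^ (2 * j) • corrSymb j • u := by
  rw [regSymb, heatSymb, add_smul, Polynomial.smul_C, Finset.sum_smul]
  simp only [smul_assoc]

/-- The corrections start at `ε ^ 2`, and their derivatives cost nothing because `BigO` covers all
of them. -/
lemma BigO.corr_sum {w : ℝ → BEvo} {p : ℕ} (h : BigO w p) :
    BigO (fun ε => ∑ j ∈ Finset.Icc 1 5, ε ^ (2 * j) • corrSymb j • w ε) (p + 2) :=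
  BigO.sum fun j hj => ((h.symb_smul (corrSymb j)).smul_pow (2 * j)).mono (by
    have := (Finset.mem_Icc.1 hj).1; lia)

lemma BigO.regSymb_smul {w : ℝ → BEvo} {p : ℕ} (h : BigO w p) :
    BigO (fun ε => regSymb ε • w ε) p :=
  ((h.symb_smul heatSymb).add (h.corr_sum.mono (by lia))).congr fun ε =>
    (RandomMotion.regSymb_smul ε (w ε)).symm

/-- The symbol by which the heat flow transforms the time derivative. -/
def heatShift : Symb := Polynomial.X + Polynomial.C ((5 / 18 : ℝ) • lapPoly)

/-- The heat flow commutes with space derivatives and turns `∂/∂t` into `∂/∂t + (5 / 18) Δ`;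
generators suffice. -/
lemma smul_heat (P : Symb) (u : BEvo) : P • heat u = heat (P.comp heatShift • u) := by
  induction P using symb_mul_induction generalizing u with
  | hadd P Q hP hQ => rw [add_smul, hP, hQ, Polynomial.add_comp, add_smul, map_add]
  | hmul P Q hP hQ => rw [mul_smul, hQ, hP, Polynomial.mul_comp, mul_smul]
  | hC c => rw [smul_assoc, one_smul, Polynomial.smul_comp, Polynomial.one_comp, smul_assoc, one_smul,
      map_real_smul]
  | hX => rw [X_heat, Polynomial.X_comp, heatShift, add_smul, C_smul, smul_assoc]
  | hXi i => rw [Polynomial.C_comp, C_smul, C_smul, map_smul]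

lemma heatSymb_smul_heat (u : BEvo) : heatSymb • heat u = heat ((Polynomial.X : Symb) • u) := by
  rw [smul_heat, heatSymb, heatShift, Polynomial.sub_comp, Polynomial.X_comp, Polynomial.C_comp,
    add_sub_cancel_right]

/-- The solution of the hierarchy before application of the heat flow. -/
def hierProfile (Φ : ℕ → BEvo) (k : ℕ) : BEvo :=
  Φ k - timeInt (∑ j : Fin k, (corrSymb (k - j)).comp heatShift • hierProfile Φ j)

/-- The solution of the hierarchy. -/
def hier (Φ : ℕ → BEvo) (k : ℕ) : BEvo := heat (hierProfile Φ k)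

/-- The recursive system for the coefficients. -/
def IsHier (u : ℕ → BEvo) : Prop :=
  ∀ k, heatSymb • u k = -∑ j ∈ Finset.range k, corrSymb (k - j) • u j

/-- Under the heat flow the heat operator is `∂/∂t` and `corrSymb` is its composition with
`heatShift`, so each equation becomes the integration in time that defines `hierProfile`. -/
lemma isHier_hier {Φ : ℕ → BEvo} (hΦ : ∀ k, (Polynomial.X : Symb) • Φ k = 0) : IsHier (hier Φ) := by
  intro k
  rw [hier, heatSymb_smul_heat, hierProfile, smul_sub, hΦ, X_timeInt, zero_sub, map_neg, map_sum]
  simp only [← smul_heat]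
  rw [Finset.sum_range]
  rfl

lemma trace_hier {Φ : ℕ → BEvo} (hΦ : ∀ k, (Polynomial.X : Symb) • Φ k = 0) (k : ℕ) :
    trace (hier Φ k) = Φ k := by
  rw [hier, trace_heat, hierProfile, map_sub, trace_timeInt, sub_zero,
    trace_of_X_smul_eq_zero (hΦ k)]

lemma eq_zero_of_heatSymb {u : BEvo} (h : heatSymb • u = 0) (h0 : trace u = 0) : u = 0 :=
  BEvo.ext fun t ht x => by
    have := abs_le_of_heatSymb h0 (T := t) (A := 0) (by rw [h]; exact stripBdd_zero le_rfl)
      ⟨ht, le_rfl⟩ x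
    simpa using this

lemma IsHier.unique {u v : ℕ → BEvo} (hu : IsHier u) (hv : IsHier v)
    (h : ∀ k, trace (u k) = trace (v k)) : u = v := by
  funext k
  induction k using Nat.strong_induction_on with
  | _ k ih =>
    refine sub_eq_zero.1 (eq_zero_of_heatSymb ?_ ?_)
    · rw [smul_sub, hu, hv, sub_eq_zero]
      congr 1
      exact Finset.sum_congr rfl fun j hj => by rw [ih j (Finset.mem_range.1 hj)]
    · rw [map_sub, h, sub_self]

lemma corrSymb_of_five_lt {j : ℕ} (h : 5 < j) : corrSymb j = 0 := by
  obtain ⟨n, rfl⟩ := Nat.exists_eq_add_of_lt h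
  rw [show 5 + n + 1 = n + 6 by ring, corrSymb_add_six]

/-- The partial sums of the expansion satisfy the regularized equation up to terms of high order. -/
lemma IsHier.regSymb_smul_sum {u : ℕ → BEvo} (hu : IsHier u) (ε : ℝ) (N : ℕ) :
    regSymb ε • ∑ k ∈ Finset.range (N + 1), ε ^ (2 * k) • u k =
      ∑ j ∈ Finset.range (N + 1), ∑ i ∈ Finset.Icc 1 5,
        if N < i + j then ε ^ (2 * (i + j)) • corrSymb i • u j else 0 := by
  have hreg : ∀ k, regSymb ε • ε ^ (2 * k) • u k =
      -∑ j ∈ Finset.range k, ε ^ (2 * k) • corrSymb (k - j) • u j +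
        ∑ i ∈ Finset.Icc 1 5, ε ^ (2 * (i + k)) • corrSymb i • u k := by
    intro k
    rw [smul_comm, RandomMotion.regSymb_smul, hu k, smul_add, smul_neg, Finset.smul_sum,
      Finset.smul_sum]
    congr 1
    refine Finset.sum_congr rfl fun i _ => ?_
    rw [smul_smul, ← pow_add]
    congr 2
    ring
  induction N with
  | zero =>
    simp only [zero_add, Finset.sum_range_one]
    rw [hreg, Finset.range_zero, Finset.sum_empty, neg_zero, zero_add]
    refine Finset.sum_congr rfl fun i hi => ?_
    rw [if_pos]
    have := (Finset.mem_Icc.1 hi).1; lia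
  | succ N ih =>
    rw [Finset.sum_range_succ, smul_add, ih, hreg, Finset.sum_range_succ _ (N + 1), ← add_assoc,
      ← sub_eq_add_neg, ← Finset.sum_sub_distrib]
    congr 1
    · refine Finset.sum_congr rfl fun j hj => ?_
      have hjN := Finset.mem_range.1 hj
      -- The terms of exact order `2 * (N + 1)` leave the remainder; they are those that the
      -- equation for `u (N + 1)` cancels. When `N + 1 - j > 5` there is nothing to cancel, since
      -- the symbol is zero.
      have h1 : ∑ i ∈ Finset.Icc 1 5,
          (if i = N + 1 - j then ε ^ (2 * (i + j)) • corrSymb i • u j else 0) =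
          ε ^ (2 * (N + 1)) • corrSymb (N + 1 - j) • u j := by
        rw [Finset.sum_ite_eq' (Finset.Icc 1 5) (N + 1 - j)
          (fun i => ε ^ (2 * (i + j)) • corrSymb i • u j)]
        split_ifs with h
        · rw [Nat.sub_add_cancel hjN.le]
        · rw [corrSymb_of_five_lt (by rw [Finset.mem_Icc] at h; lia), zero_smul, smul_zero]
      rw [← h1, ← Finset.sum_sub_distrib]
      refine Finset.sum_congr rfl fun i _ => ?_
      by_cases h2 : N + 1 < i + j
      · rw [if_pos (by lia), if_neg (by lia), if_pos h2, sub_zero]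
      · by_cases h3 : i = N + 1 - j
        · rw [if_pos (by lia), if_pos h3, if_neg h2, sub_self]
        · rw [if_neg (by lia), if_neg h3, if_neg h2, sub_self]
    · refine Finset.sum_congr rfl fun i hi => ?_
      rw [if_pos]
      have := (Finset.mem_Icc.1 hi).1; lia

lemma IsHier.bigO_sum {u : ℕ → BEvo} (hu : IsHier u) (N : ℕ) :
    BigO (fun ε => regSymb ε • ∑ k ∈ Finset.range (N + 1), ε ^ (2 * k) • u k) (2 * (N + 1)) := by
  refine BigO.congr ?_ fun ε => (hu.regSymb_smul_sum ε N).symm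
  refine BigO.sum fun j _ => BigO.sum fun i _ => ?_
  split_ifs with h
  · exact (((BigO.const (u j)).symb_smul (corrSymb i)).smul_pow (2 * (i + j))).mono (by lia)
  · exact BigO.zero

end

/-! ### Borel summation. -/

section

open BEvo

lemma bigO_sum_sub_sum (u : ℕ → BEvo) {N K : ℕ} (h : N ≤ K) :
    BigO (fun ε => ∑ k ∈ Finset.range K, ε ^ (2 * k) • u k -
      ∑ k ∈ Finset.range N, ε ^ (2 * k) • u k) (2 * N) := by
  refine BigO.congr ?_ fun ε => Finset.sum_Ico_eq_sub _ h
  exact BigO.sum fun k hk => ((BigO.const (u k)).smul_pow (2 * k)).mono (by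
    have := (Finset.mem_Ico.1 hk).1; lia)

/-- Borel's lemma: every sequence is the sequence of coefficients of an asymptotic expansion. -/
lemma exists_bigO_sub_sum (u : ℕ → BEvo) : ∃ U : ℝ → BEvo, ∀ N,
    BigO (fun ε => U ε - ∑ k ∈ Finset.range N, ε ^ (2 * k) • u k) (2 * N) := by
  obtain ⟨e, he⟩ := exists_surjective_nat (ℕ × (Fin 3 → ℕ))
  -- The derivatives are enumerated, and `u k` is bounded on `0 < t ≤ k` for the first `k + 1` of
  -- them. Any given derivative and strip are covered by all but finitely many `k`.
  choose B hB0 hB using fun k i : ℕ =>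
    (symbMonomial (e i).1 (e i).2 • u k : BEvo).exists_stripBdd (k : ℝ)
  set M : ℕ → ℝ := fun k => ∑ i ∈ Finset.range (k + 1), B k i with hM
  have hM0 : ∀ k, 0 ≤ M k := fun k => Finset.sum_nonneg fun i _ => hB0 k i
  have hBM : ∀ {k i}, i ≤ k → B k i ≤ M k := fun {k i} h =>
    Finset.single_le_sum (f := B k) (fun i _ => hB0 k i) (Finset.mem_range.2 (by lia))
  -- A sharp cut-off suffices, as no regularity in `ε` is required. One power of `ε` will absorb the
  -- bound `M k`, another the number of terms, which is about `ε⁻¹`.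
  set S : ℝ → Finset ℕ := fun ε => (Finset.range ⌈ε⁻¹⌉₊).filter fun k => ε * M k ≤ 1 with hS
  refine ⟨fun ε => ∑ k ∈ S ε, ε ^ (2 * k) • u k, fun N => BigO.of_monomials fun m α T => ?_⟩
  obtain ⟨i, hi⟩ := he (m, α)
  obtain ⟨K, hNK, hiK, hTK⟩ : ∃ K, N ≤ K ∧ i ≤ K ∧ T ≤ K := by
    refine ⟨max N (max i ⌈T⌉₊), le_max_left _ _, by simp, (Nat.le_ceil T).trans ?_⟩
    exact_mod_cast (le_max_right _ _).trans (le_max_right _ _)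
  obtain ⟨C, hC⟩ := bigO_sum_sub_sum u (hNK.trans K.le_succ) (symbMonomial m α) T
  have hsub : ∀ᶠ ε in 𝓝[>] (0 : ℝ), Finset.range (K + 1) ⊆ S ε := by
    have h1 : ∀ k ∈ Finset.range (K + 1), ∀ᶠ ε in 𝓝[>] (0 : ℝ), k ∈ S ε := by
      intro k _
      filter_upwards [eventually_pos_small ((k : ℝ) + M k + 1)⁻¹ (by have := hM0 k; positivity)]
        with ε hε
      have h2 := (lt_inv_comm₀ hε.1 (by have := hM0 k; positivity)).1 hε.2
      have h3 := hM0 k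
      have h4 : (0 : ℝ) ≤ k := k.cast_nonneg
      refine Finset.mem_filter.2 ⟨Finset.mem_range.2 (Nat.lt_ceil.2 (by linarith)), ?_⟩
      rw [← le_inv_mul_iff₀ hε.1]
      linarith
    filter_upwards [(Finset.eventually_all _).2 h1] with ε hε k hk using hε k hk
  refine ⟨2 + C, ?_⟩
  filter_upwards [hC, hsub, eventually_pos_small 1 one_pos] with ε h1 h2 h3
  rw [← Finset.sum_sdiff h2, add_sub_assoc, smul_add, add_mul]
  refine StripBdd.add ?_ h1
  rw [Finset.smul_sum]
  intro t ht x
  rw [BEvo.sum_apply]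
  have hε0 := h3.1
  have hterm : ∀ k ∈ S ε \ Finset.range (K + 1),
      |(symbMonomial m α • ε ^ (2 * k) • u k : BEvo) t x| ≤ ε ^ (2 * N + 1) := by
    intro k hk
    rw [Finset.mem_sdiff, Finset.mem_range, Finset.mem_filter] at hk
    obtain ⟨⟨-, hk1⟩, hk2⟩ := hk
    have hKk : K + 1 ≤ k := not_lt.1 hk2
    have h4 : |(symbMonomial m α • u k : BEvo) t x| ≤ M k := by
      have := hB k i t ⟨ht.1, ht.2.trans (hTK.trans (by exact_mod_cast (by lia : K ≤ k)))⟩ x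
      rw [hi] at this
      exact this.trans (hBM (by lia))
    have h5 : |(symbMonomial m α • ε ^ (2 * k) • u k : BEvo) t x| =
        ε ^ (2 * k) * |(symbMonomial m α • u k : BEvo) t x| := by
      rw [smul_comm, BEvo.smul_apply, abs_mul, abs_of_pos (pow_pos hε0 _)]
    rw [h5]
    calc ε ^ (2 * k) * |(symbMonomial m α • u k : BEvo) t x| ≤ ε ^ (2 * k) * M k := by gcongr
      _ = ε ^ (2 * k - 1) * (ε * M k) := by
        rw [← mul_assoc, ← pow_succ, Nat.sub_add_cancel (by lia)]
      _ ≤ ε ^ (2 * k - 1) * 1 := by gcongr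
      -- Here `k ≥ K + 1 ≥ N + 1`, so `2 * k - 1 ≥ 2 * N + 1`: one order more than required, to be
      -- spent on the number of terms.
      _ ≤ ε ^ (2 * N + 1) := by
        rw [mul_one]; exact pow_le_pow_of_le_one hε0.le h3.2.le (by lia)
  have hcard : ((S ε \ Finset.range (K + 1)).card : ℝ) ≤ 2 * ε⁻¹ := by
    have h5 : (S ε \ Finset.range (K + 1)).card ≤ ⌈ε⁻¹⌉₊ :=
      (Finset.card_le_card (Finset.sdiff_subset.trans (Finset.filter_subset _ _))).trans
        (Finset.card_range _).le
    have h6 := (Nat.ceil_lt_add_one (inv_pos.2 hε0).le).le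
    have h7 := (one_le_inv₀ hε0).2 h3.2.le
    have h8 : ((S ε \ Finset.range (K + 1)).card : ℝ) ≤ ⌈ε⁻¹⌉₊ := by exact_mod_cast h5
    linarith
  calc |∑ k ∈ S ε \ Finset.range (K + 1), (symbMonomial m α • ε ^ (2 * k) • u k : BEvo) t x|
      ≤ ∑ k ∈ S ε \ Finset.range (K + 1), |(symbMonomial m α • ε ^ (2 * k) • u k : BEvo) t x| :=
        Finset.abs_sum_le_sum_abs _ _
    _ ≤ (S ε \ Finset.range (K + 1)).card * ε ^ (2 * N + 1) := by
        rw [← nsmul_eq_mul]; exact Finset.sum_le_card_nsmul _ _ _ hterm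
    _ ≤ 2 * ε⁻¹ * ε ^ (2 * N + 1) := by gcongr
    _ = 2 * ε ^ (2 * N) := by rw [pow_succ]; field_simp

end

/-! ### Expansions, comparison of solutions and existence. -/

section

open BEvo

/-- `F ε ∼ u₀ + ε² u₁ + ε⁴ u₂ + …` as `ε → 0+`, with all derivatives, uniformly on strips. -/
def HasBEvoExpansion (F : ℝ → BEvo) (u : ℕ → BEvo) : Prop :=
  ∀ N, BigO (fun ε => F ε - ∑ k ∈ Finset.range (N + 1), ε ^ (2 * k) • u k) (2 * (N + 1))

namespace HasBEvoExpansion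

variable {F G : ℝ → BEvo} {u v : ℕ → BEvo}

lemma trace (h : HasBEvoExpansion F u) :
    HasBEvoExpansion (fun ε => BEvo.trace (F ε)) fun k => BEvo.trace (u k) := fun N =>
  (h N).trace.congr fun ε => by
    rw [map_sub, map_sum]
    exact congrArg _ (Finset.sum_congr rfl fun k _ => map_real_smul _ _ _)

lemma bigO_sub (hF : HasBEvoExpansion F u) (hG : HasBEvoExpansion G u) (p : ℕ) :
    BigO (fun ε => F ε - G ε) p :=
  (((hF p).sub (hG p)).congr fun _ => sub_sub_sub_cancel_right _ _ _).mono (by lia)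

lemma of_bigO_sub (hF : HasBEvoExpansion F u) (h : ∀ p, BigO (fun ε => F ε - G ε) p) :
    HasBEvoExpansion G u := fun N =>
  ((hF N).sub (h _)).congr fun ε => by abel

lemma bigO_zero (hF : HasBEvoExpansion F u) : BigO F 0 :=
  (((hF 0).mono (Nat.zero_le _)).add (BigO.const (u 0))).congr fun ε => by simp

lemma regSymb_smul (hF : HasBEvoExpansion F u) (hu : IsHier u) (p : ℕ) :
    BigO (fun ε => regSymb ε • F ε) p :=
  (((hF p).regSymb_smul.add (hu.bigO_sum p)).congr fun ε => by rw [smul_sub, sub_add_cancel]).mono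
    (by lia)

/-- At the first index where they could differ, `ε ^ (2 * k)` times the difference is `O(ε ^ (2 * k
+ 2))`; divide and let `ε → 0`. -/
lemma unique (hu : HasBEvoExpansion F u) (hv : HasBEvoExpansion F v) : u = v := by
  funext k
  induction k using Nat.strong_induction_on with
  | _ k ih =>
    have h1 : BigO (fun ε => ε ^ (2 * k) • (u k - v k)) (2 * (k + 1)) :=
      ((hv k).sub (hu k)).congr fun ε => by
        rw [sub_sub_sub_cancel_left, Finset.sum_range_succ, Finset.sum_range_succ, smul_sub,
          Finset.sum_congr rfl fun j hj => by rw [ih j (Finset.mem_range.1 hj)]]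
        abel
    refine BEvo.ext fun t ht x => ?_
    obtain ⟨C, hC⟩ := h1 1 t
    have h2 : ∀ᶠ ε in 𝓝[>] (0 : ℝ), |u k t x - v k t x| ≤ C * ε ^ 2 := by
      filter_upwards [hC, eventually_pos_small 1 one_pos] with ε h hε
      have h3 := h t ⟨ht, le_rfl⟩ x
      have h4 : ((1 : Symb) • ε ^ (2 * k) • (u k - v k) : BEvo) t x =
          ε ^ (2 * k) * (u k t x - v k t x) := by
        rw [one_smul, BEvo.smul_apply, BEvo.sub_apply]
      rw [h4, abs_mul, abs_of_pos (pow_pos hε.1 _), mul_add, pow_add, mul_left_comm] at h3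
      simpa using le_of_mul_le_mul_left h3 (pow_pos hε.1 _)
    have h5 : Tendsto (fun ε : ℝ => C * ε ^ 2) (𝓝[>] 0) (𝓝 0) := by
      have : Continuous fun ε : ℝ => C * ε ^ 2 := by fun_prop
      simpa using (this.tendsto 0).mono_left nhdsWithin_le_nhds
    have h6 := ge_of_tendsto h5 h2
    exact sub_eq_zero.1 (abs_nonpos_iff.1 h6)

end HasBEvoExpansion

/-- The equation read as a heat equation whose source is two orders smaller than the solution. -/
lemma bigO_heatSymb_smul {d : ℝ → BEvo} {p : ℕ} (hd : ∀ᶠ ε in 𝓝[>] (0 : ℝ), regSymb ε • d ε = 0)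
    (h : BigO d p) : BigO (fun ε => heatSymb • d ε) (p + 2) := by
  refine h.corr_sum.neg.congr' ?_
  filter_upwards [hd] with ε hε
  rw [RandomMotion.regSymb_smul] at hε
  exact (eq_neg_of_add_eq_zero_left hε).symm

/-- A solution of an inhomogeneous heat equation with zero initial values is bounded, with all
derivatives, by the right-hand side. -/
lemma BigO.of_heatSymb_smul {d : ℝ → BEvo} {p : ℕ} (h0 : ∀ᶠ ε in 𝓝[>] (0 : ℝ), BEvo.trace (d ε) = 0)
    (h : BigO (fun ε => heatSymb • d ε) p) : BigO d p := by
  intro P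
  induction P using symb_monomial_induction with
  | hadd P Q hP hQ => exact (hP.add hQ).congr fun _ => (add_smul _ _ _).symm
  | hmon m q =>
    induction m generalizing q with
    | zero =>
      intro T
      obtain ⟨C, hC0, hC⟩ := (h (Polynomial.C q)).exists_pos T
      refine ⟨C * T, ?_⟩
      filter_upwards [hC, h0, eventually_pos_small 1 one_pos] with ε h1 h2 hε t ht x
      rw [pow_zero, one_mul, BEvo.C_smul]
      rw [BEvo.C_smul, smul_comm] at h1
      -- Space derivatives commute with the heat operator and with `trace`, so the maximum principle
      -- applies to `q • d ε`.
      have h3 := abs_le_of_heatSymb (u := q • d ε) (by rw [map_smul, h2, smul_zero]) h1 ht x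
      refine h3.trans ?_
      have := ht.2
      have := hε.1
      rw [mul_right_comm]
      gcongr
    | succ m ih =>
      refine ((h (Polynomial.X ^ m * Polynomial.C q)).add
        ((ih (q * lapPoly)).smul_const (5 / 18))).congr fun ε => ?_
      -- One time derivative is exchanged for the heat operator plus a Laplacian, which lowers the
      -- order in time.
      have e : Polynomial.X ^ m * Polynomial.C q * heatSymb +
          (5 / 18 : ℝ) • (Polynomial.X ^ m * Polynomial.C (q * lapPoly)) =
          Polynomial.X ^ (m + 1) * Polynomial.C q := by
        rw [heatSymb, ← Polynomial.smul_C, Polynomial.C_mul]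
        simp only [Algebra.smul_def]
        ring
      rw [← e, add_smul, mul_smul, smul_assoc]
      rfl

/-- A bounded family of solutions with zero initial values is small of every order. -/
lemma bigO_of_regSymb_smul_eq_zero {d : ℝ → BEvo}
    (hd : ∀ᶠ ε in 𝓝[>] (0 : ℝ), regSymb ε • d ε = 0)
    (h0 : ∀ᶠ ε in 𝓝[>] (0 : ℝ), trace (d ε) = 0) (h : BigO d 0) (p : ℕ) : BigO d p := by
  induction p with
  | zero => exact h
  | succ p ih => exact (BigO.of_heatSymb_smul h0 (bigO_heatSymb_smul hd ih)).mono (by lia)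

/-- The Borel sum is an approximate solution to every order; two corrections, of the initial value
and of the source, are themselves small of every order and leave the expansion intact. -/
lemma exists_regular_solution {Φ : ℕ → BEvo} {G : ℝ → BEvo}
    (hΦ : ∀ k, (Polynomial.X : Symb) • Φ k = 0) (hG : ∀ ε, (Polynomial.X : Symb) • G ε = 0)
    (h : HasBEvoExpansion G Φ) : ∃ F : ℝ → BEvo,
      (∀ ε > 0, regSymb ε • F ε = 0 ∧ trace (F ε) = G ε) ∧ HasBEvoExpansion F (hier Φ) := by
  obtain ⟨U, hU⟩ := exists_bigO_sub_sum (hier Φ)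
  replace hU : HasBEvoExpansion U (hier Φ) := fun N => hU (N + 1)
  have htr : HasBEvoExpansion (fun ε => trace (U ε)) Φ := by
    simpa only [trace_hier hΦ] using hU.trace
  -- The subtracted defect is constant in time and small of every order, as both traces have the
  -- expansion `Φ`.
  set V : ℝ → BEvo := fun ε => U ε - (trace (U ε) - G ε) with hV
  have hVU : HasBEvoExpansion V (hier Φ) :=
    hU.of_bigO_sub fun p => (htr.bigO_sub h p).congr fun ε => (sub_sub_cancel _ _).symm
  obtain ⟨w, hw, hw0⟩ := exists_regSymb_smul_eq (R := fun ε => regSymb ε • V ε)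
    (hVU.regSymb_smul (isHier_hier hΦ))
  refine ⟨fun ε => V ε - w ε, fun ε hε => ⟨?_, ?_⟩,
    hVU.of_bigO_sub fun p => (hw0 p).congr fun ε => (sub_sub_cancel _ _).symm⟩
  · rw [smul_sub, (hw ε hε).1, sub_self]
  · rw [map_sub, (hw ε hε).2, sub_zero, hV, map_sub, map_sub,
      trace_of_X_smul_eq_zero (X_trace (U ε)), trace_of_X_smul_eq_zero (hG ε), sub_sub_cancel]

end

/-! ### Translation of the results to plain functions. -/

section

open BEvo

lemma uniformBigO_iff {w : ℝ → ℝ → Space → ℝ} {W : ℝ → BEvo} {p : ℕ}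
    (h : ∀ᶠ ε in 𝓝[>] (0 : ℝ), Rep (w ε) (W ε)) : UniformBigO w p ↔ BigO W p := by
  have key : ∀ T m α, (∃ C : ℝ, ∀ᶠ ε in 𝓝[>] (0 : ℝ), ∀ t ∈ Ioc 0 T, ∀ x,
      |mixedDeriv m α (w ε) t x| ≤ C * ε ^ p) ↔ ∃ C : ℝ, ∀ᶠ ε in 𝓝[>] (0 : ℝ),
      StripBdd T (C * ε ^ p) (symbMonomial m α • W ε : BEvo) := fun T m α =>
    exists_congr fun C => eventually_congr (h.mono fun ε hε => (hε.mixedDeriv m α).stripBdd_iff)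
  exact ⟨fun H => BigO.of_monomials fun m α T => (key T m α).1 (H T m α),
    fun H T m α => (key T m α).2 (H (symbMonomial m α) T)⟩

lemma Rep.remainder {f : ℝ → Space → ℝ} {F : BEvo} {u : ℕ → ℝ → Space → ℝ} {U : ℕ → BEvo}
    (hf : Rep f F) (hu : ∀ k, Rep (u k) (U k)) (ε : ℝ) (N : ℕ) :
    Rep (f - ∑ k ∈ Finset.range (N + 1), ε ^ (2 * k) • u k)
      (F - ∑ k ∈ Finset.range (N + 1), ε ^ (2 * k) • U k) :=
  hf.sub (Rep.sum fun k _ => (hu k).smul _)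

lemma hasBEvoExpansion_of_data {g : ℝ → Space → ℝ} {φ : ℕ → Space → ℝ} {G : ℝ → BEvo}
    {Φ : ℕ → BEvo} (hG : ∀ᶠ ε in 𝓝[>] (0 : ℝ), Rep (fun _ => g ε) (G ε))
    (hΦ : ∀ k, Rep (fun _ => φ k) (Φ k)) (h : HasDataExpansion g φ) : HasBEvoExpansion G Φ := by
  intro N
  refine (uniformBigO_iff (w := fun ε _ => g ε - ∑ k ∈ Finset.range (N + 1), ε ^ (2 * k) • φ k)
    ?_).1 fun T m α => ?_
  · filter_upwards [hG] with ε hε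
    convert hε.remainder hΦ ε N using 1
    funext t x
    simp only [Pi.sub_apply, Finset.sum_apply, Pi.smul_apply]
  · obtain ⟨C, hC⟩ := h N α
    cases m with
    | zero => exact ⟨C, hC.mono fun ε hε t _ x => hε x⟩
    | succ m =>
      refine ⟨0, Eventually.of_forall fun ε t _ x => ?_⟩
      rw [mixedDeriv_succ_const]
      simp

lemma hierarchy_iff {u : ℕ → ℝ → Space → ℝ} {U : ℕ → BEvo} (hu : ∀ k, Rep (u k) (U k)) :
    IsHier U ↔ (∀ t > 0, ∀ x, dt (u 0) t x = 5 / 18 * lap (u 0) t x) ∧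
      ∀ k ≥ 1, ∀ t > 0, ∀ x, dt (u k) t x =
        5 / 18 * lap (u k) t x - ∑ j ∈ Finset.range k, corr (k - j) (u j) t x := by
  have key : ∀ k, heatSymb • U k = -∑ j ∈ Finset.range k, corrSymb (k - j) • U j ↔
      ∀ t > 0, ∀ x, dt (u k) t x =
        5 / 18 * lap (u k) t x - ∑ j ∈ Finset.range k, corr (k - j) (u j) t x := by
    intro k
    have h1 : Rep (dt (u k) - (5 / 18 : ℝ) • lap (u k)) (heatSymb • U k) := by
      rw [heatSymb_smul]
      exact (hu k).dt.sub ((hu k).lap.smul _)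
    have h2 : Rep (∑ j ∈ Finset.range k, corr (k - j) (u j))
        (∑ j ∈ Finset.range k, corrSymb (k - j) • U j) := Rep.sum fun j _ => (hu j).corr _
    constructor
    · intro h t ht x
      have h3 := h1 t ht x
      have h4 := h2 t ht x
      rw [h, ← zero_sub, BEvo.sub_apply, ← h4] at h3
      simp only [Pi.sub_apply, Pi.smul_apply, smul_eq_mul, BEvo.zero_apply, Finset.sum_apply] at h3
      linarith
    · intro h
      refine BEvo.ext fun t ht x => ?_
      rw [← zero_sub, BEvo.sub_apply, ← h1 t ht x, ← h2 t ht x]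
      simp only [Pi.sub_apply, Pi.smul_apply, smul_eq_mul, BEvo.zero_apply, Finset.sum_apply]
      linarith [h t ht x]
  refine ⟨fun h => ⟨fun t ht x => ?_, fun k _ => (key k).1 (h k)⟩, fun h k => (key k).2 ?_⟩
  · simpa using (key 0).1 (h 0) t ht x
  · rcases Nat.eq_zero_or_pos k with rfl | hk
    · simpa using h.1
    · exact h.2 k hk

lemma SolvesHierarchy.rep_hier {φ : ℕ → Space → ℝ} {Φ : ℕ → BEvo}
    (hΦ : ∀ k, Rep (fun _ => φ k) (Φ k)) {u : ℕ → ℝ → Space → ℝ} (hu : SolvesHierarchy φ u) (k : ℕ) :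
    Rep (u k) (hier Φ k) := by
  choose U hU using fun k => (hu.smooth k).exists_rep
  have h1 : IsHier U := (hierarchy_iff hU).2 ⟨hu.leading, hu.higher⟩
  have h2 : U = hier Φ := h1.unique (isHier_hier fun k => X_smul_of_rep_const (hΦ k)) fun k => by
    rw [trace_hier fun k => X_smul_of_rep_const (hΦ k)]
    refine ((hu.smooth k).rep_trace (hU k)).unique ?_
    rw [show u k 0 = φ k from funext (hu.initial k)]
    exact hΦ k
  exact h2 ▸ hU k

lemma SolvesHierarchy.of_rep {φ : ℕ → Space → ℝ} {Φ : ℕ → BEvo}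
    (hΦ : ∀ k, Rep (fun _ => φ k) (Φ k)) {u : ℕ → ℝ → Space → ℝ} (hu : ∀ k, SmoothBdd (u k))
    (h : ∀ k, Rep (u k) (hier Φ k)) : SolvesHierarchy φ u where
  smooth := hu
  initial k x := by
    have h1 := (hu k).rep_trace (h k) 1 one_pos x
    rw [trace_hier fun k => X_smul_of_rep_const (hΦ k), ← hΦ k 1 one_pos x] at h1
    exact h1
  leading := ((hierarchy_iff h).1 (isHier_hier fun k => X_smul_of_rep_const (hΦ k))).1
  higher := ((hierarchy_iff h).1 (isHier_hier fun k => X_smul_of_rep_const (hΦ k))).2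

/-- Regularity says only that the difference from the known solution `F'` is `O(1)`; the equation
and the common initial value improve this to every order. -/
lemma IsRegularSolution.hasBEvoExpansion {ε₀ : ℝ} (hε₀ : 0 < ε₀) {g : ℝ → Space → ℝ}
    {f : ℝ → ℝ → Space → ℝ} (hf : IsRegularSolution ε₀ g f) {F G F' : ℝ → BEvo} {u : ℕ → BEvo}
    (hF : ∀ ε ∈ Ioo 0 ε₀, Rep (f ε) (F ε)) (hG : ∀ ε ∈ Ioo 0 ε₀, Rep (fun _ => g ε) (G ε))
    (hF' : ∀ ε > 0, regSymb ε • F' ε = 0 ∧ trace (F' ε) = G ε) (hu : HasBEvoExpansion F' u) :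
    HasBEvoExpansion F u := by
  have hev : ∀ᶠ ε in 𝓝[>] (0 : ℝ), ε ∈ Ioo 0 ε₀ := eventually_pos_small ε₀ hε₀
  refine hu.of_bigO_sub (bigO_of_regSymb_smul_eq_zero ?_ ?_
    (hu.bigO_zero.sub ((uniformBigO_iff (hev.mono hF)).1 hf.regular)))
  · filter_upwards [hev] with ε hε
    have h : regSymb ε • F ε = 0 := BEvo.ext fun t ht x =>
      ((hF ε hε).regOp ε t ht x).symm.trans (hf.equation ε hε t ht x)
    rw [smul_sub, (hF' ε hε.1).1, h, sub_zero]
  · filter_upwards [hev] with ε hε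
    have h := (hf.smooth ε hε).rep_trace (hF ε hε)
    rw [show f ε 0 = g ε from funext (hf.initial ε hε)] at h
    rw [map_sub, (hF' ε hε.1).2, h.unique (hG ε hε), sub_self]

end

end RandomMotion

end

open RandomMotion

theorem mainTheorem3 (ε₀ : ℝ) (hε₀ : 0 < ε₀)
    (φ : ℕ → RandomMotion.Space → ℝ) (hφ : ∀ k, RandomMotion.SmoothBddData (φ k))
    (g : ℝ → RandomMotion.Space → ℝ) (hg : ∀ ε ∈ Set.Ioo 0 ε₀, RandomMotion.SmoothBddData (g ε))
    (hgφ : RandomMotion.HasDataExpansion g φ) :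
    (∃ u : ℕ → ℝ → RandomMotion.Space → ℝ, RandomMotion.SolvesHierarchy φ u ∧
      ∀ u' : ℕ → ℝ → RandomMotion.Space → ℝ, RandomMotion.SolvesHierarchy φ u' →
        ∀ k, ∀ t ≥ 0, ∀ x, u' k t x = u k t x) ∧
    (∃ f : ℝ → ℝ → RandomMotion.Space → ℝ, RandomMotion.IsRegularSolution ε₀ g f) ∧
    (∀ f : ℝ → ℝ → RandomMotion.Space → ℝ, RandomMotion.IsRegularSolution ε₀ g f →
      ∀ u : ℕ → ℝ → RandomMotion.Space → ℝ,
        RandomMotion.HasExpansion f u ↔ RandomMotion.SolvesHierarchy φ u) := by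
  have hev : ∀ᶠ ε in 𝓝[>] (0 : ℝ), ε ∈ Ioo 0 ε₀ := eventually_pos_small ε₀ hε₀
  choose Φ hΦ using fun k => (hφ k).smoothBdd_const.exists_rep
  -- Nothing is known about `g ε` outside the interval; zero is used there so that `G ε` is constant
  -- in time for every `ε`.
  have hG' : ∀ ε, ∃ G : BEvo, (Polynomial.X : Symb) • G = 0 ∧
      (ε ∈ Ioo 0 ε₀ → Rep (fun _ => g ε) G) := by
    intro ε
    by_cases h : ε ∈ Ioo 0 ε₀
    · obtain ⟨G, hG⟩ := (hg ε h).smoothBdd_const.exists_rep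
      exact ⟨G, BEvo.X_smul_of_rep_const hG, fun _ => hG⟩
    · exact ⟨0, smul_zero _, fun h' => absurd h' h⟩
  choose G hG0 hG using hG'
  have hX : ∀ k, (Polynomial.X : Symb) • Φ k = 0 := fun k => BEvo.X_smul_of_rep_const (hΦ k)
  obtain ⟨F, hF, hFu⟩ := exists_regular_solution hX hG0
    (hasBEvoExpansion_of_data (hev.mono hG) hΦ hgφ)
  refine ⟨⟨fun k => (hier Φ k).extend (φ k), ?_, ?_⟩, ⟨fun ε => (F ε).extend (g ε), ?_⟩, ?_⟩
  · refine SolvesHierarchy.of_rep hΦ (fun k => BEvo.smoothBdd_extend ?_) fun k => BEvo.rep_extend _ _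
    rw [trace_hier hX]
    exact hΦ k
  · intro u' hu' k t ht x
    rcases ge_iff_le.1 ht |>.eq_or_lt with rfl | ht
    · exact (hu'.initial k x).trans (BEvo.extend_zero _ _ x).symm
    · exact (hu'.rep_hier hΦ k t ht x).trans (BEvo.rep_extend _ _ t ht x).symm
  · have hreg : UniformBigO (fun ε => (F ε).extend (g ε)) 0 :=
      (uniformBigO_iff (Eventually.of_forall fun ε => BEvo.rep_extend _ _)).2 hFu.bigO_zero
    refine ⟨fun ε hε => BEvo.smoothBdd_extend ?_, fun ε hε t ht x => ?_,
      fun ε _ x => BEvo.extend_zero _ _ _, hreg⟩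
    · rw [(hF ε hε.1).2]
      exact hG ε hε
    · rw [((F ε).rep_extend (g ε)).regOp ε t ht x, (hF ε hε.1).1]
      rfl
  · intro f hf u
    have hF'' : ∀ ε, ∃ F' : BEvo, ε ∈ Ioo 0 ε₀ → Rep (f ε) F' := by
      intro ε
      by_cases h : ε ∈ Ioo 0 ε₀
      · obtain ⟨F', hF'⟩ := (hf.smooth ε h).exists_rep
        exact ⟨F', fun _ => hF'⟩
      · exact ⟨0, fun h' => absurd h' h⟩
    choose F' hF' using hF''
    have hexp := hf.hasBEvoExpansion hε₀ hF' hG hF hFu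
    have key : ∀ U : ℕ → BEvo, (∀ k, Rep (u k) (U k)) → ∀ N, UniformBigO
        (fun ε => f ε - ∑ k ∈ Finset.range (N + 1), ε ^ (2 * k) • u k) (2 * (N + 1)) ↔
        BigO (fun ε => F' ε - ∑ k ∈ Finset.range (N + 1), ε ^ (2 * k) • U k) (2 * (N + 1)) :=
      fun U hU N => uniformBigO_iff (hev.mono fun ε hε => (hF' ε hε).remainder hU ε N)
    constructor
    · intro hu
      choose U hU using fun k => (hu.coeff k).exists_rep
      have h1 : HasBEvoExpansion F' U := fun N => (key U hU N).1 (hu.remainder N)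
      rw [h1.unique hexp] at hU
      exact SolvesHierarchy.of_rep hΦ hu.coeff hU
    · intro hu
      exact ⟨hu.smooth, fun N => (key _ (hu.rep_hier hΦ) N).2 (hexp N)⟩
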